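/- \textbf{Setting.} Let $n\ge 1$, let $S_0$ be a compact smooth manifold of dimension $n$, let $a<0$, and let the future end $N_+=(a,0)\times S_0$ carry the smooth Lorentzian metric $$d\breve s^2=e^{2\tilde\psi}\{-(dx^0)^2+\sigma_{ij}(x^0,x)dx^idx^j\},\qquad \tilde\psi(x^0,x)=f(x^0)+\psi(x^0,x),$$ where the $\sigma_{ij}(x^0,\cdot)$ are Riemannian metrics on $S_0$. Assume that it is asymptotically Robertson--Walker (ARW) with respect to the future: there is a smooth Riemannian metric $\bar\sigma_{ij}$ on $S_0$ such that, as $x^0\to 0$, all space and time derivatives (of every order $\geq 0$) of $e^{-2f}\breve g_{\alpha\beta}$ converge uniformly to those of $-(dx^0)^2+\bar\sigma_{ij}(x)dx^idx^j$; $f\to-\infty$; $f'<0$; there is $\omega\in\mathbb R$ with $n+\omega-2>0$ and $\lim_{\tau\to0}|f'|^2e^{(n+\omega-2)f}=m>0$; with $\tilde\gamma=\frac12(n+\omega-2)$, the limit $\lim_{\tau\to 0}(f''+\tilde\gamma|f'|^2)$ exists, and for every $k\ge1$ there is a constant $c_k$ with $|D^k_\tau(f''+\tilde\gamma|f'|^2)|\le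 c_k|f'|^k$ and $|D^k_\tau f|\le c_k|f'|^k$. \textbf{Curvature functions.} Let $F\in C^\infty(\Gamma_+)\cap C^0(\bar\Gamma_+)$, $\Gamma_+=\{\kappa\in\mathbb R^n:\kappa_i>0\}$, denote a symmetric function, positively homogeneous of degree one, with $F(1,\dots,1)=n$, of class $(K^*)$: $\partial F/\partial\kappa_i>0$ in $\Gamma_+$, $F=0$ on $\partial\Gamma_+$ and, regarding $F$ as a function $F(h_{ij})=F(\kappa_i)$ of symmetric matrices with eigenvalues $\kappa_i>0$, with $F^{ij},F^{ij,kl}$ its first and second partial derivatives, $F^{ij,kl}\eta_{ij}\eta_{kl}\le F^{-1}(F^{ij}\eta_{ij})^2-F^{ik}\tilde h^{jl}\eta_{ij}\eta_{kl}$ for all symmetric $\eta$, where $(\tilde h^{ij})=(h_{ij})^{-1}$, and $\epsilon_0F\,\mathrm{tr}(h)\le F^{ij}h_{ik}h^k_j$ for some $\epsilon_0>0$. \textbf{Hypersurfaces.} Let $M=\{(u(x),x):x\in S_0\}\subset N_+$ be a spacelike graph with $u\in C^2(S_0)$, $x_i$ its coordinate tangent vectors, $\breve\nu$ its past directed unit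 normal, $\breve g_{ij}$ the induced metric and $\breve h_{ij}$ the second fundamental form defined by the Gauss formula $x^\alpha_{ij}=\breve h_{ij}\breve\nu^\alpha$. $M$ is called convex if its principal curvatures (the eigenvalues of $\breve h^i_j$) are positive, weakly convex if they are non-negative. $\breve F^{ij}=\partial F/\partial \breve h_{ij}$ is evaluated at $\breve h_i^j$. The sign of the curvature tensor $\breve R_{\alpha\beta\gamma\delta}$ is such that it is positive on round spheres when contracted as $R_{\alpha\beta\alpha\beta}$, and $\breve R_{\beta\delta}=\breve g^{\alpha\gamma}\breve R_{\alpha\beta\gamma\delta}$. The leaves of the inverse $F$-curvature flow (IFCF) are the hypersurfaces $M(t)=x(t,S_0)=\mathrm{graph}\,u(t,\cdot)$, where $x$ is a smooth solution on some $[0,T)$, $0<T\le\infty$, of $\dot x=-\frac1{\breve F}\breve\nu$ (with $\breve F=F(\breve h_i^j)$) with $x(t,\cdot)$ embeddings onto convex spacelike graphs in $N_+$; $M_0=M(0)$. \textbf{Lemma.} (i) If $\tilde\gamma<1$, assume in addition that $\bar\sigma_{ij}$ has non-negative sectional curvature. Then there are constants $\epsilon>0$ and $\tilde c>0$, depending only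 on $(N_+,\breve g_{\alpha\beta})$, such that for every $F$ as above $$\breve F^{ij}\breve R_{\alpha\beta\gamma\delta}\breve\nu^\alpha x^\beta_i\breve\nu^\gamma x^\delta_j\ \ge\ \tilde c\,|f'|^2e^{-2\tilde\psi}$$ at every point of each convex spacelike graph $M$ with $\inf_M x^0>-\epsilon$, and at every point of each leaf of every IFCF whose initial hypersurface satisfies $-\epsilon<\inf_{M_0}x^0$. (ii) Without any assumption on the sectional curvature of $\bar\sigma_{ij}$, there are constants $\epsilon>0$ and $\tilde c>0$, depending only on $(N_+,\breve g_{\alpha\beta})$, such that $$\breve R_{\alpha\beta}\breve\nu^\alpha\breve\nu^\beta\ \ge\ \tilde c\,|f'|^2e^{-2\tilde\psi}$$ at every point of each weakly convex spacelike graph $M$ with $\inf_M x^0>-\epsilon$, and at every point of each leaf of every IFCF, for every $F$ as above, whose initial hypersurface satisfies $-\epsilon<\inf_{M_0}x^0$. -/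

import Mathlib

open Set Filter Topology
open scoped Manifold ContDiff

noncomputable section

namespace ARW

/-! ### Semi-Riemannian geometry of a metric given in local coordinates -/

section Coordinates

variable {V : Type*} [NormedAddCommGroup V] [NormedSpace ℝ V]

/-- The Christoffel symbol `Γ(v, w) = vᵝ wᵞ Γᵅ_βγ` at `p` of the metric `G` (the coordinate
expression of a semi-Riemannian metric on an open subset of `V`):
`G (Γ(v, w), z) = ½ (∂_v G (w, z) + ∂_w G (v, z) - ∂_z G (v, w))`. -/
def christoffel (G : V → V →L[ℝ] V →L[ℝ] ℝ) (p v w : V) : V :=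
  (G p).inverse ((1 / 2 : ℝ) •
    (fderiv ℝ G p v w + fderiv ℝ G p w v - ((fderiv ℝ G p).flip v).flip w))

/-- The curvature `R(c, d) b = ∇_c ∇_d b - ∇_d ∇_c b` for constant coordinate fields. -/
def curvature (G : V → V →L[ℝ] V →L[ℝ] ℝ) (p c d b : V) : V :=
  fderiv ℝ (fun q => christoffel G q d b) p c - fderiv ℝ (fun q => christoffel G q c b) p d
    + christoffel G p c (christoffel G p d b) - christoffel G p d (christoffel G p c b)

/-- The Riemann tensor `R_αβγδ aᵅ bᵝ cᵞ dᵟ = G (R(c, d) b, a)`, with the sign for which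
`R_αβαβ > 0` on round spheres. -/
def riemann (G : V → V →L[ℝ] V →L[ℝ] ℝ) (p a b c d : V) : ℝ :=
  G p (curvature G p c d b) a

end Coordinates

/-- The coordinate space `ℝⁿ`. -/
abbrev Coord (n : ℕ) : Type := EuclideanSpace ℝ (Fin n)

/-- The coordinate vector `∂ᵢ`. -/
def coordVec {n : ℕ} (i : Fin n) : Coord n := EuclideanSpace.single i (1 : ℝ)

/-- The Ricci tensor `R_βδ bᵝ dᵟ = R^α_βαδ bᵝ dᵟ` in the coordinates `(x⁰, x¹, …, xⁿ)`. -/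
def ricci {n : ℕ} (G : ℝ × Coord n → (ℝ × Coord n) →L[ℝ] (ℝ × Coord n) →L[ℝ] ℝ)
    (p b d : ℝ × Coord n) : ℝ :=
  (curvature G p (1, 0) d b).1 + ∑ i : Fin n, (curvature G p (0, coordVec i) d b).2 i

/-- The Lorentzian metric `-(dx⁰)² + s`. -/
def lorentz {n : ℕ} (s : Coord n →L[ℝ] Coord n →L[ℝ] ℝ) :
    (ℝ × Coord n) →L[ℝ] (ℝ × Coord n) →L[ℝ] ℝ :=
  s.bilinearComp (ContinuousLinearMap.snd ℝ ℝ (Coord n)) (ContinuousLinearMap.snd ℝ ℝ (Coord n))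
    - (ContinuousLinearMap.mul ℝ ℝ).bilinearComp
        (ContinuousLinearMap.fst ℝ ℝ (Coord n)) (ContinuousLinearMap.fst ℝ ℝ (Coord n))

/-! ### Curvature functions -/

section CurvatureFunctions

variable {n : ℕ}

/-- The positive cone `Γ₊`. -/
def posCone (n : ℕ) : Set (Fin n → ℝ) := {κ | ∀ i, 0 < κ i}

/-- `κ` lists the eigenvalues of `A` with multiplicity. -/
def IsEigenvalues (A : Matrix (Fin n) (Fin n) ℝ) (κ : Fin n → ℝ) : Prop :=
  A.charpoly = ∏ i, (Polynomial.X - Polynomial.C (κ i))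

/-- `F(A) = F(κᵢ)`, where the `κᵢ` are the eigenvalues of the diagonalizable matrix `A`
(their order is irrelevant when `F` is symmetric). -/
def matrixFun (F : (Fin n → ℝ) → ℝ) (A : Matrix (Fin n) (Fin n) ℝ) : ℝ :=
  F (Classical.epsilon (IsEigenvalues A))

/-- `F^{ij} = ∂F/∂h_ij`, where `F` is evaluated at `h_i^j = g^{jk} h_ki`: the derivative in the
direction of the symmetric matrix `½ (E_ij + E_ji)`. -/
def Fup (F : (Fin n → ℝ) → ℝ) (g h : Matrix (Fin n) (Fin n) ℝ) (i j : Fin n) : ℝ :=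
  deriv (fun t : ℝ => matrixFun F
    (g⁻¹ * (h + t • ((1 / 2 : ℝ) • (Matrix.single i j 1 + Matrix.single j i 1))))) 0

/-- `F` is a smooth curvature function of class `(K*)` that is positively homogeneous of degree
one and normalized by `F(1, …, 1) = n`. -/
structure IsClassKStar (F : (Fin n → ℝ) → ℝ) : Prop where
  smooth : ContDiffOn ℝ ∞ F (posCone n)
  continuousOn : ContinuousOn F (closure (posCone n))
  symmetric : ∀ κ ∈ closure (posCone n), ∀ s : Equiv.Perm (Fin n), F (κ ∘ s) = F κ
  homogeneous : ∀ κ ∈ posCone n, ∀ t : ℝ, 0 < t → F (t • κ) = t * F κ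
  normalized : F (fun _ => 1) = n
  deriv_pos : ∀ κ ∈ posCone n, ∀ i, 0 < fderiv ℝ F κ (Pi.single i 1)
  boundary : ∀ κ ∈ frontier (posCone n), F κ = 0
  /-- `F^{ij,kl} η_ij η_kl ≤ F⁻¹ (F^{ij} η_ij)² - F^{ik} h̃^{jl} η_ij η_kl`, with `h̃ = h⁻¹`;
  the left-hand side is the second derivative of `F` at `h` in the direction `η`. -/
  classK : ∀ h η : Matrix (Fin n) (Fin n) ℝ, h.PosDef → η.IsSymm →
    iteratedDeriv 2 (fun t : ℝ => matrixFun F (h + t • η)) 0 ≤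
      (matrixFun F h)⁻¹ * (∑ i, ∑ j, Fup F 1 h i j * η i j) ^ 2
        - ∑ i, ∑ j, ∑ k, ∑ l, Fup F 1 h i k * h⁻¹ j l * η i j * η k l
  /-- `ε₀ F H ≤ F^{ij} h_ik h^k_j`, with `H` the trace of `h`. -/
  classKStar : ∃ ε₀ : ℝ, 0 < ε₀ ∧ ∀ h : Matrix (Fin n) (Fin n) ℝ, h.PosDef →
    ε₀ * matrixFun F h * h.trace ≤ ∑ i, ∑ j, Fup F 1 h i j * (h * h) i j

end CurvatureFunctions

/-! ### ARW future ends -/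

section Ambient

variable {n : ℕ} {S : Type*} [TopologicalSpace S] [ChartedSpace (Coord n) S]

/-- A field of bilinear forms on the tangent spaces of `S`. -/
abbrev BilinField (n : ℕ) (S : Type*) [TopologicalSpace S] [ChartedSpace (Coord n) S] : Type _ :=
  ∀ x : S, TangentSpace (𝓡 n) x →L[ℝ] TangentSpace (𝓡 n) x →L[ℝ] ℝ

/-- The differential at `y` of the inverse of the chart `φ`. -/
def chartInvDeriv (φ : OpenPartialHomeomorph S (Coord n)) (y : Coord n) :
    Coord n →L[ℝ] Coord n :=
  mfderiv 𝓘(ℝ, Coord n) (𝓡 n) φ.symm y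

/-- The coordinate expression of a field of bilinear forms in the chart `φ`. -/
def inChart (φ : OpenPartialHomeomorph S (Coord n)) (s : BilinField n S) (y : Coord n) :
    Coord n →L[ℝ] Coord n →L[ℝ] ℝ :=
  ContinuousLinearMap.bilinearComp (s (φ.symm y) : Coord n →L[ℝ] Coord n →L[ℝ] ℝ)
    (chartInvDeriv φ y) (chartInvDeriv φ y)

/-- `s` is pointwise a scalar product. -/
def IsScalarProduct (s : BilinField n S) : Prop :=
  ∀ x, (∀ v w, s x v w = s x w v) ∧ ∀ v, v ≠ 0 → 0 < s x v v

/-- The data of a future end `(a, 0) × S` with the metric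
`e^{2 (f(x⁰) + ψ(x⁰, x))} (-(dx⁰)² + σ(x⁰, x))`, together with a limit metric `σbar` on `S` and
the number `ω`. Only the values for `x⁰ ∈ (a, 0)` matter. -/
structure FutureEnd (n : ℕ) (S : Type*) [TopologicalSpace S] [ChartedSpace (Coord n) S] where
  a : ℝ
  f : ℝ → ℝ
  ψ : ℝ → S → ℝ
  σ : ℝ → BilinField n S
  σbar : BilinField n S
  omega : ℝ

namespace FutureEnd

variable (N : FutureEnd n S)

/-- `γ̃ = ½ (n + ω - 2)`. -/
def γ : ℝ := (1 / 2) * (n + N.omega - 2)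

/-- `ψ̃ = f + ψ`. -/
def ψt (τ : ℝ) (x : S) : ℝ := N.f τ + N.ψ τ x

/-- The metric of the future end in the coordinates `(x⁰, φ)`. -/
def metric (φ : OpenPartialHomeomorph S (Coord n)) (p : ℝ × Coord n) :
    (ℝ × Coord n) →L[ℝ] (ℝ × Coord n) →L[ℝ] ℝ :=
  Real.exp (2 * N.ψt p.1 (φ.symm p.2)) • lorentz (inChart φ (N.σ p.1) p.2)

/-- The rescaled metric `e^{-2 f}` times `metric`. -/
def rescaledMetric (φ : OpenPartialHomeomorph S (Coord n)) (p : ℝ × Coord n) :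
    (ℝ × Coord n) →L[ℝ] (ℝ × Coord n) →L[ℝ] ℝ :=
  Real.exp (-2 * N.f p.1) • N.metric φ p

/-- The limit metric `-(dx⁰)² + σbar`. -/
def limitMetric (φ : OpenPartialHomeomorph S (Coord n)) (p : ℝ × Coord n) :
    (ℝ × Coord n) →L[ℝ] (ℝ × Coord n) →L[ℝ] ℝ :=
  lorentz (inChart φ N.σbar p.2)

/-- The future end is smooth and asymptotically Robertson-Walker (ARW) with respect to the
future, the singularity being at `x⁰ = 0`. -/
structure IsARW : Prop where
  a_neg : N.a < 0
  f_smooth : ContDiffOn ℝ ∞ N.f (Ioo N.a 0)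
  ψ_smooth : ContMDiffOn (𝓘(ℝ, ℝ).prod (𝓡 n)) 𝓘(ℝ, ℝ) ∞ (fun p : ℝ × S => N.ψ p.1 p.2)
    (Ioo N.a 0 ×ˢ univ)
  σ_scalarProduct : ∀ τ ∈ Ioo N.a 0, IsScalarProduct (N.σ τ)
  σ_smooth : ∀ φ ∈ atlas (Coord n) S, ContDiffOn ℝ ∞
    (fun p : ℝ × Coord n => inChart φ (N.σ p.1) p.2) (Ioo N.a 0 ×ˢ φ.target)
  σbar_scalarProduct : IsScalarProduct N.σbar
  σbar_smooth : ∀ φ ∈ atlas (Coord n) S, ContDiffOn ℝ ∞ (inChart φ N.σbar) φ.target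
  f_tendsto : Tendsto N.f (𝓝[<] 0) atBot
  /-- All space and time derivatives of the rescaled metric converge uniformly to those of the
  limit metric (which do not depend on `x⁰`). In particular `e^ψ → 1` and `σ → σbar`. -/
  metric_tendsto : ∀ φ ∈ atlas (Coord n) S, ∀ K ⊆ φ.target, IsCompact K → ∀ k : ℕ,
    TendstoUniformlyOn (fun τ y => iteratedFDeriv ℝ k (N.rescaledMetric φ) (τ, y))
      (fun y => iteratedFDeriv ℝ k (N.limitMetric φ) (0, y)) (𝓝[<] 0) K
  f_deriv_neg : ∀ τ ∈ Ioo N.a 0, 0 < -deriv N.f τ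
  omega_pos : 0 < n + N.omega - 2
  mass : ∃ m : ℝ, 0 < m ∧
    Tendsto (fun τ => |deriv N.f τ| ^ 2 * Real.exp ((n + N.omega - 2) * N.f τ)) (𝓝[<] 0) (𝓝 m)
  f_limit : ∃ l : ℝ,
    Tendsto (fun τ => iteratedDeriv 2 N.f τ + N.γ * |deriv N.f τ| ^ 2) (𝓝[<] 0) (𝓝 l)
  f_bound₁ : ∀ k : ℕ, 1 ≤ k → ∃ c : ℝ, ∀ τ ∈ Ioo N.a 0,
    |iteratedDeriv k (fun s => iteratedDeriv 2 N.f s + N.γ * |deriv N.f s| ^ 2) τ|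
      ≤ c * |deriv N.f τ| ^ k
  f_bound₂ : ∀ k : ℕ, 1 ≤ k → ∃ c : ℝ, ∀ τ ∈ Ioo N.a 0,
    |iteratedDeriv k N.f τ| ≤ c * |deriv N.f τ| ^ k

/-- The limit metric `σbar` on `S` has non-negative sectional curvature. -/
def NonnegSectional : Prop :=
  ∀ φ ∈ atlas (Coord n) S, ∀ y ∈ φ.target, ∀ v w : Coord n,
    0 ≤ riemann (inChart φ N.σbar) y v w v w

/-! ### Spacelike graphs

`u : S → ℝ` describes `graph u = {(u x, x)}`. Everything is written in the coordinates
`(x⁰, φ)` of the future end and `φ` of the graph, at the point `y` of the chart. -/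

section Graph

variable (u : S → ℝ) (φ : OpenPartialHomeomorph S (Coord n)) (y : Coord n)

/-- The point of the graph above `y`. -/
def graphPt : ℝ × Coord n := (u (φ.symm y), y)

/-- The differential of `u` in the chart. -/
def du : Coord n →L[ℝ] ℝ := fderiv ℝ (u ∘ φ.symm) y

/-- The tangent vector `x_i = (u_i, ∂_i)` of the graph. -/
def tangentVec (i : Fin n) : ℝ × Coord n := (du u φ y (coordVec i), coordVec i)

/-- The gradient `u^i = σ^{ij} u_j`, with `σ` evaluated on the graph. -/
def gradU : Coord n := (inChart φ (N.σ (u (φ.symm y))) y).inverse (du u φ y)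

/-- `v = (1 - σ^{ij} u_i u_j)^{1/2}`. -/
def v : ℝ := Real.sqrt (1 - du u φ y (N.gradU u φ y))

/-- The past directed unit normal `ν = -v⁻¹ e^{-ψ̃} (1, u^i)`. -/
def normal : ℝ × Coord n :=
  -((N.v u φ y)⁻¹ * Real.exp (-N.ψt (u (φ.symm y)) (φ.symm y))) • ((1 : ℝ), N.gradU u φ y)

/-- The induced metric `g_ij`. -/
def inducedMetric : Matrix (Fin n) (Fin n) ℝ := Matrix.of fun i j =>
  N.metric φ (graphPt u φ y) (tangentVec u φ y i) (tangentVec u φ y j)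

/-- The second fundamental form `h_ij` with respect to the past directed normal. By the Gauss
formula `x_ij = h_ij ν` and `⟨ν, ν⟩ = -1` it is `-⟨x_ij, ν⟩`; the part of `x_ij` tangential to
the graph does not contribute to this product and is left out. -/
def secondFF : Matrix (Fin n) (Fin n) ℝ := Matrix.of fun i j =>
  -N.metric φ (graphPt u φ y)
    ((fderiv ℝ (fderiv ℝ (u ∘ φ.symm)) y (coordVec i) (coordVec j), (0 : Coord n))
      + christoffel (N.metric φ) (graphPt u φ y) (tangentVec u φ y i) (tangentVec u φ y j))
    (N.normal u φ y)

/-- The curvature `F(h_i^j)` of the graph. -/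
def graphCurvature (F : (Fin n → ℝ) → ℝ) : ℝ :=
  matrixFun F ((N.inducedMetric u φ y)⁻¹ * N.secondFF u φ y)

/-- `F^{ij} R_αβγδ ν^α x^β_i ν^γ x^δ_j`, with `F^{ij}` evaluated at `h_i^j`. -/
def curvatureTerm (F : (Fin n → ℝ) → ℝ) : ℝ :=
  ∑ i, ∑ j, Fup F (N.inducedMetric u φ y) (N.secondFF u φ y) i j *
    riemann (N.metric φ) (graphPt u φ y)
      (N.normal u φ y) (tangentVec u φ y i) (N.normal u φ y) (tangentVec u φ y j)

/-- `R_αβ ν^α ν^β`. -/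
def ricciTerm : ℝ :=
  ricci (N.metric φ) (graphPt u φ y) (N.normal u φ y) (N.normal u φ y)

/-- `|f'|² e^{-2 ψ̃}` on the graph. -/
def weight : ℝ :=
  |deriv N.f (u (φ.symm y))| ^ 2 * Real.exp (-2 * N.ψt (u (φ.symm y)) (φ.symm y))

end Graph

/-- `graph u` is a spacelike hypersurface of class `C²` in the future end. -/
structure IsSpacelikeGraph (u : S → ℝ) : Prop where
  contMDiff : ContMDiff (𝓡 n) 𝓘(ℝ, ℝ) 2 u
  mem : ∀ x, u x ∈ Ioo N.a 0
  spacelike : ∀ φ ∈ atlas (Coord n) S, ∀ y ∈ φ.target, (N.inducedMetric u φ y).PosDef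

/-- All principal curvatures are non-negative. -/
def IsWeaklyConvex (u : S → ℝ) : Prop :=
  ∀ φ ∈ atlas (Coord n) S, ∀ y ∈ φ.target, (N.secondFF u φ y).PosSemidef

/-- All principal curvatures are positive, i.e. they lie in `Γ₊`. -/
def IsStrictlyConvex (u : S → ℝ) : Prop :=
  ∀ φ ∈ atlas (Coord n) S, ∀ y ∈ φ.target, (N.secondFF u φ y).PosDef

/-- The time interval `[0, T)`, where `T` may be infinite. -/
def timeInterval (T : EReal) : Set ℝ := {t | 0 ≤ t ∧ (t : EReal) < T}

/-- `x` is a smooth solution of the inverse `F`-curvature flow `ẋ = -F⁻¹ ν` on `[0, T)`, whose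
leaves `x(t, S) = graph u(t, ·)` are spacelike, convex graphs. -/
structure IsIFCF (F : (Fin n → ℝ) → ℝ) (T : EReal) (x : ℝ → S → ℝ × S) (u : ℝ → S → ℝ) :
    Prop where
  T_pos : 0 < T
  smooth : ContMDiffOn (𝓘(ℝ, ℝ).prod (𝓡 n)) (𝓘(ℝ, ℝ).prod (𝓡 n)) ∞
    (fun p : ℝ × S => x p.1 p.2) (timeInterval T ×ˢ univ)
  embedding : ∀ t ∈ timeInterval T, ∃ Φ : S ≃ₘ⟮𝓡 n, 𝓡 n⟯ S, ∀ ξ, x t ξ = (u t (Φ ξ), Φ ξ)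
  spacelike : ∀ t ∈ timeInterval T, N.IsSpacelikeGraph (u t)
  convex : ∀ t ∈ timeInterval T, N.IsStrictlyConvex (u t)
  evolution : ∀ t ∈ timeInterval T, ∀ ξ, ∀ φ ∈ atlas (Coord n) S, (x t ξ).2 ∈ φ.source →
    HasDerivWithinAt (fun s => ((x s ξ).1, φ (x s ξ).2))
      (-(N.graphCurvature (u t) φ (φ (x t ξ).2) F)⁻¹ • N.normal (u t) φ (φ (x t ξ).2))
      (timeInterval T) t

end FutureEnd

end Ambient

end ARW

end

/-!
In the coordinates `(x⁰, φ)` the metric of the future end is `G = e^{2 f(x⁰)} G̃`, where the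
rescaled metric `G̃` converges with all its derivatives to `-(dx⁰)² + σbar`, while `|f'| → ∞` and
`f'' / |f'|² → -γ̃` (the last two follow from the condition on the mass and the boundedness of
`f'' + γ̃ |f'|²`). The formula for the curvature under a conformal change writes the curvature of
`G` as `|f'|²` times a continuous function of the 2-jet of `G̃`, of `1 / f'` and of `f'' / |f'|²`
(`IsConformalAt.curvature_eq`). As `x⁰ → 0` everything that involves a derivative of `G̃` is
multiplied by a power of `1 / f'` and disappears; what is left is the quadratic form
`γ̃ |X⁰ η - Y⁰ ξ|² + |ξ ∧ η|²` in `X = (X⁰, ξ)` and `Y = (Y⁰, η)` (`curv_limit`). It dominates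
`min (γ̃, 1)` times the squared area of the parallelogram spanned by `X` and `Y` in the Riemannian
metric `(dx⁰)² + σbar`. By compactness of `S` and of the set of pairs of orthogonal vectors of norm
one, near the singularity the curvature form is therefore at least
`½ min (γ̃, 1) |f'|² e^{2 ψ̃}` times the squared area for `(dx⁰)² + σ`, in all charts
(`FutureEnd.IsARW.exists_curvatureBound`). The Riemannian curvature of `σbar` enters only the terms
of lower order, so that no sign of it is needed.

For a spacelike graph the squared area spanned by the normal and a tangent vector is at least
`e^{-4 ψ̃}` times the induced metric of the tangent vector, however steep the graph is
(`FutureEnd.IsARW.metric_tangent_le`). Hence the form `R_αβγδ ν^α x^β_i ν^γ x^δ_j` is bounded from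
below by `½ min (γ̃, 1) |f'|² e^{-2 ψ̃} g_ij`, and both estimates follow by contraction. The
contraction with `g^{ij}` is the Ricci curvature of `ν` (`FutureEnd.IsARW.ricciTerm_eq`). For the
contraction with `F^{ij}` one needs `F^{ij} g_ij ≥ n` (`IsClassKStar.le_sum_fderiv`): the condition
of class `(K)`, tested with diagonal matrices, shows that `F` is concave in `Γ₊`, and `F` is
homogeneous with `F(1, …, 1) = n`. To express `F^{ij}` through the partial derivatives of `F` one
has to differentiate a symmetric function of the eigenvalues of a matrix, also where eigenvalues
coincide; this is `hasDerivAt_matrixFun`, which rests on the Hoffman-Wielandt inequality.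

Along the inverse curvature flow `x⁰` does not decrease, since `F ≥ 0` and `-ν` is future directed
(`FutureEnd.IsIFCF.fst_le_fst`), so that all leaves lie above the lower bound of the initial
hypersurface and the estimates for graphs apply to them.
-/

noncomputable section

namespace ARW

/-! ### Symmetric functions of the eigenvalues of a matrix -/

section SpectralFunctions

open Matrix

variable {n : ℕ}

theorem exists_orthogonal_diagonal {A : Matrix (Fin n) (Fin n) ℝ} (hA : A.IsSymm) :
    ∃ (U : Matrix (Fin n) (Fin n) ℝ) (κ : Fin n → ℝ),
      Uᵀ * U = 1 ∧ U * Uᵀ = 1 ∧ Uᵀ * A * U = diagonal κ := by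
  have hH : A.IsHermitian := by rw [IsHermitian, conjTranspose_eq_transpose_of_trivial]; exact hA
  have h := hH.conjStarAlgAut_star_eigenvectorUnitary
  have h1 := hH.eigenvectorUnitary.2.1
  have h2 := hH.eigenvectorUnitary.2.2
  rw [star_eq_conjTranspose, conjTranspose_eq_transpose_of_trivial] at h1 h2
  refine ⟨hH.eigenvectorUnitary, hH.eigenvalues, h1, h2, ?_⟩
  rw [Unitary.conjStarAlgAut_apply] at h
  simpa [star_eq_conjTranspose, conjTranspose_eq_transpose_of_trivial] using h

theorem isEigenvalues_conj {W W' : Matrix (Fin n) (Fin n) ℝ} (h : W' * W = 1) (κ : Fin n → ℝ) :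
    IsEigenvalues (W * diagonal κ * W') κ := by
  rw [IsEigenvalues, charpoly_mul_comm, ← mul_assoc, h, one_mul, charpoly_diagonal]

theorem isEigenvalues_conj_iff {W W' A : Matrix (Fin n) (Fin n) ℝ} (h : W' * W = 1)
    (κ : Fin n → ℝ) : IsEigenvalues (W * A * W') κ ↔ IsEigenvalues A κ := by
  rw [IsEigenvalues, charpoly_mul_comm, ← mul_assoc, h, one_mul, IsEigenvalues]

theorem matrixFun_conj {W W' A : Matrix (Fin n) (Fin n) ℝ} (h : W' * W = 1)
    (F : (Fin n → ℝ) → ℝ) : matrixFun F (W * A * W') = matrixFun F A := by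
  have : IsEigenvalues (W * A * W') = IsEigenvalues A :=
    funext fun κ => propext (isEigenvalues_conj_iff h κ)
  rw [matrixFun, matrixFun, this]

/-- Two lists of eigenvalues of the same matrix agree up to a permutation. -/
theorem IsEigenvalues.exists_perm {A : Matrix (Fin n) (Fin n) ℝ} {κ κ' : Fin n → ℝ}
    (h : IsEigenvalues A κ) (h' : IsEigenvalues A κ') : ∃ s : Equiv.Perm (Fin n), κ' = κ ∘ s := by
  have hm : Finset.univ.val.map κ' = Finset.univ.val.map κ := by
    have key : ∀ μ : Fin n → ℝ, IsEigenvalues A μ → A.charpoly.roots = Finset.univ.val.map μ := by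
      intro μ hμ
      have h3 := Polynomial.roots_multiset_prod_X_sub_C (Finset.univ.val.map μ)
      rw [Multiset.map_map] at h3
      rw [IsEigenvalues] at hμ
      rw [hμ]
      exact h3
    rw [← key κ h, ← key κ' h']
  have hc : ∀ c : ℝ, Fintype.card {i // κ' i = c} = Fintype.card {i // κ i = c} := by
    intro c
    have h1 := congrArg (Multiset.count c) hm
    rw [Multiset.count_map, Multiset.count_map] at h1
    rw [Fintype.card_subtype, Fintype.card_subtype]
    simp only [eq_comm (a := c)] at h1
    exact h1
  refine ⟨Equiv.ofFiberEquiv (f := κ') (g := κ) fun c => Fintype.equivOfCardEq (hc c), ?_⟩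
  funext i
  exact (Equiv.ofFiberEquiv_map _ i).symm

theorem matrixFun_eq {F : (Fin n → ℝ) → ℝ}
    (hF : ∀ κ ∈ closure (posCone n), ∀ s : Equiv.Perm (Fin n), F (κ ∘ s) = F κ)
    {A : Matrix (Fin n) (Fin n) ℝ} {κ : Fin n → ℝ} (h : IsEigenvalues A κ)
    (hκ : κ ∈ posCone n) : matrixFun F A = F κ := by
  obtain ⟨s, hs⟩ := h.exists_perm (Classical.epsilon_spec (p := IsEigenvalues A) ⟨κ, h⟩)
  rw [matrixFun, hs, hF κ (subset_closure hκ)]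

theorem sum_sq_eq_trace (X : Matrix (Fin n) (Fin n) ℝ) :
    ∑ i, ∑ j, X i j ^ 2 = (X * Xᵀ).trace := by
  simp [trace, mul_apply, sq]

/-- The **Hoffman-Wielandt inequality** for the comparison with a diagonal matrix. The squares of
the entries of an orthogonal matrix form a doubly stochastic matrix, hence a convex combination
of permutation matrices, and one of these permutations provides the enumeration. -/
theorem exists_eigenvalues_near {B : Matrix (Fin n) (Fin n) ℝ} (hB : B.IsSymm) (κ : Fin n → ℝ) :
    ∃ (U : Matrix (Fin n) (Fin n) ℝ) (μ : Fin n → ℝ), Uᵀ * U = 1 ∧ B = U * diagonal μ * Uᵀ ∧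
      ∑ i, (μ i - κ i) ^ 2 ≤ ∑ i, ∑ j, (B - diagonal κ) i j ^ 2 := by
  obtain ⟨U, μ, h1, h2, h3⟩ := exists_orthogonal_diagonal hB
  have hBU : B = U * diagonal μ * Uᵀ := by
    rw [← h3]
    calc B = (U * Uᵀ) * B * (U * Uᵀ) := by rw [h2, one_mul, mul_one]
      _ = _ := by simp only [mul_assoc]
  have hM : (Matrix.of fun i j => U i j ^ 2) ∈ doublyStochastic ℝ (Fin n) := by
    rw [mem_doublyStochastic_iff_sum]
    refine ⟨fun i j => sq_nonneg _, fun i => ?_, fun j => ?_⟩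
    · have := congrFun (congrFun h2 i) i
      simpa [mul_apply, sq] using this
    · have := congrFun (congrFun h1 j) j
      simpa [mul_apply, sq] using this
  obtain ⟨w, hw0, hw1, hw⟩ := exists_eq_sum_perm_of_mem_doublyStochastic hM
  have hfrob : ∑ i, ∑ j, (B - diagonal κ) i j ^ 2 = ∑ i, ∑ j, U i j ^ 2 * (μ j - κ i) ^ 2 := by
    have h4 : (B - diagonal κ) * U = Matrix.of fun i j => U i j * (μ j - κ i) := by
      have : B * U = U * diagonal μ := by rw [hBU, mul_assoc, h1, mul_one]
      rw [sub_mul, this]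
      ext i j
      simp [mul_diagonal, diagonal_mul]
      ring
    have h5 : (B - diagonal κ) * (B - diagonal κ)ᵀ
        = ((B - diagonal κ) * U) * ((B - diagonal κ) * U)ᵀ := by
      rw [transpose_mul, mul_assoc, ← mul_assoc U, h2, one_mul]
    rw [sum_sq_eq_trace, h5, ← sum_sq_eq_trace, h4]
    simp [mul_pow]
  have hsum : ∑ i, ∑ j, U i j ^ 2 * (μ j - κ i) ^ 2
      = ∑ σ : Equiv.Perm (Fin n), w σ * ∑ i, (μ (σ i) - κ i) ^ 2 := by
    have h6 : ∀ i j, U i j ^ 2 = ∑ σ : Equiv.Perm (Fin n), w σ * (if σ i = j then 1 else 0) := by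
      intro i j
      have := congrFun (congrFun hw i) j
      simp only [Matrix.sum_apply, Matrix.smul_apply, PEquiv.toMatrix_apply, Matrix.of_apply,
        smul_eq_mul, Equiv.toPEquiv_apply, Option.mem_def, Option.some.injEq] at this
      exact this.symm
    simp only [h6, Finset.sum_mul, Finset.mul_sum]
    have h7 : ∀ i, ∑ j, ∑ σ : Equiv.Perm (Fin n),
        w σ * (if σ i = j then 1 else 0) * (μ j - κ i) ^ 2
        = ∑ σ : Equiv.Perm (Fin n), w σ * (μ (σ i) - κ i) ^ 2 := by
      intro i
      rw [Finset.sum_comm]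
      refine Finset.sum_congr rfl fun σ _ => ?_
      simp
    rw [Finset.sum_congr rfl fun i _ => h7 i, Finset.sum_comm]
  obtain ⟨σ, hσ⟩ : ∃ σ : Equiv.Perm (Fin n),
      ∑ i, (μ (σ i) - κ i) ^ 2 ≤ ∑ i, ∑ j, (B - diagonal κ) i j ^ 2 := by
    by_contra! hcon
    have h8 : ∑ σ : Equiv.Perm (Fin n), w σ * (∑ i, ∑ j, (B - diagonal κ) i j ^ 2)
        < ∑ σ : Equiv.Perm (Fin n), w σ * ∑ i, (μ (σ i) - κ i) ^ 2 := by
      obtain ⟨τ, hτ⟩ : ∃ τ, 0 < w τ := by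
        by_contra! h9
        have : ∑ σ, w σ ≤ 0 := Finset.sum_nonpos fun σ _ => h9 σ
        linarith
      exact Finset.sum_lt_sum (fun s _ => mul_le_mul_of_nonneg_left (hcon s).le (hw0 s))
        ⟨τ, Finset.mem_univ _, mul_lt_mul_of_pos_left (hcon τ) hτ⟩
    rw [← Finset.sum_mul, hw1, one_mul, ← hsum, ← hfrob] at h8
    exact lt_irrefl _ h8
  have hP : ∀ i j, (σ.permMatrix ℝ) i j = if σ i = j then 1 else 0 := by
    intro i j
    simp [PEquiv.toMatrix_apply, Equiv.toPEquiv_apply]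
  refine ⟨Matrix.of fun i j => U i (σ j), μ ∘ σ, ?_, ?_, hσ⟩
  · ext i j
    have := congrFun (congrFun h1 (σ i)) (σ j)
    simpa [mul_apply, one_apply] using this
  · rw [hBU]
    ext i j
    rw [mul_apply, mul_apply]
    simp only [mul_diagonal, transpose_apply, Matrix.of_apply, Function.comp]
    exact (Equiv.sum_comp σ fun k => U i k * μ k * U j k).symm

theorem trace_pow_conj {U : Matrix (Fin n) (Fin n) ℝ} (h : Uᵀ * U = 1) (μ : Fin n → ℝ) (k : ℕ) :
    ((U * diagonal μ * Uᵀ) ^ k).trace = ∑ i, μ i ^ k := by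
  have h2 : U * Uᵀ = 1 := mul_eq_one_comm.mp h
  have : (U * diagonal μ * Uᵀ) ^ k = U * diagonal μ ^ k * Uᵀ := by
    induction k with
    | zero => simp [h2]
    | succ k ih =>
      rw [pow_succ, ih, pow_succ]
      calc U * diagonal μ ^ k * Uᵀ * (U * diagonal μ * Uᵀ)
          = U * diagonal μ ^ k * (Uᵀ * U) * diagonal μ * Uᵀ := by simp only [mul_assoc]
        _ = _ := by rw [h, mul_one]; simp only [mul_assoc]
  rw [this, trace_mul_comm, ← mul_assoc, h, one_mul, diagonal_pow, trace_diagonal]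
  simp

/-- The derivative of `tr (D + t C)^k`. The entries of the matrix are differentiated, and the
derivative is tested against all matrices that commute with `D`, which makes the induction on `k`
work. -/
theorem hasDerivAt_trace_pow (D C : Matrix (Fin n) (Fin n) ℝ) (k : ℕ) :
    HasDerivAt (fun t : ℝ => ((D + t • C) ^ k).trace) (k * (D ^ (k - 1) * C).trace) 0 := by
  have h0 : ∀ i j, HasDerivAt (fun t : ℝ => (D + t • C) i j) (C i j) 0 := by
    intro i j
    simpa using ((hasDerivAt_id (0 : ℝ)).mul_const (C i j)).const_add (D i j)
  have h1 : ∃ M : Matrix (Fin n) (Fin n) ℝ,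
      (∀ i j, HasDerivAt (fun t : ℝ => ((D + t • C) ^ k) i j) (M i j) 0) ∧
      ∀ Z, Z * D = D * Z → (M * Z).trace = (k : ℝ) * (D ^ (k - 1) * C * Z).trace := by
    induction k with
    | zero =>
      refine ⟨0, fun i j => ?_, fun Z _ => by simp⟩
      simpa using hasDerivAt_const (0 : ℝ) ((1 : Matrix (Fin n) (Fin n) ℝ) i j)
    | succ k ih =>
      obtain ⟨M, hM, hMZ⟩ := ih
      refine ⟨M * D + D ^ k * C, fun i j => ?_, fun Z hZ => ?_⟩
      · have := HasDerivAt.fun_sum (u := Finset.univ) fun l _ => (hM i l).fun_mul (h0 l j)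
        simp only [zero_smul, add_zero, Finset.sum_add_distrib, ← mul_apply, ← pow_succ] at this
        exact this
      · rw [add_mul, trace_add, mul_assoc, hMZ (D * Z) (by rw [mul_assoc, hZ]), ← hZ, ← mul_assoc,
          trace_mul_comm, ← mul_assoc, ← mul_assoc]
        rcases k with _ | k
        · simp
        · rw [← pow_succ']
          simp only [Nat.add_sub_cancel]
          push_cast
          ring
  obtain ⟨M, hM, hMZ⟩ := h1
  have h2 := hMZ 1 (by simp)
  rw [mul_one, mul_one] at h2
  rw [← h2]
  exact HasDerivAt.fun_sum fun i _ => hM i i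

theorem exists_derivative_eq (q : Polynomial ℝ) : ∃ p : Polynomial ℝ, p.derivative = q := by
  induction q using Polynomial.induction_on' with
  | add p q hp hq =>
    obtain ⟨a, rfl⟩ := hp
    obtain ⟨b, rfl⟩ := hq
    exact ⟨a + b, Polynomial.derivative_add⟩
  | monomial k a =>
    refine ⟨Polynomial.monomial (k + 1) (a / (k + 1)), ?_⟩
    rw [Polynomial.derivative_monomial]
    simp only [Nat.add_sub_cancel]
    congr 1
    push_cast
    field_simp

/-- A symmetric function `∑ i, p (μ i)` of the eigenvalues is a trace, so that it is differentiable
along a line of matrices whatever the multiplicities of the eigenvalues are. -/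
theorem hasDerivAt_sum_eval (κ : Fin n → ℝ) (C : Matrix (Fin n) (Fin n) ℝ)
    {μ : ℝ → Fin n → ℝ} {U : ℝ → Matrix (Fin n) (Fin n) ℝ} (hU : ∀ t, (U t)ᵀ * U t = 1)
    (hμ : ∀ t, diagonal κ + t • C = U t * diagonal (μ t) * (U t)ᵀ) (p : Polynomial ℝ) :
    HasDerivAt (fun t => ∑ i, p.eval (μ t i)) (∑ i, p.derivative.eval (κ i) * C i i) 0 := by
  induction p using Polynomial.induction_on' with
  | add p q hp hq =>
    simpa only [Polynomial.eval_add, Polynomial.derivative_add, Finset.sum_add_distrib, add_mul]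
      using hp.fun_add hq
  | monomial k a =>
    have h := (hasDerivAt_trace_pow (diagonal κ) C k).const_mul a
    simp only [hμ, trace_pow_conj (hU _)] at h
    simp only [Polynomial.eval_monomial, Polynomial.derivative_monomial, ← Finset.mul_sum]
    refine h.congr_deriv ?_
    rw [diagonal_pow, trace]
    simp only [diag_apply, diagonal_mul, Finset.mul_sum, Pi.pow_apply]
    exact Finset.sum_congr rfl fun i _ => by ring

theorem isOpen_posCone : IsOpen (posCone n) := by
  have : posCone n = ⋂ i, {κ : Fin n → ℝ | 0 < κ i} := by ext; simp [posCone]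
  rw [this]
  exact isOpen_iInter_of_finite fun i => isOpen_lt continuous_const (continuous_apply i)

/-- Partial derivatives of a symmetric function for equal coordinates agree: exchange these two
coordinates. -/
theorem fderiv_single_eq_of_symm {F : (Fin n → ℝ) → ℝ}
    (hF : ∀ κ ∈ closure (posCone n), ∀ s : Equiv.Perm (Fin n), F (κ ∘ s) = F κ)
    {κ : Fin n → ℝ} (hκ : κ ∈ posCone n) (hd : DifferentiableAt ℝ F κ) {i j : Fin n}
    (hij : κ i = κ j) :
    fderiv ℝ F κ (Pi.single i 1) = fderiv ℝ F κ (Pi.single j 1) := by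
  let L : (Fin n → ℝ) →L[ℝ] (Fin n → ℝ) :=
    ContinuousLinearMap.pi fun k => ContinuousLinearMap.proj (Equiv.swap i j k)
  have hL : ∀ x, L x = x ∘ Equiv.swap i j := fun x => rfl
  have hLκ : L κ = κ := by
    rw [hL]; funext k
    simp only [Function.comp, Equiv.swap_apply_def]
    split_ifs with h1 h2
    · rw [h1, hij]
    · rw [h2, hij]
    · rfl
  have he : F ∘ L =ᶠ[𝓝 κ] F := by
    filter_upwards [isOpen_posCone.mem_nhds hκ] with x hx
    exact hF x (subset_closure hx) _
  have h1 : fderiv ℝ F κ = (fderiv ℝ F κ).comp L := by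
    conv_lhs => rw [← he.fderiv_eq]
    rw [fderiv_comp κ (by rw [hLκ]; exact hd) L.differentiableAt, hLκ, L.fderiv]
  have h2 : L (Pi.single i 1) = Pi.single j 1 := by
    rw [hL]; funext k
    simp only [Function.comp, Pi.single_apply, Equiv.swap_apply_def]
    split_ifs <;> simp_all
  conv_lhs => rw [h1]
  rw [ContinuousLinearMap.comp_apply, h2]

/-- First variation of a symmetric function of the eigenvalues at a diagonal matrix. Since
coinciding eigenvalues have equal partial derivatives, the differential of `F` at `κ` is also that
of a function `μ ↦ ∑ i, p (μ i)` with a polynomial `p`; the latter is a trace, whose variation is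
known, and the difference of the two functions is `o(t)` as the eigenvalues move by `O(t)`. -/
theorem hasDerivAt_matrixFun {F : (Fin n → ℝ) → ℝ}
    (hF : ∀ κ ∈ closure (posCone n), ∀ s : Equiv.Perm (Fin n), F (κ ∘ s) = F κ)
    {κ : Fin n → ℝ} (hκ : κ ∈ posCone n) (hd : DifferentiableAt ℝ F κ)
    {C : Matrix (Fin n) (Fin n) ℝ} (hC : C.IsSymm) :
    HasDerivAt (fun t : ℝ => matrixFun F (diagonal κ + t • C))
      (∑ i, fderiv ℝ F κ (Pi.single i 1) * C i i) 0 := by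
  have hS : ∀ t : ℝ, (diagonal κ + t • C).IsSymm := fun t =>
    (isSymm_diagonal κ).add (hC.smul t)
  choose U μ hU hμ hb using fun t => exists_eigenvalues_near (hS t) κ
  -- `p'` interpolates the partial derivatives; this is possible because indices with the same
  -- eigenvalue have the same partial derivative.
  obtain ⟨p, hp⟩ : ∃ p : Polynomial ℝ, ∀ i,
      p.derivative.eval (κ i) = fderiv ℝ F κ (Pi.single i 1) := by
    classical
    have hr : ∃ r : ℝ → ℝ, ∀ i, r (κ i) = fderiv ℝ F κ (Pi.single i 1) := by
      refine ⟨fun x => if h : ∃ i, κ i = x then fderiv ℝ F κ (Pi.single h.choose 1) else 0,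
        fun i => ?_⟩
      have h : ∃ j, κ j = κ i := ⟨i, rfl⟩
      simp only [h, dite_true]
      exact fderiv_single_eq_of_symm hF hκ hd h.choose_spec
    obtain ⟨r, hr⟩ := hr
    obtain ⟨p, hp⟩ := exists_derivative_eq (Lagrange.interpolate (Finset.univ.image κ) id r)
    refine ⟨p, fun i => ?_⟩
    rw [hp, ← hr i]
    exact Lagrange.eval_interpolate_at_node (v := id) r (Function.injective_id.injOn)
      (Finset.mem_image_of_mem κ (Finset.mem_univ i))
  have hP : HasFDerivAt (fun x : Fin n → ℝ => ∑ i, p.eval (x i)) (fderiv ℝ F κ) κ := by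
    have h1 : HasFDerivAt (fun x : Fin n → ℝ => ∑ i, p.eval (x i))
        (∑ i, p.derivative.eval (κ i) •
          (ContinuousLinearMap.proj i : (Fin n → ℝ) →L[ℝ] ℝ)) κ := by
      refine HasFDerivAt.fun_sum fun i _ => ?_
      exact (p.hasDerivAt (κ i)).comp_hasFDerivAt κ
        (ContinuousLinearMap.proj (R := ℝ) (φ := fun _ : Fin n => ℝ) i).hasFDerivAt
    refine h1.congr_fderiv (ContinuousLinearMap.ext fun v => ?_)
    have hv : v = ∑ i, v i • (Pi.single i (1 : ℝ) : Fin n → ℝ) := by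
      funext k
      simp [Finset.sum_apply, Pi.single_apply]
    conv_rhs => rw [hv, map_sum]
    simp [hp, mul_comm]
  have hC0 : 0 ≤ ∑ i, ∑ j, C i j ^ 2 :=
    Finset.sum_nonneg fun i _ => Finset.sum_nonneg fun j _ => sq_nonneg _
  have hsmall : ∃ K : ℝ, 0 ≤ K ∧ ∀ t, ‖μ t - κ‖ ≤ K * |t| := by
    refine ⟨Real.sqrt (∑ i, ∑ j, C i j ^ 2), Real.sqrt_nonneg _, fun t => ?_⟩
    have h1 : ∑ i, (μ t i - κ i) ^ 2 ≤ t ^ 2 * ∑ i, ∑ j, C i j ^ 2 := by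
      refine (hb t).trans (le_of_eq ?_)
      simp [Finset.mul_sum, mul_pow]
    rw [pi_norm_le_iff_of_nonneg (by positivity)]
    intro i
    have h2 : (μ t i - κ i) ^ 2 ≤ t ^ 2 * ∑ i, ∑ j, C i j ^ 2 :=
      (Finset.single_le_sum (f := fun i => (μ t i - κ i) ^ 2) (fun i _ => sq_nonneg _)
        (Finset.mem_univ i)).trans h1
    rw [Pi.sub_apply, Real.norm_eq_abs]
    refine abs_le_of_sq_le_sq ?_ (by positivity)
    rw [mul_pow, sq_abs, Real.sq_sqrt hC0, mul_comm]
    exact h2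
  obtain ⟨K, hK, hsmall⟩ := hsmall
  have hμ0 : μ 0 = κ := by
    have := hsmall 0
    simp only [abs_zero, mul_zero, norm_le_zero_iff] at this
    exact sub_eq_zero.mp this
  have hO : (fun t => μ t - κ) =O[𝓝 0] fun t : ℝ => t :=
    Asymptotics.IsBigO.of_bound K (Eventually.of_forall fun t => by
      simpa [Real.norm_eq_abs] using hsmall t)
  have hten : Tendsto μ (𝓝 0) (𝓝 κ) := by
    rw [tendsto_iff_norm_sub_tendsto_zero]
    refine squeeze_zero (fun t => norm_nonneg _) hsmall ?_
    have : Tendsto (fun t : ℝ => K * |t|) (𝓝 0) (𝓝 (K * |0|)) :=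
      (continuous_const.mul continuous_abs).tendsto 0
    simpa using this
  have hdiff : HasDerivAt (fun t => F (μ t) - ∑ i, p.eval (μ t i)) 0 0 := by
    have h1 := hd.hasFDerivAt.sub hP
    rw [sub_self] at h1
    have h2 := (h1.isLittleO.comp_tendsto hten).trans_isBigO hO
    rw [hasDerivAt_iff_isLittleO, hμ0]
    simpa [Function.comp_def] using h2
  have hFμ : HasDerivAt (fun t => F (μ t)) (∑ i, fderiv ℝ F κ (Pi.single i 1) * C i i) 0 := by
    have := hdiff.add (hasDerivAt_sum_eval κ C hU hμ p)
    simp only [hp, zero_add] at this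
    refine this.congr_of_eventuallyEq (Eventually.of_forall fun t => ?_)
    simp
  refine hFμ.congr_of_eventuallyEq ?_
  filter_upwards [hten (isOpen_posCone.mem_nhds hκ)] with t ht
  refine matrixFun_eq hF ?_ ht
  rw [hμ t]
  exact isEigenvalues_conj (hU t) _

end SpectralFunctions

/-! ### Curvature functions of class `(K*)` -/

section ClassKStar

open Matrix

variable {n : ℕ} {F : (Fin n → ℝ) → ℝ}

theorem isSymm_symmetrized_single (i j : Fin n) :
    ((1 / 2 : ℝ) • (Matrix.single i j (1 : ℝ) + Matrix.single j i 1)).IsSymm := by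
  simp [IsSymm, transpose_add, transpose_single, add_comm]

theorem conj_symmetrized_single_diag (W : Matrix (Fin n) (Fin n) ℝ) (i j k : Fin n) :
    (Wᵀ * ((1 / 2 : ℝ) • (Matrix.single i j (1 : ℝ) + Matrix.single j i 1)) * W :
      Matrix (Fin n) (Fin n) ℝ) k k = W i k * W j k := by
  simp only [Matrix.mul_smul, Matrix.smul_mul, Matrix.smul_apply, mul_add, add_mul, Matrix.add_apply,
    smul_eq_mul]
  have : ∀ a b : Fin n, (Wᵀ * Matrix.single a b (1 : ℝ) * W : Matrix (Fin n) (Fin n) ℝ) k k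
      = W a k * W b k := by
    intro a b
    rw [mul_apply, Finset.sum_eq_single b]
    · simp
    · intro c _ hc
      rw [mul_single_apply_of_ne _ _ _ _ _ hc, zero_mul]
    · simp
  rw [this, this]
  ring

/-- Two positive definite forms can be diagonalized simultaneously. -/
theorem exists_simultaneous_diagonal {g h : Matrix (Fin n) (Fin n) ℝ} (hg : g.PosDef)
    (hh : h.PosDef) : ∃ (W : Matrix (Fin n) (Fin n) ℝ) (κ : Fin n → ℝ), κ ∈ posCone n ∧
      Wᵀ * g * W = 1 ∧ Wᵀ * h * W = diagonal κ := by
  have hsymm : ∀ {A : Matrix (Fin n) (Fin n) ℝ}, A.PosDef → A.IsSymm := fun hA => by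
    have := hA.isHermitian
    rwa [IsHermitian, conjTranspose_eq_transpose_of_trivial] at this
  have hpos : ∀ {A V : Matrix (Fin n) (Fin n) ℝ} {μ : Fin n → ℝ}, A.PosDef → IsUnit V →
      Vᵀ * A * V = diagonal μ → μ ∈ posCone n := by
    intro A V μ hA hV h
    have h1 := (hV.posDef_star_left_conjugate_iff (x := A)).mpr hA
    rw [star_eq_conjTranspose, conjTranspose_eq_transpose_of_trivial, h, posDef_diagonal_iff] at h1
    exact h1
  obtain ⟨U, μ, hU1, hU2, hU⟩ := exists_orthogonal_diagonal (hsymm hg)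
  have hμ := hpos hg (IsUnit.of_mul_eq_one _ hU2) hU
  -- Rescale the eigenvectors of `g` to unit length, then diagonalize `h` in this basis.
  set R := diagonal fun i => (Real.sqrt (μ i))⁻¹ with hR
  have hRμ : R * diagonal μ * R = 1 := by
    rw [hR, diagonal_mul_diagonal, diagonal_mul_diagonal, ← diagonal_one]
    congr 1
    funext i
    have h1 : 0 < Real.sqrt (μ i) := Real.sqrt_pos.mpr (hμ i)
    have h2 : μ i = Real.sqrt (μ i) * Real.sqrt (μ i) := (Real.mul_self_sqrt (hμ i).le).symm
    conv_lhs => rw [h2]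
    field_simp
    rw [Real.sqrt_sq h1.le]
  have hRt : Rᵀ = R := diagonal_transpose _
  have hRu : IsUnit R := by
    rw [mul_assoc] at hRμ
    exact IsUnit.of_mul_eq_one _ hRμ
  have hURg : (U * R)ᵀ * g * (U * R) = 1 := by
    rw [← hRμ, ← hU, transpose_mul, hRt]
    simp only [mul_assoc]
  have hURu : IsUnit (U * R) := (IsUnit.of_mul_eq_one _ hU2).mul hRu
  obtain ⟨V, κ, hV1, hV2, hV⟩ := exists_orthogonal_diagonal (A := (U * R)ᵀ * h * (U * R)) (by
    rw [IsSymm, transpose_mul _ (U * R), transpose_mul _ h, transpose_transpose, (hsymm hh).eq,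
      ← mul_assoc])
  have hW : ∀ A, (U * R * V)ᵀ * A * (U * R * V) = Vᵀ * ((U * R)ᵀ * A * (U * R)) * V := by
    intro A
    rw [transpose_mul]
    simp only [mul_assoc]
  refine ⟨U * R * V, κ, ?_, ?_, ?_⟩
  · refine hpos hh (hURu.mul (IsUnit.of_mul_eq_one _ hV2)) (V := U * R * V) ?_
    rw [hW, hV]
  · rw [hW, hURg, mul_one, hV1]
  · rw [hW, hV]

/-- The endomorphism `g⁻¹ A` is similar to the matrix of the form `A` in a `g`-orthonormal basis,
given by the columns of `W`. -/
theorem inv_mul_eq_conj {g W : Matrix (Fin n) (Fin n) ℝ} (hW : Wᵀ * g * W = 1)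
    (A : Matrix (Fin n) (Fin n) ℝ) :
    g⁻¹ * A = W * (Wᵀ * A * W) * (Wᵀ * g) ∧ (Wᵀ * g) * W = 1 := by
  refine ⟨?_, hW⟩
  have h1 : W * (Wᵀ * g) = 1 := mul_eq_one_comm.mp hW
  have h2 : g⁻¹ = W * Wᵀ := inv_eq_left_inv (by rw [mul_assoc, h1])
  rw [h2]
  calc W * Wᵀ * A = W * Wᵀ * A * (W * (Wᵀ * g)) := by rw [h1, mul_one]
    _ = _ := by simp only [mul_assoc]

namespace IsClassKStar

theorem differentiableAt (hF : IsClassKStar F) {κ : Fin n → ℝ} (hκ : κ ∈ posCone n) :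
    DifferentiableAt ℝ F κ :=
  (hF.smooth.contDiffAt (isOpen_posCone.mem_nhds hκ)).differentiableAt (by simp)

/-- In a basis of eigenvectors of `h` which is orthonormal for `g`, the matrix `F^{ij}` is diagonal
with the entries `∂F/∂κ_k`. -/
theorem Fup_eq (hF : IsClassKStar F) {g h W : Matrix (Fin n) (Fin n) ℝ} {κ : Fin n → ℝ}
    (hκ : κ ∈ posCone n) (hg : Wᵀ * g * W = 1) (hh : Wᵀ * h * W = diagonal κ) (i j : Fin n) :
    Fup F g h i j = ∑ k, fderiv ℝ F κ (Pi.single k 1) * (W i k * W j k) := by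
  set E := (1 / 2 : ℝ) • (Matrix.single i j (1 : ℝ) + Matrix.single j i 1) with hE
  have h1 : ∀ t : ℝ, matrixFun F (g⁻¹ * (h + t • E))
      = matrixFun F (diagonal κ + t • (Wᵀ * E * W)) := by
    intro t
    obtain ⟨h2, h3⟩ := inv_mul_eq_conj hg (h + t • E)
    rw [h2, matrixFun_conj h3, mul_add, add_mul, hh, Matrix.mul_smul, Matrix.smul_mul]
  have hC : (Wᵀ * E * W).IsSymm := by
    rw [IsSymm, transpose_mul, transpose_mul, transpose_transpose,
      (isSymm_symmetrized_single i j).eq, ← mul_assoc]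
  have h4 := hasDerivAt_matrixFun hF.symmetric hκ (hF.differentiableAt hκ) hC
  simp only [← h1] at h4
  rw [Fup, ← hE, h4.deriv]
  exact Finset.sum_congr rfl fun k _ => by rw [conj_symmetrized_single_diag]

/-- Euler's relation for homogeneous functions. -/
theorem euler (hF : IsClassKStar F) {κ : Fin n → ℝ} (hκ : κ ∈ posCone n) :
    fderiv ℝ F κ κ = F κ := by
  have h1 : HasDerivAt (fun t : ℝ => F (t • κ)) (fderiv ℝ F κ κ) 1 := by
    have h2 : HasDerivAt (fun t : ℝ => t • κ) κ 1 := by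
      simpa using (hasDerivAt_id (1 : ℝ)).smul_const κ
    have h3 : HasFDerivAt F (fderiv ℝ F κ) ((1 : ℝ) • κ) := by
      rw [one_smul]; exact (hF.differentiableAt hκ).hasFDerivAt
    exact h3.comp_hasDerivAt (1 : ℝ) h2
  have h4 : HasDerivAt (fun t : ℝ => F (t • κ)) (F κ) 1 := by
    have h5 : HasDerivAt (fun t : ℝ => t * F κ) (F κ) 1 := by
      simpa using (hasDerivAt_id (1 : ℝ)).mul_const (F κ)
    refine h5.congr_of_eventuallyEq ?_
    filter_upwards [lt_mem_nhds (zero_lt_one (α := ℝ))] with t ht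
    exact hF.homogeneous κ hκ t ht
  exact h1.unique h4

theorem fderiv_apply (F : (Fin n → ℝ) → ℝ) (κ ξ : Fin n → ℝ) :
    fderiv ℝ F κ ξ = ∑ i, fderiv ℝ F κ (Pi.single i 1) * ξ i := by
  have hv : ξ = ∑ i, ξ i • (Pi.single i (1 : ℝ) : Fin n → ℝ) := by
    funext k
    simp [Finset.sum_apply, Pi.single_apply]
  conv_lhs => rw [hv, map_sum]
  simp [mul_comm]

theorem nonneg (hF : IsClassKStar F) {κ : Fin n → ℝ} (hκ : κ ∈ posCone n) : 0 ≤ F κ := by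
  rw [← hF.euler hκ, fderiv_apply]
  exact Finset.sum_nonneg fun i _ => mul_nonneg (hF.deriv_pos κ hκ i).le (hκ i).le

theorem isEigenvalues_diagonal (κ : Fin n → ℝ) : IsEigenvalues (diagonal κ) κ := by
  simpa using isEigenvalues_conj (W := 1) (W' := 1) (by simp) κ

/-- The curvature of a convex hypersurface is non-negative. -/
theorem matrixFun_nonneg (hF : IsClassKStar F) {g h : Matrix (Fin n) (Fin n) ℝ} (hg : g.PosDef)
    (hh : h.PosDef) : 0 ≤ matrixFun F (g⁻¹ * h) := by
  obtain ⟨W, κ, hκ, hWg, hWh⟩ := exists_simultaneous_diagonal hg hh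
  obtain ⟨h2, h3⟩ := inv_mul_eq_conj hWg h
  rw [h2, matrixFun_conj h3, hWh, matrixFun_eq hF.symmetric (isEigenvalues_diagonal κ) hκ]
  exact hF.nonneg hκ

/-- The class `(K)` inequality, tested with diagonal matrices, bounds the second derivative of `F`
by an expression which is non-positive by the Cauchy-Schwarz inequality. -/
theorem second_deriv_nonpos (hF : IsClassKStar F) {κ : Fin n → ℝ} (hκ : κ ∈ posCone n)
    (ξ : Fin n → ℝ) : iteratedDeriv 2 (fun t : ℝ => F (κ + t • ξ)) 0 ≤ 0 := by
  have h0 : ∀ t : ℝ, diagonal κ + t • diagonal ξ = diagonal (κ + t • ξ) := by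
    intro t
    rw [← diagonal_smul, diagonal_add]
    rfl
  have hev : (fun t : ℝ => matrixFun F (diagonal κ + t • diagonal ξ))
      =ᶠ[𝓝 0] fun t => F (κ + t • ξ) := by
    have hc : ContinuousAt (fun t : ℝ => κ + t • ξ) 0 := by fun_prop
    have := hc (isOpen_posCone.mem_nhds (by simpa using hκ))
    filter_upwards [this] with t ht
    rw [h0, matrixFun_eq hF.symmetric (isEigenvalues_diagonal _) ht]
  rw [← hev.iteratedDeriv_eq]
  refine (hF.classK _ _ (PosDef.diagonal hκ) (isSymm_diagonal ξ)).trans ?_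
  have hFup : ∀ i j, Fup F 1 (diagonal κ) i j
      = if i = j then fderiv ℝ F κ (Pi.single i 1) else 0 := by
    intro i j
    rw [hF.Fup_eq (W := 1) hκ (by simp) (by simp)]
    simp only [one_apply]
    rw [Finset.sum_eq_single i]
    · simp [eq_comm]
    · intro k _ hk
      simp [hk.symm]
    · simp
  set D : Fin n → ℝ := fun i => fderiv ℝ F κ (Pi.single i 1) with hD
  have hinv : (diagonal κ)⁻¹ = diagonal fun i => (κ i)⁻¹ := by
    refine inv_eq_left_inv ?_
    rw [diagonal_mul_diagonal, ← diagonal_one]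
    congr 1
    funext i
    exact inv_mul_cancel₀ (hκ i).ne'
  have h1 : ∑ i, ∑ j, Fup F 1 (diagonal κ) i j * diagonal ξ i j = ∑ i, D i * ξ i := by
    simp [hFup, diagonal_apply, hD]
  have h2 : ∑ i, ∑ j, ∑ k, ∑ l, Fup F 1 (diagonal κ) i k * (diagonal κ)⁻¹ j l
      * diagonal ξ i j * diagonal ξ k l = ∑ i, D i * ξ i ^ 2 / κ i := by
    refine Finset.sum_congr rfl fun i _ => ?_
    rw [Finset.sum_eq_single i, Finset.sum_eq_single i, Finset.sum_eq_single i]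
    · simp only [hFup, hinv, diagonal_apply_eq, if_true]
      rw [div_eq_mul_inv]
      ring
    · intro l _ hl
      simp [hl.symm]
    · simp
    · intro k _ hk
      simp [hFup, hk.symm]
    · simp
    · intro j _ hj
      simp [diagonal_apply_ne _ hj.symm]
    · simp
  have h3 : matrixFun F (diagonal κ) = ∑ i, D i * κ i := by
    rw [matrixFun_eq hF.symmetric (isEigenvalues_diagonal _) hκ, ← hF.euler hκ, fderiv_apply]
  rw [h1, h2, h3, sub_nonpos]
  have hDp : ∀ i, 0 < D i := hF.deriv_pos κ hκ
  have hS : 0 ≤ ∑ i, D i * κ i := Finset.sum_nonneg fun i _ => (mul_pos (hDp i) (hκ i)).le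
  have hcs : (∑ i, D i * ξ i) ^ 2 ≤ (∑ i, D i * κ i) * ∑ i, D i * ξ i ^ 2 / κ i := by
    refine Finset.sum_sq_le_sum_mul_sum_of_sq_le_mul _ (fun i _ => (mul_pos (hDp i) (hκ i)).le)
      (fun i _ => div_nonneg (mul_nonneg (hDp i).le (sq_nonneg _)) (hκ i).le) fun i _ => ?_
    have := (hκ i).ne'
    refine le_of_eq ?_
    field_simp
  rcases hS.eq_or_lt with h | h
  -- The sum vanishes for `n = 0` only, and then so does its inverse.
  · rw [← h, _root_.inv_zero, zero_mul]
    exact Finset.sum_nonneg fun i _ =>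
      div_nonneg (mul_nonneg (hDp i).le (sq_nonneg _)) (hκ i).le
  · rw [inv_mul_le_iff₀ h]
    exact hcs

/-- By concavity and homogeneity of `F`, the sum of its partial derivatives is at least
`F(1, …, 1) = n`. -/
theorem le_sum_fderiv (hF : IsClassKStar F) {κ : Fin n → ℝ} (hκ : κ ∈ posCone n) :
    (n : ℝ) ≤ ∑ i, fderiv ℝ F κ (Pi.single i 1) := by
  -- Compare `F` with its tangent at `κ` on the line through `κ` and `(1, …, 1)`.
  set ξ : Fin n → ℝ := (fun _ => 1) - κ with hξ
  set D : Set ℝ := (fun t : ℝ => κ + t • ξ) ⁻¹' posCone n with hD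
  have hcont : Continuous fun t : ℝ => κ + t • ξ := by fun_prop
  have hDo : IsOpen D := isOpen_posCone.preimage hcont
  have hconv : Convex ℝ D := by
    intro s hs t ht a b ha hb hab i
    have h1 : (κ + (a • s + b • t) • ξ) i
        = a * (κ + s • ξ) i + b * (κ + t • ξ) i := by
      simp only [Pi.add_apply, Pi.smul_apply, smul_eq_mul]
      linear_combination (-(κ i)) * hab
    show 0 < (κ + (a • s + b • t) • ξ) i
    rw [h1]
    rcases ha.eq_or_lt with h | h
    · have : b = 1 := by linarith
      rw [← h, this, zero_mul, zero_add, one_mul]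
      exact ht i
    · exact add_pos_of_pos_of_nonneg (mul_pos h (hs i)) (mul_nonneg hb (ht i).le)
  have h0 : (0 : ℝ) ∈ D := by simpa [hD] using hκ
  have h1 : (1 : ℝ) ∈ D := by
    show κ + (1 : ℝ) • ξ ∈ posCone n
    intro i
    simp [hξ]
  have hsm : ContDiffOn ℝ ∞ (fun t : ℝ => F (κ + t • ξ)) D :=
    hF.smooth.comp (by fun_prop) fun t ht => ht
  have hconc : ConcaveOn ℝ D fun t : ℝ => F (κ + t • ξ) := by
    refine concaveOn_of_deriv2_nonpos' hconv (hsm.differentiableOn (by simp)) ?_ ?_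
    · exact (hsm.deriv_of_isOpen hDo (m := 1) (by norm_cast)).differentiableOn (by simp)
    · intro t ht
      have h2 := hF.second_deriv_nonpos (κ := κ + t • ξ) ht ξ
      have h3 : (fun s : ℝ => F (κ + t • ξ + s • ξ))
          = fun s => (fun r : ℝ => F (κ + r • ξ)) (t + s) := by
        funext s
        simp only [add_smul, add_assoc]
      rw [h3, iteratedDeriv_comp_const_add 2 (fun r : ℝ => F (κ + r • ξ))] at h2
      simp only [add_zero, iteratedDeriv_eq_iterate] at h2
      exact h2
  have hder : HasDerivAt (fun t : ℝ => F (κ + t • ξ)) (fderiv ℝ F κ ξ) 0 := by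
    have h2 : HasDerivAt (fun t : ℝ => κ + t • ξ) ξ 0 := by
      simpa using ((hasDerivAt_id (0 : ℝ)).smul_const ξ).const_add κ
    have h3 : HasFDerivAt F (fderiv ℝ F κ) (κ + (0 : ℝ) • ξ) := by
      rw [zero_smul, add_zero]; exact (hF.differentiableAt hκ).hasFDerivAt
    exact h3.comp_hasDerivAt (0 : ℝ) h2
  have hs := hconc.slope_le_of_hasDerivAt h0 h1 zero_lt_one hder
  rw [slope_def_field, hξ, map_sub, hF.euler hκ, fderiv_apply F κ fun _ => 1] at hs
  have h4 : κ + (1 : ℝ) • ((fun _ => (1 : ℝ)) - κ) = fun _ => 1 := by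
    funext i; simp
  rw [h4, hF.normalized] at hs
  simp only [zero_smul, add_zero, sub_zero, div_one, mul_one] at hs
  linarith

end IsClassKStar

theorem sum_conj_mul (W M : Matrix (Fin n) (Fin n) ℝ) (d : Fin n → ℝ) :
    ∑ i, ∑ j, (∑ k, d k * (W i k * W j k)) * M i j
      = ∑ k, d k * ∑ i, ∑ j, M i j * W i k * W j k := by
  simp only [Finset.sum_mul, Finset.mul_sum]
  rw [Finset.sum_congr rfl fun i _ => Finset.sum_comm, Finset.sum_comm]
  exact Finset.sum_congr rfl fun k _ => Finset.sum_congr rfl fun i _ =>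
    Finset.sum_congr rfl fun j _ => by ring

theorem sum_quadratic_eq_one {g W : Matrix (Fin n) (Fin n) ℝ} (hW : Wᵀ * g * W = 1) (k : Fin n) :
    ∑ i, ∑ j, g i j * W i k * W j k = 1 := by
  have := congrFun (congrFun hW k) k
  rw [one_apply_eq, mul_apply] at this
  rw [← this, Finset.sum_comm]
  refine Finset.sum_congr rfl fun j _ => ?_
  rw [mul_apply, Finset.sum_mul]
  exact Finset.sum_congr rfl fun i _ => by rw [transpose_apply]; ring

/-- Contraction of `F^{ij}` with a bilinear form that is bounded from below by the metric. -/
theorem IsClassKStar.le_sum_Fup_mul (hF : IsClassKStar F) {g h M : Matrix (Fin n) (Fin n) ℝ}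
    (hg : g.PosDef) (hh : h.PosDef) {c : ℝ} (hc : 0 ≤ c)
    (hM : ∀ ξ : Fin n → ℝ, c * ∑ i, ∑ j, g i j * ξ i * ξ j ≤ ∑ i, ∑ j, M i j * ξ i * ξ j) :
    c * n ≤ ∑ i, ∑ j, Fup F g h i j * M i j := by
  obtain ⟨W, κ, hκ, hWg, hWh⟩ := exists_simultaneous_diagonal hg hh
  simp only [hF.Fup_eq hκ hWg hWh, sum_conj_mul]
  calc c * n ≤ c * ∑ k, fderiv ℝ F κ (Pi.single k 1) :=
        mul_le_mul_of_nonneg_left (hF.le_sum_fderiv hκ) hc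
    _ = ∑ k, fderiv ℝ F κ (Pi.single k 1) * c := by rw [mul_comm, Finset.sum_mul]
    _ ≤ _ := by
        refine Finset.sum_le_sum fun k _ => mul_le_mul_of_nonneg_left ?_ (hF.deriv_pos κ hκ k).le
        have := hM fun i => W i k
        rwa [sum_quadratic_eq_one hWg, mul_one] at this

/-- The trace with respect to `g` of a bilinear form that is bounded from below by `g`. -/
theorem le_sum_inv_mul {g M : Matrix (Fin n) (Fin n) ℝ} (hg : g.PosDef) {c : ℝ}
    (hM : ∀ ξ : Fin n → ℝ, c * ∑ i, ∑ j, g i j * ξ i * ξ j ≤ ∑ i, ∑ j, M i j * ξ i * ξ j) :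
    c * n ≤ ∑ i, ∑ j, g⁻¹ i j * M i j := by
  obtain ⟨W, κ, hκ, hWg, -⟩ := exists_simultaneous_diagonal hg hg
  have h1 : g⁻¹ = W * Wᵀ :=
    inv_eq_left_inv (by rw [mul_assoc]; exact mul_eq_one_comm.mp hWg)
  have h2 : ∀ i j, g⁻¹ i j = ∑ k, 1 * (W i k * W j k) := by
    intro i j
    simp [h1, mul_apply]
  simp only [h2, sum_conj_mul]
  calc c * n = ∑ _k : Fin n, 1 * c := by simp [mul_comm]
    _ ≤ _ := by
        refine Finset.sum_le_sum fun k _ => mul_le_mul_of_nonneg_left ?_ zero_le_one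
        have := hM fun i => W i k
        rwa [sum_quadratic_eq_one hWg, mul_one] at this

end ClassKStar

/-! ### The curvature tensor in coordinates -/

section Curvature

set_option maxSynthPendingDepth 3

variable {V : Type*} [NormedAddCommGroup V] [NormedSpace ℝ V]

/-- The lowered Christoffel symbols `½ (∂_v G (w, z) + ∂_w G (v, z) - ∂_z G (v, w))` as a linear
function of the first derivative `D` of the metric. -/
def koszul (D : V →L[ℝ] V →L[ℝ] V →L[ℝ] ℝ) : V →L[ℝ] V →L[ℝ] V →L[ℝ] ℝ :=
  (1 / 2 : ℝ) • (D + D.flip -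
    (ContinuousLinearMap.flipₗᵢ ℝ V V ℝ : (V →L[ℝ] V →L[ℝ] ℝ) →L[ℝ] V →L[ℝ] V →L[ℝ] ℝ).comp
      D.flip)

theorem koszul_apply (D : V →L[ℝ] V →L[ℝ] V →L[ℝ] ℝ) (v w z : V) :
    koszul D v w z = 1 / 2 * (D v w z + D w v z - D z v w) := by
  simp [koszul]

/-- The Christoffel symbols as a field of continuous bilinear maps. -/
def christoffelL (G : V → V →L[ℝ] V →L[ℝ] ℝ) (p : V) : V →L[ℝ] V →L[ℝ] V :=
  (ContinuousLinearMap.compL ℝ V (V →L[ℝ] ℝ) V (G p).inverse).comp (koszul (fderiv ℝ G p))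

theorem christoffelL_apply (G : V → V →L[ℝ] V →L[ℝ] ℝ) (p v w : V) :
    christoffelL G p v w = christoffel G p v w := by
  simp [christoffelL, christoffel, koszul]

theorem apply_christoffel {G : V → V →L[ℝ] V →L[ℝ] ℝ} {p : V} (h : (G p).IsInvertible)
    (v w z : V) : G p (christoffelL G p v w) z = koszul (fderiv ℝ G p) v w z := by
  rw [christoffelL, ContinuousLinearMap.comp_apply, ContinuousLinearMap.compL_apply,
    ContinuousLinearMap.comp_apply, h.self_apply_inverse]

/-- The curvature in terms of bilinear Christoffel symbols `Γ` and their derivative `Γ'`. -/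
theorem curvature_eq {G : V → V →L[ℝ] V →L[ℝ] ℝ} {Γ : V → V →L[ℝ] V →L[ℝ] V}
    {Γ' : V →L[ℝ] V →L[ℝ] V →L[ℝ] V} {p : V} (hΓ : ∀ᶠ q in 𝓝 p, christoffelL G q = Γ q)
    (hΓ' : HasFDerivAt Γ Γ' p) (c d b : V) :
    curvature G p c d b = Γ' c d b - Γ' d c b + Γ p c (Γ p d b) - Γ p d (Γ p c b) := by
  have h1 : ∀ d b : V,
      fderiv ℝ (fun q => christoffel G q d b) p = (Γ'.flip d).flip b := by
    intro d b
    have h2 : HasFDerivAt (fun q => Γ q d b) ((Γ'.flip d).flip b) p := by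
      have h3 := (hΓ'.clm_apply (hasFDerivAt_const d p)).clm_apply (hasFDerivAt_const b p)
      refine h3.congr_fderiv ?_
      ext c
      simp
    refine (h2.congr_of_eventuallyEq ?_).fderiv
    filter_upwards [hΓ] with q hq
    rw [← christoffelL_apply, hq]
  have h0 := hΓ.self_of_nhds
  rw [curvature, h1, h1]
  simp only [← christoffelL_apply, h0]
  simp

/-- A field of non-degenerate symmetric bilinear forms which is of class `C²` near `p`. -/
structure IsMetricAt (G : V → V →L[ℝ] V →L[ℝ] ℝ) (p : V) : Prop where
  contDiffAt : ContDiffAt ℝ 2 G p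
  invertible : ∀ᶠ q in 𝓝 p, (G q).IsInvertible
  symm : ∀ᶠ q in 𝓝 p, ∀ v w, G q v w = G q w v

variable {G : V → V →L[ℝ] V →L[ℝ] ℝ} {p : V}

/-- The product rule for a bilinear map, with the value of the derivative made explicit. -/
theorem _root_.HasFDerivAt.clm_apply₂ {W E F : Type*} [NormedAddCommGroup W] [NormedSpace ℝ W]
    [NormedAddCommGroup E] [NormedSpace ℝ E] [NormedAddCommGroup F] [NormedSpace ℝ F]
    {B : V → E →L[ℝ] F →L[ℝ] W} {B' : V →L[ℝ] E →L[ℝ] F →L[ℝ] W}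
    {x : V → E} {x' : V →L[ℝ] E} {y : V → F} {y' : V →L[ℝ] F}
    (hB : HasFDerivAt B B' p) (hx : HasFDerivAt x x' p) (hy : HasFDerivAt y y' p) :
    ∃ L : V →L[ℝ] W, HasFDerivAt (fun q => B q (x q) (y q)) L p ∧
      ∀ c, L c = B' c (x p) (y p) + B p (x' c) (y p) + B p (x p) (y' c) := by
  refine ⟨_, (hB.clm_apply hx).clm_apply hy, fun c => ?_⟩
  simp
  abel

namespace IsMetricAt

theorem eventually (h : IsMetricAt G p) : ∀ᶠ q in 𝓝 p, IsMetricAt G q := by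
  filter_upwards [h.contDiffAt.eventually (by simp), h.invertible.eventually_nhds,
    h.symm.eventually_nhds] with q h1 h2 h3
  exact ⟨h1, h2, h3⟩

theorem hasFDerivAt (h : IsMetricAt G p) : HasFDerivAt G (fderiv ℝ G p) p :=
  (h.contDiffAt.differentiableAt (by simp)).hasFDerivAt

theorem contDiffAt_fderiv (h : IsMetricAt G p) : ContDiffAt ℝ 1 (fderiv ℝ G) p :=
  h.contDiffAt.fderiv_right (by norm_num)

theorem hasFDerivAt_fderiv (h : IsMetricAt G p) :
    HasFDerivAt (fderiv ℝ G) (fderiv ℝ (fderiv ℝ G) p) p :=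
  (h.contDiffAt_fderiv.differentiableAt (by simp)).hasFDerivAt

theorem fderiv_symm (h : IsMetricAt G p) (c v w : V) :
    fderiv ℝ G p c v w = fderiv ℝ G p c w v := by
  have h1 : ∀ v w : V, HasFDerivAt (fun q => G q v w) (((fderiv ℝ G p).flip v).flip w) p := by
    intro v w
    refine ((h.hasFDerivAt.clm_apply (hasFDerivAt_const v p)).clm_apply
      (hasFDerivAt_const w p)).congr_fderiv ?_
    ext c
    simp
  have h2 := (h1 v w).unique ((h1 w v).congr_of_eventuallyEq (by
    filter_upwards [h.symm] with q hq
    exact hq v w))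
  simpa using congrArg (fun L : V →L[ℝ] ℝ => L c) h2

theorem contDiffAt_christoffelL [CompleteSpace V] (h : IsMetricAt G p) :
    ContDiffAt ℝ 1 (christoffelL G) p := by
  have h1 : ContDiffAt ℝ 1 (fun q => (G q).inverse) p := by
    obtain ⟨e, he⟩ := h.invertible.self_of_nhds
    have h2 := contDiffAt_map_inverse (𝕜 := ℝ) (n := 1) e
    rw [he] at h2
    exact h2.comp p (h.contDiffAt.of_le (by norm_num))
  have h2 : ContDiffAt ℝ 1 (fun q => koszul (fderiv ℝ G q)) p := by
    have h3 := h.contDiffAt_fderiv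
    have h4 : ContDiffAt ℝ 1 (fun q => (fderiv ℝ G q).flip) p :=
      (ContinuousLinearMap.flipₗᵢ ℝ V V (V →L[ℝ] ℝ)).contDiff.contDiffAt.comp p h3
    exact ((h3.add h4).sub (contDiffAt_const.clm_comp h4)).const_smul _
  exact (((ContinuousLinearMap.compL ℝ V (V →L[ℝ] ℝ) V).contDiff.contDiffAt.comp p h1).clm_comp h2)

theorem hasFDerivAt_christoffelL [CompleteSpace V] (h : IsMetricAt G p) :
    HasFDerivAt (christoffelL G) (fderiv ℝ (christoffelL G) p) p :=
  (h.contDiffAt_christoffelL.differentiableAt (by simp)).hasFDerivAt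

theorem curvature_eq [CompleteSpace V] (h : IsMetricAt G p) (c d b : V) :
    curvature G p c d b = fderiv ℝ (christoffelL G) p c d b - fderiv ℝ (christoffelL G) p d c b
      + christoffelL G p c (christoffelL G p d b) - christoffelL G p d (christoffelL G p c b) :=
  ARW.curvature_eq (Eventually.of_forall fun _ => rfl) h.hasFDerivAt_christoffelL c d b

/-- The Levi-Civita connection is compatible with the metric. -/
theorem fderiv_apply_eq (h : IsMetricAt G p) (c v w : V) :
    fderiv ℝ G p c v w = G p (christoffelL G p c v) w + G p v (christoffelL G p c w) := by
  rw [h.symm.self_of_nhds v, apply_christoffel h.invertible.self_of_nhds,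
    apply_christoffel h.invertible.self_of_nhds, koszul_apply, koszul_apply,
    h.fderiv_symm c w v]
  ring

/-- `R_αβγδ` vanishes when its first two arguments agree: differentiate
`∂_d (G (b, b)) = 2 G (∇_d b, b)` once more and use that second derivatives commute. -/
theorem riemann_self_left [CompleteSpace V] (h : IsMetricAt G p) (b c d : V) :
    riemann G p b b c d = 0 := by
  have hsymm : ∀ c d v w, fderiv ℝ (fderiv ℝ G) p c d v w = fderiv ℝ (fderiv ℝ G) p d c v w := by
    intro c d v w
    have := (h.contDiffAt.isSymmSndFDerivAt (by simp)).eq c d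
    rw [this]
  have key : ∀ c d : V, fderiv ℝ (fderiv ℝ G) p c d b b
      = 2 * (fderiv ℝ G p c (christoffelL G p d b) b
        + G p (fderiv ℝ (christoffelL G) p c d b) b) := by
    intro c d
    have h1 : HasFDerivAt (fun q => fderiv ℝ G q d b b)
        ((((fderiv ℝ (fderiv ℝ G) p).flip d).flip b).flip b) p := by
      refine (((h.hasFDerivAt_fderiv.clm_apply (hasFDerivAt_const d p)).clm_apply
        (hasFDerivAt_const b p)).clm_apply (hasFDerivAt_const b p)).congr_fderiv ?_
      ext c
      simp
    obtain ⟨L, hL, hLc⟩ := HasFDerivAt.clm_apply₂ h.hasFDerivAt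
      ((h.hasFDerivAt_christoffelL.clm_apply (hasFDerivAt_const d p)).clm_apply
        (hasFDerivAt_const b p)) (hasFDerivAt_const b p)
    have h2 : HasFDerivAt (fun q => fderiv ℝ G q d b b) ((2 : ℝ) • L) p := by
      refine (hL.const_mul 2).congr_of_eventuallyEq ?_
      filter_upwards [h.eventually] with q hq
      rw [hq.fderiv_apply_eq d b b, hq.symm.self_of_nhds b]
      ring
    have h3 := congrArg (fun L : V →L[ℝ] ℝ => L c) (h1.unique h2)
    simp only [smul_apply, hLc] at h3
    simpa using h3
  have h1 := key c d
  have h2 := key d c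
  rw [hsymm c d] at h1
  rw [h.fderiv_apply_eq c] at h1
  rw [h.fderiv_apply_eq d] at h2
  have h3 := h.symm.self_of_nhds (christoffelL G p c b) (christoffelL G p d b)
  rw [riemann, h.curvature_eq]
  simp only [map_add, map_sub, add_apply, sub_apply]
  linarith

/-- The quadratic form of the curvature tensor depends on the plane of its arguments only. -/
theorem riemann_add_smul [CompleteSpace V] (h : IsMetricAt G p) (v w : V) (s : ℝ) :
    riemann G p v (w + s • v) v (w + s • v) = riemann G p v w v w := by
  have h1 : curvature G p v (w + s • v) (w + s • v)
      = curvature G p v w w + s • curvature G p v w v := by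
    simp only [h.curvature_eq, map_add, map_smul, add_apply,
      smul_apply]
    module
  have h2 := h.riemann_self_left v v w
  rw [riemann] at h2
  rw [riemann, h1, map_add, map_smul, add_apply,
    smul_apply, h2, smul_zero, add_zero, riemann]

end IsMetricAt

end Curvature

/-! ### Change of coordinates -/

section ChangeOfCoordinates

set_option maxSynthPendingDepth 3

variable {V W : Type*} [NormedAddCommGroup V] [NormedSpace ℝ V]
  [NormedAddCommGroup W] [NormedSpace ℝ W]
  {G : V → V →L[ℝ] V →L[ℝ] ℝ} {G' : W → W →L[ℝ] W →L[ℝ] ℝ} {Θ : V → W} {p : V}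

/-- `G` is near `p` the pull-back of `G'` by the change of coordinates `Θ`. -/
structure IsPullbackAt (G : V → V →L[ℝ] V →L[ℝ] ℝ) (G' : W → W →L[ℝ] W →L[ℝ] ℝ) (Θ : V → W)
    (p : V) : Prop where
  metric : IsMetricAt G p
  metric' : IsMetricAt G' (Θ p)
  contDiffAt : ContDiffAt ℝ 3 Θ p
  surjective : ∀ᶠ q in 𝓝 p, Function.Surjective (fderiv ℝ Θ q)
  eq : ∀ᶠ q in 𝓝 p, ∀ v w, G q v w = G' (Θ q) (fderiv ℝ Θ q v) (fderiv ℝ Θ q w)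

namespace IsPullbackAt

theorem eventually (h : IsPullbackAt G G' Θ p) : ∀ᶠ q in 𝓝 p, IsPullbackAt G G' Θ q := by
  filter_upwards [h.metric.eventually, h.contDiffAt.continuousAt.eventually h.metric'.eventually,
    h.contDiffAt.eventually (by simp), h.surjective.eventually_nhds, h.eq.eventually_nhds]
    with q h1 h2 h3 h4 h5
  exact ⟨h1, h2, h3, h4, h5⟩

theorem hasFDerivAt (h : IsPullbackAt G G' Θ p) : HasFDerivAt Θ (fderiv ℝ Θ p) p :=
  (h.contDiffAt.differentiableAt (by simp)).hasFDerivAt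

theorem contDiffAt_fderiv (h : IsPullbackAt G G' Θ p) : ContDiffAt ℝ 2 (fderiv ℝ Θ) p :=
  h.contDiffAt.fderiv_right (by norm_num)

theorem hasFDerivAt_fderiv (h : IsPullbackAt G G' Θ p) :
    HasFDerivAt (fderiv ℝ Θ) (fderiv ℝ (fderiv ℝ Θ) p) p :=
  (h.contDiffAt_fderiv.differentiableAt (by simp)).hasFDerivAt

theorem hasFDerivAt_fderiv_fderiv (h : IsPullbackAt G G' Θ p) :
    HasFDerivAt (fderiv ℝ (fderiv ℝ Θ)) (fderiv ℝ (fderiv ℝ (fderiv ℝ Θ)) p) p :=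
  ((h.contDiffAt_fderiv.fderiv_right (m := 1) (by norm_num)).differentiableAt (by simp)).hasFDerivAt

theorem fderiv_fderiv_symm (h : IsPullbackAt G G' Θ p) (v w : V) :
    fderiv ℝ (fderiv ℝ Θ) p v w = fderiv ℝ (fderiv ℝ Θ) p w v :=
  (h.contDiffAt.isSymmSndFDerivAt (by simp; norm_num)).eq v w

/-- Transformation law of the first derivative of the metric. -/
theorem fderiv_metric (h : IsPullbackAt G G' Θ p) (c v w : V) :
    fderiv ℝ G p c v w =
      fderiv ℝ G' (Θ p) (fderiv ℝ Θ p c) (fderiv ℝ Θ p v) (fderiv ℝ Θ p w)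
        + G' (Θ p) (fderiv ℝ (fderiv ℝ Θ) p c v) (fderiv ℝ Θ p w)
        + G' (Θ p) (fderiv ℝ Θ p v) (fderiv ℝ (fderiv ℝ Θ) p c w) := by
  have h1 : HasFDerivAt (fun q => G q v w) (((fderiv ℝ G p).flip v).flip w) p := by
    refine ((h.metric.hasFDerivAt.clm_apply (hasFDerivAt_const v p)).clm_apply
      (hasFDerivAt_const w p)).congr_fderiv ?_
    ext c
    simp
  have h0 : HasFDerivAt (fun q => G' (Θ q)) ((fderiv ℝ G' (Θ p)).comp (fderiv ℝ Θ p)) p :=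
    h.metric'.hasFDerivAt.comp p h.hasFDerivAt
  obtain ⟨L, hL, hLc⟩ := HasFDerivAt.clm_apply₂ h0
    (h.hasFDerivAt_fderiv.clm_apply (hasFDerivAt_const v p))
    (h.hasFDerivAt_fderiv.clm_apply (hasFDerivAt_const w p))
  have h2 := h1.unique (hL.congr_of_eventuallyEq (by
    filter_upwards [h.eq] with q hq
    exact hq v w))
  have h3 := congrArg (fun L : V →L[ℝ] ℝ => L c) h2
  simp only [hLc] at h3
  simpa using h3

/-- Transformation law of the Christoffel symbols. -/
theorem christoffelL_eq (h : IsPullbackAt G G' Θ p) (v w : V) :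
    fderiv ℝ Θ p (christoffelL G p v w) = fderiv ℝ (fderiv ℝ Θ) p v w
      + christoffelL G' (Θ p) (fderiv ℝ Θ p v) (fderiv ℝ Θ p w) := by
  have hinv := h.metric'.invertible.self_of_nhds
  -- Both sides are compared through their products with all vectors, by the Koszul formula.
  refine hinv.injective (ContinuousLinearMap.ext fun z' => ?_)
  obtain ⟨z, rfl⟩ := h.surjective.self_of_nhds z'
  rw [← h.eq.self_of_nhds, apply_christoffel h.metric.invertible.self_of_nhds, map_add,
    add_apply, apply_christoffel hinv, koszul_apply, koszul_apply,
    h.fderiv_metric, h.fderiv_metric, h.fderiv_metric, h.fderiv_fderiv_symm w v,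
    h.fderiv_fderiv_symm z v, h.fderiv_fderiv_symm z w,
    h.metric'.symm.self_of_nhds (fderiv ℝ Θ p w) (fderiv ℝ (fderiv ℝ Θ) p v z)]
  ring

/-- The curvature is a tensor. -/
theorem curvature_eq [CompleteSpace V] [CompleteSpace W] (h : IsPullbackAt G G' Θ p) (c d b : V) :
    fderiv ℝ Θ p (curvature G p c d b)
      = curvature G' (Θ p) (fderiv ℝ Θ p c) (fderiv ℝ Θ p d) (fderiv ℝ Θ p b) := by
  -- The derivative of the transformation law of the Christoffel symbols; the third derivatives of
  -- `Θ` cancel in the alternation over `c` and `d`.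
  have key : ∀ c d : V, fderiv ℝ (fderiv ℝ Θ) p c (christoffelL G p d b)
      + fderiv ℝ Θ p (fderiv ℝ (christoffelL G) p c d b)
      = fderiv ℝ (fderiv ℝ (fderiv ℝ Θ)) p c d b
        + (fderiv ℝ (christoffelL G') (Θ p) (fderiv ℝ Θ p c) (fderiv ℝ Θ p d) (fderiv ℝ Θ p b)
          + christoffelL G' (Θ p) (fderiv ℝ (fderiv ℝ Θ) p c d) (fderiv ℝ Θ p b)
          + christoffelL G' (Θ p) (fderiv ℝ Θ p d) (fderiv ℝ (fderiv ℝ Θ) p c b)) := by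
    intro c d
    have h1 := h.hasFDerivAt_fderiv.clm_apply ((h.metric.hasFDerivAt_christoffelL.clm_apply
      (hasFDerivAt_const d p)).clm_apply (hasFDerivAt_const b p))
    have h2 := (h.hasFDerivAt_fderiv_fderiv.clm_apply (hasFDerivAt_const d p)).clm_apply
      (hasFDerivAt_const b p)
    have h0 : HasFDerivAt (fun q => christoffelL G' (Θ q))
        ((fderiv ℝ (christoffelL G') (Θ p)).comp (fderiv ℝ Θ p)) p :=
      h.metric'.hasFDerivAt_christoffelL.comp p h.hasFDerivAt
    obtain ⟨L, hL, hLc⟩ := HasFDerivAt.clm_apply₂ h0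
      (h.hasFDerivAt_fderiv.clm_apply (hasFDerivAt_const d p))
      (h.hasFDerivAt_fderiv.clm_apply (hasFDerivAt_const b p))
    have h3 := h1.unique ((h2.add hL).congr_of_eventuallyEq (by
      filter_upwards [h.eventually] with q hq
      exact hq.christoffelL_eq d b))
    have h4 := congrArg (fun L : V →L[ℝ] W => L c) h3
    simp only [add_apply, hLc] at h4
    simp at h4
    rw [← h4]
    abel
  have hsymm : fderiv ℝ (fderiv ℝ (fderiv ℝ Θ)) p c d = fderiv ℝ (fderiv ℝ (fderiv ℝ Θ)) p d c :=
    (h.contDiffAt_fderiv.isSymmSndFDerivAt (by simp)).eq c d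
  have e1 := key c d
  have e2 := key d c
  rw [← hsymm, h.fderiv_fderiv_symm d c] at e2
  have e1' := eq_sub_of_add_eq' e1
  have e2' := eq_sub_of_add_eq' e2
  rw [h.metric.curvature_eq, h.metric'.curvature_eq]
  simp only [map_add, map_sub, e1', e2', h.christoffelL_eq]
  abel

theorem riemann_eq [CompleteSpace V] [CompleteSpace W] (h : IsPullbackAt G G' Θ p) (a b c d : V) :
    riemann G p a b c d = riemann G' (Θ p) (fderiv ℝ Θ p a) (fderiv ℝ Θ p b) (fderiv ℝ Θ p c)
      (fderiv ℝ Θ p d) := by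
  rw [riemann, riemann, h.eq.self_of_nhds, h.curvature_eq]

end IsPullbackAt

end ChangeOfCoordinates

/-! ### Conformal change by a function of time -/

section Conformal

set_option maxSynthPendingDepth 3

variable {V : Type*} [NormedAddCommGroup V] [NormedSpace ℝ V]

/-- The change `v⁰ w + w⁰ v - A (v, w) ∇x⁰` of the Christoffel symbols of the metric `A`, per unit
of `f'`, when `A` is multiplied by `e^{2 f(x⁰)}`. -/
def conformalShift (A : ℝ × V →L[ℝ] ℝ × V →L[ℝ] ℝ) : ℝ × V →L[ℝ] ℝ × V →L[ℝ] ℝ × V :=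
  (ContinuousLinearMap.fst ℝ ℝ V).smulRight (ContinuousLinearMap.id ℝ (ℝ × V))
    + ((ContinuousLinearMap.fst ℝ ℝ V).smulRight (ContinuousLinearMap.id ℝ (ℝ × V))).flip
    - ((ContinuousLinearMap.smulRightL ℝ (ℝ × V) (ℝ × V)).flip
        (A.inverse (ContinuousLinearMap.fst ℝ ℝ V))).comp A

theorem conformalShift_apply (A : ℝ × V →L[ℝ] ℝ × V →L[ℝ] ℝ) (v w : ℝ × V) :
    conformalShift A v w
      = v.1 • w + w.1 • v - A v w • A.inverse (ContinuousLinearMap.fst ℝ ℝ V) := by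
  simp [conformalShift]

variable {G Gt : ℝ × V → ℝ × V →L[ℝ] ℝ × V →L[ℝ] ℝ} {f : ℝ → ℝ} {p : ℝ × V}

/-- `G = e^{2 f(x⁰)} Gt` near `p`. -/
structure IsConformalAt (G Gt : ℝ × V → ℝ × V →L[ℝ] ℝ × V →L[ℝ] ℝ) (f : ℝ → ℝ) (p : ℝ × V) :
    Prop where
  metric : IsMetricAt Gt p
  contDiffAt : ContDiffAt ℝ 2 f p.1
  eq : ∀ᶠ q in 𝓝 p, G q = Real.exp (2 * f q.1) • Gt q

namespace IsConformalAt

theorem eventually (h : IsConformalAt G Gt f p) : ∀ᶠ q in 𝓝 p, IsConformalAt G Gt f q := by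
  filter_upwards [h.metric.eventually, (continuous_fst.tendsto p).eventually
    (h.contDiffAt.eventually (by simp)), h.eq.eventually_nhds] with q h1 h2 h3
  exact ⟨h1, h2, h3⟩

theorem isMetricAt (h : IsConformalAt G Gt f p) : IsMetricAt G p := by
  refine ⟨?_, ?_, ?_⟩
  · have h1 : ContDiffAt ℝ 2 (fun q : ℝ × V => Real.exp (2 * f q.1)) p :=
      Real.contDiff_exp.contDiffAt.comp p
        (contDiffAt_const.mul (h.contDiffAt.comp p contDiffAt_fst))
    exact (h1.smul h.metric.contDiffAt).congr_of_eventuallyEq h.eq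
  · filter_upwards [h.eq, h.metric.invertible] with q h1 h2
    obtain ⟨e, he⟩ := h2
    rw [h1, ← he]
    have hc := (Real.exp_pos (2 * f q.1)).ne'
    refine ContinuousLinearMap.IsInvertible.of_inverse
      (g := (Real.exp (2 * f q.1))⁻¹ • (e.symm : (ℝ × V →L[ℝ] ℝ) →L[ℝ] ℝ × V)) ?_ ?_
    · refine ContinuousLinearMap.ext fun v => ?_
      simp [hc]
    · refine ContinuousLinearMap.ext fun v => ?_
      simp [hc]
  · filter_upwards [h.eq, h.metric.symm] with q h1 h2 v w
    simp [h1, h2 v w]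

theorem fderiv_eq (h : IsConformalAt G Gt f p) (c v w : ℝ × V) :
    fderiv ℝ G p c v w
      = Real.exp (2 * f p.1) * (2 * deriv f p.1 * c.1 * Gt p v w + fderiv ℝ Gt p c v w) := by
  have hf : HasFDerivAt (fun q : ℝ × V => f q.1)
      (deriv f p.1 • ContinuousLinearMap.fst ℝ ℝ V) p :=
    (h.contDiffAt.differentiableAt (by simp)).hasDerivAt.comp_hasFDerivAt p hasFDerivAt_fst
  have h1 := ((hf.const_mul 2).exp.smul h.metric.hasFDerivAt).congr_of_eventuallyEq h.eq
  rw [h1.fderiv]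
  simp
  ring

/-- The Christoffel symbols after a conformal change. -/
theorem christoffelL_eq (h : IsConformalAt G Gt f p) :
    christoffelL G p = christoffelL Gt p + deriv f p.1 • conformalShift (Gt p) := by
  have hG := h.isMetricAt.invertible.self_of_nhds
  have hGt := h.metric.invertible.self_of_nhds
  refine ContinuousLinearMap.ext fun v => ContinuousLinearMap.ext fun w => ?_
  refine hG.injective (ContinuousLinearMap.ext fun z => ?_)
  rw [apply_christoffel hG, koszul_apply, h.fderiv_eq, h.fderiv_eq, h.fderiv_eq,
    h.eq.self_of_nhds]
  simp only [add_apply, smul_apply, map_add, map_sub, map_smul, sub_apply, smul_eq_mul,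
    conformalShift_apply, apply_christoffel hGt, koszul_apply, hGt.self_apply_inverse,
    ContinuousLinearMap.coe_fst']
  ring

end IsConformalAt

theorem IsMetricAt.differentiableAt_inverse [CompleteSpace V] (h : IsMetricAt Gt p) :
    DifferentiableAt ℝ (fun q => (Gt q).inverse) p := by
  obtain ⟨e, he⟩ := h.invertible.self_of_nhds
  have h2 := contDiffAt_map_inverse (𝕜 := ℝ) (n := 1) e
  rw [he] at h2
  exact (h2.differentiableAt (by simp)).comp p h.hasFDerivAt.differentiableAt

/-- The derivative of the Christoffel symbols in terms of the derivatives of the metric. -/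
theorem IsMetricAt.fderiv_christoffelL [CompleteSpace V] (h : IsMetricAt Gt p) (c d b : ℝ × V) :
    fderiv ℝ (christoffelL Gt) p c d b = (Gt p).inverse (koszul (fderiv ℝ (fderiv ℝ Gt) p c) d b
      - fderiv ℝ Gt p c (christoffelL Gt p d b)) := by
  have hinv := h.invertible.self_of_nhds
  refine hinv.injective (ContinuousLinearMap.ext fun z => ?_)
  rw [hinv.self_apply_inverse]
  obtain ⟨L, hL, hLc⟩ := HasFDerivAt.clm_apply₂ h.hasFDerivAt
    ((h.hasFDerivAt_christoffelL.clm_apply (hasFDerivAt_const d p)).clm_apply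
      (hasFDerivAt_const b p)) (hasFDerivAt_const z p)
  have h1 : ∀ v w z : ℝ × V, HasFDerivAt (fun q => fderiv ℝ Gt q v w z)
      ((((fderiv ℝ (fderiv ℝ Gt) p).flip v).flip w).flip z) p := by
    intro v w z
    refine (((h.hasFDerivAt_fderiv.clm_apply (hasFDerivAt_const v p)).clm_apply
      (hasFDerivAt_const w p)).clm_apply (hasFDerivAt_const z p)).congr_fderiv ?_
    refine ContinuousLinearMap.ext fun c => ?_
    simp
  have h2 := (((h1 d b z).add (h1 b d z)).sub (h1 z d b)).const_mul (1 / 2)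
  have h3 := hL.unique (h2.congr_of_eventuallyEq (by
    filter_upwards [h.invertible] with q hq
    rw [apply_christoffel hq, koszul_apply]
    rfl))
  have h4 := congrArg (fun L : ℝ × V →L[ℝ] ℝ => L c) h3
  simp only [hLc] at h4
  simp only [sub_apply, koszul_apply]
  simp at h4
  simp
  linarith

/-- The derivative of `conformalShift` along a field of metrics. -/
theorem IsMetricAt.hasFDerivAt_conformalShift [CompleteSpace V] (h : IsMetricAt Gt p) :
    ∃ S' : ℝ × V →L[ℝ] ℝ × V →L[ℝ] ℝ × V →L[ℝ] ℝ × V,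
      HasFDerivAt (fun q => conformalShift (Gt q)) S' p ∧ ∀ c d b, S' c d b =
        -(fderiv ℝ Gt p c d b • (Gt p).inverse (ContinuousLinearMap.fst ℝ ℝ V))
        + Gt p d b • (Gt p).inverse
          (fderiv ℝ Gt p c ((Gt p).inverse (ContinuousLinearMap.fst ℝ ℝ V))) := by
  have hinv := h.invertible.self_of_nhds
  obtain ⟨Z', hZ'⟩ : ∃ Z', HasFDerivAt
      (fun q => (Gt q).inverse (ContinuousLinearMap.fst ℝ ℝ V)) Z' p :=
    ⟨_, h.differentiableAt_inverse.hasFDerivAt.clm_apply (hasFDerivAt_const _ p)⟩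
  have hZc : ∀ c, Z' c = -(Gt p).inverse
      (fderiv ℝ Gt p c ((Gt p).inverse (ContinuousLinearMap.fst ℝ ℝ V))) := by
    intro c
    have h1 := h.hasFDerivAt.clm_apply hZ'
    have h2 := h1.unique ((hasFDerivAt_const (ContinuousLinearMap.fst ℝ ℝ V) p).congr_of_eventuallyEq
      (by
        filter_upwards [h.invertible] with q hq
        rw [hq.self_apply_inverse]))
    have h3 := congrArg (fun L : ℝ × V →L[ℝ] ℝ × V →L[ℝ] ℝ => L c) h2
    refine hinv.injective ?_
    rw [map_neg, hinv.self_apply_inverse]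
    simp at h3
    exact eq_neg_of_add_eq_zero_left h3
  have h1 := ((ContinuousLinearMap.smulRightL ℝ (ℝ × V) (ℝ × V)).flip.hasFDerivAt.comp p hZ')
  have h2 := (h1.clm_comp h.hasFDerivAt).const_sub
    ((ContinuousLinearMap.fst ℝ ℝ V).smulRight (ContinuousLinearMap.id ℝ (ℝ × V))
    + ((ContinuousLinearMap.fst ℝ ℝ V).smulRight (ContinuousLinearMap.id ℝ (ℝ × V))).flip)
  refine ⟨_, h2, fun c d b => ?_⟩
  simp [hZc]
  abel

end Conformal

/-! ### Asymptotics of the curvature under a conformal change -/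

section Jets

set_option maxSynthPendingDepth 3

variable {V : Type*} [NormedAddCommGroup V] [NormedSpace ℝ V]

/-- The space of 2-jets `(A, B, D, H)` of metrics: the metric, its inverse, and its first and
second derivatives. -/
abbrev Jet (V : Type*) [NormedAddCommGroup V] [NormedSpace ℝ V] : Type _ :=
  (ℝ × V →L[ℝ] ℝ × V →L[ℝ] ℝ) × ((ℝ × V →L[ℝ] ℝ) →L[ℝ] ℝ × V) ×
    (ℝ × V →L[ℝ] ℝ × V →L[ℝ] ℝ × V →L[ℝ] ℝ) ×
      (ℝ × V →L[ℝ] ℝ × V →L[ℝ] ℝ × V →L[ℝ] ℝ × V →L[ℝ] ℝ)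

namespace Jet

variable (j : Jet V) (c d b v w : ℝ × V)

/-- The Christoffel symbols as a function of the jet. -/
def gam : ℝ × V := j.2.1 (koszul j.2.2.1 v w)

/-- The derivatives of the Christoffel symbols as a function of the jet. -/
def gamDeriv : ℝ × V := j.2.1 (koszul (j.2.2.2 c) d b - j.2.2.1 c (j.gam d b))

/-- The bilinear map `conformalShift` as a function of the jet. -/
def shift : ℝ × V := v.1 • w + w.1 • v - j.1 v w • j.2.1 (ContinuousLinearMap.fst ℝ ℝ V)

/-- The derivative of `conformalShift` as a function of the jet. -/
def shiftDeriv : ℝ × V :=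
  -(j.2.2.1 c d b • j.2.1 (ContinuousLinearMap.fst ℝ ℝ V))
    + j.1 d b • j.2.1 (j.2.2.1 c (j.2.1 (ContinuousLinearMap.fst ℝ ℝ V)))

/-- The curvature of `e^{2 f(x⁰)}` times a metric with the jet `j`, divided by `|f'|²`, as a
function of `j`, `s = 1 / f'` and `r = f'' / |f'|²`. -/
def curv (s r : ℝ) : ℝ × V :=
  s ^ 2 • (j.gamDeriv c d b - j.gamDeriv d c b + j.gam c (j.gam d b) - j.gam d (j.gam c b))
  + s • (j.shiftDeriv c d b - j.shiftDeriv d c b + j.gam c (j.shift d b) + j.shift c (j.gam d b)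
      - j.gam d (j.shift c b) - j.shift d (j.gam c b))
  + (j.shift c (j.shift d b) - j.shift d (j.shift c b))
  + r • (c.1 • j.shift d b - d.1 • j.shift c b)

end Jet

theorem continuous_koszul : Continuous (koszul (V := V)) := by
  have h : Continuous fun D : V →L[ℝ] V →L[ℝ] V →L[ℝ] ℝ => D.flip :=
    (ContinuousLinearMap.flipₗᵢ ℝ V V (V →L[ℝ] ℝ)).continuous
  exact ((continuous_id.add h).sub (continuous_const.clm_comp h)).const_smul (1 / 2 : ℝ)

theorem continuous_curv : Continuous fun z : Jet V × ℝ × ℝ × (ℝ × V) × (ℝ × V) =>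
    z.1.1 (z.1.curv z.2.2.2.1 z.2.2.2.2 z.2.2.2.2 z.2.1 z.2.2.1) z.2.2.2.1 := by
  have hk : Continuous (koszul (V := ℝ × V)) := continuous_koszul
  have hgam : ∀ {T : Type _} [TopologicalSpace T] {j : T → Jet V} {v w : T → ℝ × V},
      Continuous j → Continuous v → Continuous w → Continuous fun t => (j t).gam (v t) (w t) := by
    intro T _ j v w hj hv hw
    exact hj.snd.fst.clm_apply (((hk.comp hj.snd.snd.fst).clm_apply hv).clm_apply hw)
  have hgamD : ∀ {T : Type _} [TopologicalSpace T] {j : T → Jet V} {c v w : T → ℝ × V},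
      Continuous j → Continuous c → Continuous v → Continuous w →
      Continuous fun t => (j t).gamDeriv (c t) (v t) (w t) := by
    intro T _ j c v w hj hc hv hw
    exact hj.snd.fst.clm_apply
      ((((hk.comp (hj.snd.snd.snd.clm_apply hc)).clm_apply hv).clm_apply hw).sub
        ((hj.snd.snd.fst.clm_apply hc).clm_apply (hgam hj hv hw)))
  have hshift : ∀ {T : Type _} [TopologicalSpace T] {j : T → Jet V} {v w : T → ℝ × V},
      Continuous j → Continuous v → Continuous w → Continuous fun t => (j t).shift (v t) (w t) := by
    intro T _ j v w hj hv hw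
    exact ((hv.fst.smul hw).add (hw.fst.smul hv)).sub
      (((hj.fst.clm_apply hv).clm_apply hw).smul (hj.snd.fst.clm_apply continuous_const))
  have hshiftD : ∀ {T : Type _} [TopologicalSpace T] {j : T → Jet V} {c v w : T → ℝ × V},
      Continuous j → Continuous c → Continuous v → Continuous w →
      Continuous fun t => (j t).shiftDeriv (c t) (v t) (w t) := by
    intro T _ j c v w hj hc hv hw
    have hZ : Continuous fun t => (j t).2.1 (ContinuousLinearMap.fst ℝ ℝ V) :=
      hj.snd.fst.clm_apply continuous_const
    exact ((((hj.snd.snd.fst.clm_apply hc).clm_apply hv).clm_apply hw).smul hZ).neg.add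
      (((hj.fst.clm_apply hv).clm_apply hw).smul
        (hj.snd.fst.clm_apply ((hj.snd.snd.fst.clm_apply hc).clm_apply hZ)))
  have hj : Continuous fun z : Jet V × ℝ × ℝ × (ℝ × V) × (ℝ × V) => z.1 := continuous_fst
  have hc : Continuous fun z : Jet V × ℝ × ℝ × (ℝ × V) × (ℝ × V) => z.2.2.2.1 := by fun_prop
  have hd : Continuous fun z : Jet V × ℝ × ℝ × (ℝ × V) × (ℝ × V) => z.2.2.2.2 := by fun_prop
  have hs : Continuous fun z : Jet V × ℝ × ℝ × (ℝ × V) × (ℝ × V) => z.2.1 := by fun_prop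
  have hr : Continuous fun z : Jet V × ℝ × ℝ × (ℝ × V) × (ℝ × V) => z.2.2.1 := by fun_prop
  refine (hj.fst.clm_apply ?_).clm_apply hc
  refine (((hs.pow 2).smul ?_).add (hs.smul ?_)).add ?_ |>.add (hr.smul ?_)
  · exact (((hgamD hj hc hd hd).sub (hgamD hj hd hc hd)).add (hgam hj hc (hgam hj hd hd))).sub
      (hgam hj hd (hgam hj hc hd))
  · exact (((((hshiftD hj hc hd hd).sub (hshiftD hj hd hc hd)).add
      (hgam hj hc (hshift hj hd hd))).add (hshift hj hc (hgam hj hd hd))).sub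
      (hgam hj hd (hshift hj hc hd))).sub (hshift hj hd (hgam hj hc hd))
  · exact (hshift hj hc (hshift hj hd hd)).sub (hshift hj hd (hshift hj hc hd))
  · exact (hc.fst.smul (hshift hj hd hd)).sub (hd.fst.smul (hshift hj hc hd))

/-- The 2-jet of `G` at `p`. -/
def jetAt (G : ℝ × V → ℝ × V →L[ℝ] ℝ × V →L[ℝ] ℝ) (p : ℝ × V) : Jet V :=
  (G p, (G p).inverse, fderiv ℝ G p, fderiv ℝ (fderiv ℝ G) p)

variable {G Gt : ℝ × V → ℝ × V →L[ℝ] ℝ × V →L[ℝ] ℝ} {f : ℝ → ℝ} {p : ℝ × V}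

theorem christoffelL_eq_gam (v w : ℝ × V) : christoffelL Gt p v w = (jetAt Gt p).gam v w := by
  simp [christoffelL, Jet.gam, jetAt]

/-- The curvature of a metric after a conformal change by a function of time. -/
theorem IsConformalAt.curvature_eq [CompleteSpace V] (h : IsConformalAt G Gt f p)
    (hf : deriv f p.1 ≠ 0) (c d b : ℝ × V) :
    curvature G p c d b = deriv f p.1 ^ 2 • (jetAt Gt p).curv c d b
      (deriv f p.1)⁻¹ (deriv (deriv f) p.1 / deriv f p.1 ^ 2) := by
  obtain ⟨S', hS', hS⟩ := h.metric.hasFDerivAt_conformalShift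
  have hf' : HasFDerivAt (fun q : ℝ × V => deriv f q.1)
      (deriv (deriv f) p.1 • ContinuousLinearMap.fst ℝ ℝ V) p := by
    have h1 : DifferentiableAt ℝ (deriv f) p.1 := by
      have h2 : ContDiffAt ℝ 1 (fderiv ℝ f) p.1 := h.contDiffAt.fderiv_right (by norm_num)
      exact (h2.differentiableAt (by simp)).clm_apply (differentiableAt_const (1 : ℝ))
    exact h1.hasDerivAt.comp_hasFDerivAt p hasFDerivAt_fst
  have hΓ' := h.metric.hasFDerivAt_christoffelL.add (hf'.smul hS')
  rw [ARW.curvature_eq (Γ := fun q => christoffelL Gt q + deriv f q.1 • conformalShift (Gt q))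
    (by filter_upwards [h.eventually] with q hq using hq.christoffelL_eq) hΓ' c d b]
  have hshift : ∀ v w, conformalShift (Gt p) v w = (jetAt Gt p).shift v w := fun v w =>
    conformalShift_apply _ _ _
  have hshiftD : ∀ c d b, S' c d b = (jetAt Gt p).shiftDeriv c d b := hS
  have hgamD : ∀ c d b, fderiv ℝ (christoffelL Gt) p c d b = (jetAt Gt p).gamDeriv c d b := by
    intro c d b
    rw [h.metric.fderiv_christoffelL, Jet.gamDeriv, christoffelL_eq_gam]
    rfl
  have e1 : ∀ c d b : ℝ × V, (fderiv ℝ (christoffelL Gt) p + (deriv f p.1 • S' +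
      (deriv (deriv f) p.1 • ContinuousLinearMap.fst ℝ ℝ V).smulRight (conformalShift (Gt p))))
      c d b = (jetAt Gt p).gamDeriv c d b + deriv f p.1 • (jetAt Gt p).shiftDeriv c d b
        + (deriv (deriv f) p.1 * c.1) • (jetAt Gt p).shift d b := by
    intro c d b
    simp only [add_apply, smul_apply, ContinuousLinearMap.smulRight_apply, hgamD, hshiftD, hshift,
      ContinuousLinearMap.coe_fst', smul_eq_mul, add_assoc]
  rw [e1, e1]
  simp only [add_apply, smul_apply, map_add, map_smul, ← hgamD, ← hshiftD, ← hshift,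
    ← christoffelL_eq_gam, Jet.curv]
  have hs : (deriv f p.1)⁻¹ * deriv f p.1 = 1 := inv_mul_cancel₀ hf
  match_scalars <;> field_simp

end Jets

/-! ### The limit of the curvature -/

section Limit

set_option maxSynthPendingDepth 3

variable {n : ℕ}

theorem isInvertible_of_nondegenerate {E : Type*} [NormedAddCommGroup E] [NormedSpace ℝ E]
    [FiniteDimensional ℝ E] {A : E →L[ℝ] E →L[ℝ] ℝ} (hA : ∀ v, A v = 0 → v = 0) :
    A.IsInvertible := by
  have hfin : Module.finrank ℝ E = Module.finrank ℝ (E →L[ℝ] ℝ) := by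
    rw [← (LinearMap.toContinuousLinearMap (𝕜 := ℝ) (E := E) (F' := ℝ)).finrank_eq]
    exact Subspace.dual_finrank_eq.symm
  have hinj : Function.Injective (A : E →ₗ[ℝ] E →L[ℝ] ℝ) := by
    rw [← LinearMap.ker_eq_bot, LinearMap.ker_eq_bot']
    exact hA
  exact ⟨(LinearEquiv.ofInjectiveOfFinrankEq _ hinj hfin).toContinuousLinearEquiv, by
    refine ContinuousLinearMap.ext fun v => ?_
    rfl⟩

theorem lorentz_apply (s : Coord n →L[ℝ] Coord n →L[ℝ] ℝ) (v w : ℝ × Coord n) :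
    lorentz s v w = s v.2 w.2 - v.1 * w.1 := by
  simp [lorentz]

theorem lorentz_symm {s : Coord n →L[ℝ] Coord n →L[ℝ] ℝ} (hs : ∀ v w, s v w = s w v)
    (v w : ℝ × Coord n) : lorentz s v w = lorentz s w v := by
  rw [lorentz_apply, lorentz_apply, hs, mul_comm]

theorem isInvertible_of_pos {s : Coord n →L[ℝ] Coord n →L[ℝ] ℝ} (hs : ∀ v, v ≠ 0 → 0 < s v v) :
    s.IsInvertible := by
  refine isInvertible_of_nondegenerate fun v hv => ?_
  by_contra h
  have := hs v h
  rw [hv] at this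
  simp at this

theorem isInvertible_lorentz {s : Coord n →L[ℝ] Coord n →L[ℝ] ℝ} (hs : ∀ v, v ≠ 0 → 0 < s v v) :
    (lorentz s).IsInvertible := by
  refine isInvertible_of_nondegenerate fun v hv => ?_
  have h1 : v.1 = 0 := by
    have := congrArg (fun L : ℝ × Coord n →L[ℝ] ℝ => L (1, 0)) hv
    simpa [lorentz_apply] using this
  have h2 : v.2 = 0 := by
    by_contra h
    have h3 := hs v.2 h
    have := congrArg (fun L : ℝ × Coord n →L[ℝ] ℝ => L (0, v.2)) hv
    simp [lorentz_apply] at this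
    linarith
  exact Prod.ext h1 h2

/-- The squared area of the parallelogram spanned by `X` and `Y` with respect to the Riemannian
metric `(dx⁰)² + s`. -/
def areaSq (s : Coord n →L[ℝ] Coord n →L[ℝ] ℝ) (X Y : ℝ × Coord n) : ℝ :=
  (X.1 * X.1 + s X.2 X.2) * (Y.1 * Y.1 + s Y.2 Y.2) - (X.1 * Y.1 + s X.2 Y.2) ^ 2

theorem areaSq_add_smul {s : Coord n →L[ℝ] Coord n →L[ℝ] ℝ} (hs : ∀ v w, s v w = s w v)
    (X Y : ℝ × Coord n) (t : ℝ) : areaSq s X (Y + t • X) = areaSq s X Y := by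
  simp only [areaSq, Prod.fst_add, Prod.snd_add, Prod.smul_fst, Prod.smul_snd, map_add, map_smul,
    add_apply, smul_apply, smul_eq_mul, hs Y.2 X.2]
  ring

theorem areaSq_smul_smul (s : Coord n →L[ℝ] Coord n →L[ℝ] ℝ) (X Y : ℝ × Coord n) (a b : ℝ) :
    areaSq s (a • X) (b • Y) = a ^ 2 * b ^ 2 * areaSq s X Y := by
  simp only [areaSq, Prod.smul_fst, Prod.smul_snd, map_smul, smul_apply, smul_eq_mul]
  ring

theorem areaSq_comm {s : Coord n →L[ℝ] Coord n →L[ℝ] ℝ} (hs : ∀ v w, s v w = s w v)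
    (X Y : ℝ × Coord n) : areaSq s X Y = areaSq s Y X := by
  rw [areaSq, areaSq, hs X.2 Y.2]
  ring

theorem areaSq_pos {s : Coord n →L[ℝ] Coord n →L[ℝ] ℝ} (hs : ∀ v w, s v w = s w v)
    (hp : ∀ v, v ≠ 0 → 0 < s v v) {X Y : ℝ × Coord n} (hX : X ≠ 0) (hY : ∀ t : ℝ, Y ≠ t • X) :
    0 < areaSq s X Y := by
  have hpos : ∀ Z : ℝ × Coord n, Z ≠ 0 → 0 < Z.1 * Z.1 + s Z.2 Z.2 := by
    intro Z hZ
    by_cases h : Z.2 = 0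
    · have : Z.1 ≠ 0 := fun h1 => hZ (Prod.ext h1 h)
      rw [h, map_zero, add_zero]
      exact mul_self_pos.mpr this
    · exact add_pos_of_nonneg_of_pos (mul_self_nonneg _) (hp _ h)
  have hXX := hpos X hX
  set a := X.1 * X.1 + s X.2 X.2 with ha
  set b := X.1 * Y.1 + s X.2 Y.2 with hb
  have hW : a • Y - b • X ≠ 0 := by
    intro h
    refine hY (a⁻¹ * b) ?_
    rw [sub_eq_zero] at h
    rw [mul_smul, ← h, smul_smul, inv_mul_cancel₀ hXX.ne', one_smul]
  have h1 := hpos _ hW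
  have h2 : (a • Y - b • X).1 * (a • Y - b • X).1 + s (a • Y - b • X).2 (a • Y - b • X).2
      = a * areaSq s X Y := by
    simp only [areaSq, ha, hb, Prod.fst_sub, Prod.snd_sub, Prod.smul_fst, Prod.smul_snd, map_sub,
      map_smul, sub_apply, smul_apply, smul_eq_mul, hs Y.2 X.2]
    ring
  rw [h2] at h1
  exact pos_of_mul_pos_right h1 hXX.le

theorem cauchy_schwarz {s : Coord n →L[ℝ] Coord n →L[ℝ] ℝ} (hs : ∀ v w, s v w = s w v)
    (hp : ∀ v, v ≠ 0 → 0 < s v v) (v w : Coord n) : s v w ^ 2 ≤ s v v * s w w := by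
  by_cases hv : v = 0
  · simp [hv]
  have h0 : ∀ v, 0 ≤ s v v := fun v => by
    by_cases h : v = 0
    · simp [h]
    · exact (hp v h).le
  have h1 := h0 (s v v • w - s v w • v)
  have h2 : s (s v v • w - s v w • v) (s v v • w - s v w • v)
      = s v v * (s v v * s w w - s v w ^ 2) := by
    simp only [map_sub, map_smul, sub_apply, smul_apply, smul_eq_mul, hs w v]
    ring
  rw [h2] at h1
  linarith [nonneg_of_mul_nonneg_right h1 (hp v hv)]

/-- In the limit, the curvature form is `γ` on planes containing `∂₀` and `1` on planes orthogonal
to it, with respect to the metric `(dx⁰)² + s`. -/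
theorem curv_limit {s : Coord n →L[ℝ] Coord n →L[ℝ] ℝ} (hs : ∀ v w, s v w = s w v)
    (hp : ∀ v, v ≠ 0 → 0 < s v v) {j : Jet (Coord n)} (h1 : j.1 = lorentz s)
    (h2 : j.2.1 = (lorentz s).inverse) (γ : ℝ) (X Y : ℝ × Coord n) :
    j.1 (j.curv X Y Y 0 (-γ)) X
      = γ * s (X.1 • Y.2 - Y.1 • X.2) (X.1 • Y.2 - Y.1 • X.2)
        + (s X.2 X.2 * s Y.2 Y.2 - s X.2 Y.2 ^ 2) := by
  have hZ : j.2.1 (ContinuousLinearMap.fst ℝ ℝ (Coord n)) = (-1, 0) := by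
    have : lorentz s (-1, 0) = ContinuousLinearMap.fst ℝ ℝ (Coord n) := by
      refine ContinuousLinearMap.ext fun v => ?_
      simp [lorentz_apply]
    rw [h2, ← this, (isInvertible_lorentz hp).inverse_apply_self]
  have hsh : ∀ v w, j.shift v w = v.1 • w + w.1 • v + lorentz s v w • ((1 : ℝ), (0 : Coord n)) := by
    intro v w
    have : ((-1 : ℝ), (0 : Coord n)) = -((1 : ℝ), (0 : Coord n)) := by simp
    rw [Jet.shift, hZ, h1, this, smul_neg, sub_neg_eq_add]
  simp only [Jet.curv, hsh, h1, lorentz_apply]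
  simp only [ne_eq, OfNat.ofNat_ne_zero, not_false_eq_true, zero_pow, zero_smul, zero_add,
    Prod.fst_add, Prod.snd_add, Prod.fst_sub, Prod.snd_sub, Prod.smul_fst, Prod.smul_snd, map_add,
    map_sub, map_smul, add_apply, sub_apply, smul_apply, smul_eq_mul, smul_zero, add_zero, mul_one,
    hs Y.2 X.2]
  ring

/-- The factor `1 / 2` leaves the room needed to pass from the limit to a neighbourhood. -/
theorem areaSq_lt_curv_limit {s : Coord n →L[ℝ] Coord n →L[ℝ] ℝ} (hs : ∀ v w, s v w = s w v)
    (hp : ∀ v, v ≠ 0 → 0 < s v v) {j : Jet (Coord n)} (h1 : j.1 = lorentz s)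
    (h2 : j.2.1 = (lorentz s).inverse) {γ : ℝ} (hγ : 0 < γ) {X Y : ℝ × Coord n} (hX : X ≠ 0)
    (hY : ∀ t : ℝ, Y ≠ t • X) :
    min γ 1 / 2 * areaSq s X Y < j.1 (j.curv X Y Y 0 (-γ)) X := by
  have hQ := areaSq_pos hs hp hX hY
  have hm : 0 < min γ 1 := lt_min hγ one_pos
  have h3 : areaSq s X Y = s (X.1 • Y.2 - Y.1 • X.2) (X.1 • Y.2 - Y.1 • X.2)
        + (s X.2 X.2 * s Y.2 Y.2 - s X.2 Y.2 ^ 2) := by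
    simp only [areaSq, map_sub, map_smul, sub_apply, smul_apply, smul_eq_mul, hs Y.2 X.2]
    ring
  have h4 : 0 ≤ s (X.1 • Y.2 - Y.1 • X.2) (X.1 • Y.2 - Y.1 • X.2) := by
    by_cases h : X.1 • Y.2 - Y.1 • X.2 = 0
    · simp [h]
    · exact (hp _ h).le
  have h5 := cauchy_schwarz hs hp X.2 Y.2
  rw [curv_limit hs hp h1 h2]
  have h6 := mul_le_mul_of_nonneg_right (min_le_left γ 1) h4
  have h7 := mul_le_mul_of_nonneg_right (min_le_right γ 1) (sub_nonneg.mpr h5)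
  have h8 := mul_pos hm hQ
  rw [h3] at h8 ⊢
  nlinarith

/-- Pairs of vectors of norm one which are orthogonal for the Euclidean scalar product. The norm is
that of the product space, a maximum; all that matters is that the set is compact and meets all
planes in a basis. -/
def orthoPairs (n : ℕ) : Set ((ℝ × Coord n) × (ℝ × Coord n)) :=
  {P | ‖P.1‖ = 1 ∧ ‖P.2‖ = 1 ∧ P.1.1 * P.2.1 + inner ℝ P.1.2 P.2.2 = 0}

theorem isCompact_orthoPairs : IsCompact (orthoPairs n) := by
  refine (isCompact_closedBall (0 : (ℝ × Coord n) × (ℝ × Coord n)) 1).of_isClosed_subset ?_ ?_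
  · refine IsClosed.inter (isClosed_eq (by fun_prop) (by fun_prop))
      (IsClosed.inter (isClosed_eq (by fun_prop) (by fun_prop))
      (isClosed_eq (by fun_prop) (by fun_prop)))
  · rintro ⟨X, Y⟩ ⟨h1, h2, -⟩
    rw [mem_closedBall_zero_iff, Prod.norm_def]
    exact max_le h1.le h2.le

theorem euclidean_self_pos {X : ℝ × Coord n} (hX : X ≠ 0) :
    0 < X.1 * X.1 + inner ℝ X.2 X.2 := by
  by_cases h : X.2 = 0
  · have : X.1 ≠ 0 := fun h1 => hX (Prod.ext h1 h)
    rw [h, inner_zero_left, add_zero]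
    exact mul_self_pos.mpr this
  · exact add_pos_of_nonneg_of_pos (mul_self_nonneg _) (real_inner_self_pos.mpr h)

theorem orthoPairs_independent {X Y : ℝ × Coord n} (h : (X, Y) ∈ orthoPairs n) :
    X ≠ 0 ∧ ∀ t : ℝ, Y ≠ t • X := by
  obtain ⟨h1, h2, h3⟩ := h
  have hX : X ≠ 0 := by
    rintro rfl
    simp at h1
  refine ⟨hX, fun t ht => ?_⟩
  have h4 := euclidean_self_pos hX
  simp only [ht, Prod.smul_fst, Prod.smul_snd, inner_smul_right, smul_eq_mul] at h3
  have h5 : t * (X.1 * X.1 + inner ℝ X.2 X.2) = 0 := by linarith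
  rcases mul_eq_zero.mp h5 with h6 | h6
  · rw [ht, h6] at h2
    simp at h2
  · exact h4.ne' h6

theorem IsMetricAt.riemann_smul_smul {G : ℝ × Coord n → ℝ × Coord n →L[ℝ] ℝ × Coord n →L[ℝ] ℝ}
    {p : ℝ × Coord n} (h : IsMetricAt G p) (X Y : ℝ × Coord n) (a b : ℝ) :
    riemann G p (a • X) (b • Y) (a • X) (b • Y) = a ^ 2 * b ^ 2 * riemann G p X Y X Y := by
  simp only [riemann, h.curvature_eq, map_smul, smul_apply, smul_smul,
    map_add, map_sub, add_apply, sub_apply, smul_eq_mul]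
  ring

/-- A lower bound for the curvature form by the area needs to be checked for normalized pairs of
orthogonal vectors only. -/
theorem IsMetricAt.areaSq_le_riemann
    {G : ℝ × Coord n → ℝ × Coord n →L[ℝ] ℝ × Coord n →L[ℝ] ℝ} {p : ℝ × Coord n}
    (h : IsMetricAt G p) {s : Coord n →L[ℝ] Coord n →L[ℝ] ℝ} (hs : ∀ v w, s v w = s w v) {c : ℝ}
    (hK : ∀ P ∈ orthoPairs n, c * areaSq s P.1 P.2 ≤ riemann G p P.1 P.2 P.1 P.2)
    (X Y : ℝ × Coord n) : c * areaSq s X Y ≤ riemann G p X Y X Y := by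
  have hzero : ∀ (a b : ℝ) (X Y : ℝ × Coord n), a ^ 2 * b ^ 2 = 0 →
      c * areaSq s (a • X) (b • Y) ≤ riemann G p (a • X) (b • Y) (a • X) (b • Y) := by
    intro a b X Y hab
    rw [areaSq_smul_smul, h.riemann_smul_smul, hab]
    simp
  by_cases hX : X = 0
  · have := hzero 0 1 X Y (by simp)
    simpa [hX] using this
  set t := (X.1 * Y.1 + inner ℝ X.2 Y.2) / (X.1 * X.1 + inner ℝ X.2 X.2) with ht
  set Y' := Y + (-t) • X with hY'
  rw [← areaSq_add_smul hs X Y (-t), ← h.riemann_add_smul X Y (-t), ← hY']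
  by_cases hY0 : Y' = 0
  · have := hzero 1 0 X Y' (by simp)
    simpa [hY0] using this
  have hx := norm_ne_zero_iff.mpr hX
  have hy := norm_ne_zero_iff.mpr hY0
  have horth : X.1 * Y'.1 + inner ℝ X.2 Y'.2 = 0 := by
    have h1 := (euclidean_self_pos hX).ne'
    simp only [hY', Prod.fst_add, Prod.snd_add, Prod.smul_fst, Prod.smul_snd, smul_eq_mul,
      inner_add_right, inner_smul_right]
    have h2 : t * (X.1 * X.1 + inner ℝ X.2 X.2) = X.1 * Y.1 + inner ℝ X.2 Y.2 := by
      rw [ht, div_mul_cancel₀ _ h1]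
    linear_combination -h2
  have hmem : (‖X‖⁻¹ • X, ‖Y'‖⁻¹ • Y') ∈ orthoPairs n := by
    refine ⟨?_, ?_, ?_⟩
    · rw [norm_smul, norm_inv, norm_norm, inv_mul_cancel₀ hx]
    · rw [norm_smul, norm_inv, norm_norm, inv_mul_cancel₀ hy]
    · simp only [Prod.smul_fst, Prod.smul_snd, smul_eq_mul, inner_smul_left, inner_smul_right,
        conj_trivial]
      linear_combination (‖X‖⁻¹ * ‖Y'‖⁻¹) * horth
  have h3 := hK _ hmem
  simp only [areaSq_smul_smul, h.riemann_smul_smul] at h3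
  have h4 : 0 < ‖X‖⁻¹ ^ 2 * ‖Y'‖⁻¹ ^ 2 := by positivity
  refine le_of_mul_le_mul_left ?_ h4
  linarith

end Limit

/-! ### Convergence of jets -/

section JetConvergence

set_option maxSynthPendingDepth 3

variable {E F : Type*} [NormedAddCommGroup E] [NormedSpace ℝ E]
  [NormedAddCommGroup F] [NormedSpace ℝ F]

theorem continuousMultilinearCurryFin1_iteratedFDeriv (f : E → F) (x : E) :
    continuousMultilinearCurryFin1 ℝ E F (iteratedFDeriv ℝ 1 f x) = fderiv ℝ f x := by
  refine ContinuousLinearMap.ext fun v => ?_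
  rw [continuousMultilinearCurryFin1_apply, iteratedFDeriv_one_apply]
  rfl

/-- The second derivative as a linear map into linear maps depends continuously on the second
iterated derivative. -/
theorem exists_continuous_iteratedFDeriv_two :
    ∃ L : (E [×2]→L[ℝ] F) → E →L[ℝ] E →L[ℝ] F, Continuous L ∧
      ∀ (f : E → F) (x : E), L (iteratedFDeriv ℝ 2 f x) = fderiv ℝ (fderiv ℝ f) x := by
  refine ⟨fun M => ((continuousMultilinearCurryFin1 ℝ E F).toContinuousLinearEquiv :
    (E [×1]→L[ℝ] F) →L[ℝ] E →L[ℝ] F).comp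
      (continuousMultilinearCurryLeftEquiv ℝ (fun _ : Fin 2 => E) F M), ?_, fun f x => ?_⟩
  · exact continuous_const.clm_comp
      (continuousMultilinearCurryLeftEquiv ℝ (fun _ : Fin 2 => E) F).continuous
  · refine ContinuousLinearMap.ext fun v => ContinuousLinearMap.ext fun w => ?_
    simp
    rw [iteratedFDeriv_two_apply]
    rfl

/-- Locally uniform convergence to a continuous limit, as convergence along a product filter. -/
theorem tendsto_of_tendstoUniformlyOn {Z : Type*} [PseudoMetricSpace Z] {X : Type*}
    [TopologicalSpace X] {g : ℝ → X → Z} {g₀ : X → Z} {l : Filter ℝ} {K : Set X} {y : X}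
    (h : TendstoUniformlyOn g g₀ l K) (hK : K ∈ 𝓝 y) (hg : ContinuousAt g₀ y) :
    Tendsto (fun q : ℝ × X => g q.1 q.2) (l ×ˢ 𝓝 y) (𝓝 (g₀ y)) := by
  rw [tendstoUniformlyOn_iff_tendsto] at h
  have h1 := h.mono_left (Filter.prod_mono le_rfl (le_principal_iff.mpr hK) : l ×ˢ 𝓝 y ≤ l ×ˢ 𝓟 K)
  rw [tendsto_uniformity_iff_dist_tendsto_zero] at h1
  have h2 : Tendsto (fun q : ℝ × X => dist (g₀ q.2) (g₀ y)) (l ×ˢ 𝓝 y) (𝓝 0) :=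
    tendsto_iff_dist_tendsto_zero.mp (hg.tendsto.comp tendsto_snd)
  rw [tendsto_iff_dist_tendsto_zero]
  refine squeeze_zero (fun _ => dist_nonneg) (fun q => ?_) (by simpa using h1.add h2)
  rw [dist_comm (g₀ q.2)]
  exact dist_triangle _ _ _

end JetConvergence

/-! ### Charts -/

section Charts

set_option maxSynthPendingDepth 3

variable {n : ℕ} {S : Type*} [TopologicalSpace S] [ChartedSpace (Coord n) S]
  {φ φ' : OpenPartialHomeomorph S (Coord n)}

theorem inChart_apply (φ : OpenPartialHomeomorph S (Coord n)) (s : BilinField n S)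
    (y v w : Coord n) :
    inChart φ s y v w = s (φ.symm y) (chartInvDeriv φ y v) (chartInvDeriv φ y w) := rfl

theorem IsScalarProduct.inChart_symm {s : BilinField n S} (hs : IsScalarProduct s)
    (φ : OpenPartialHomeomorph S (Coord n)) (y v w : Coord n) :
    inChart φ s y v w = inChart φ s y w v :=
  (hs _).1 _ _

variable [IsManifold (𝓡 n) ∞ S]

theorem chartInvDeriv_injective (hφ : φ ∈ atlas (Coord n) S) {y : Coord n} (hy : y ∈ φ.target) :
    Function.Injective (chartInvDeriv φ y) := by
  have h := (mdifferentiable_of_mem_atlas (I := 𝓡 n) hφ).comp_symm_deriv hy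
  intro v w hvw
  have h3 : ∀ v, mfderiv (𝓡 n) (𝓡 n) φ (φ.symm y) (chartInvDeriv φ y v) = v := fun v =>
    congrArg (fun L => L v) h
  rw [← h3 v, hvw, h3 w]

theorem IsScalarProduct.inChart_pos {s : BilinField n S} (hs : IsScalarProduct s)
    (hφ : φ ∈ atlas (Coord n) S) {y : Coord n} (hy : y ∈ φ.target) (v : Coord n) (hv : v ≠ 0) :
    0 < inChart φ s y v v := by
  refine (hs _).2 _ fun h => hv (chartInvDeriv_injective hφ hy ?_)
  rw [map_zero]
  exact h

theorem contDiffAt_transition (hφ : φ ∈ atlas (Coord n) S) (hφ' : φ' ∈ atlas (Coord n) S)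
    {y : Coord n} (hy : y ∈ φ.target) (hy' : φ.symm y ∈ φ'.source) :
    ContDiffAt ℝ ∞ (φ' ∘ φ.symm) y := by
  have h1 := contMDiffAt_symm_of_mem_maximalAtlas (I := 𝓡 n) (n := ∞)
    (IsManifold.subset_maximalAtlas hφ) hy
  have h2 := contMDiffAt_of_mem_maximalAtlas (I := 𝓡 n) (n := ∞)
    (IsManifold.subset_maximalAtlas hφ') hy'
  exact contMDiffAt_iff_contDiffAt.mp (h2.comp y h1)

theorem chartInvDeriv_transition (hφ : φ ∈ atlas (Coord n) S) (hφ' : φ' ∈ atlas (Coord n) S)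
    {y : Coord n} (hy : y ∈ φ.target) (hy' : φ.symm y ∈ φ'.source) (v : Coord n) :
    chartInvDeriv φ' (φ' (φ.symm y)) (fderiv ℝ (φ' ∘ φ.symm) y v) = chartInvDeriv φ y v := by
  have h0 := contDiffAt_transition hφ hφ' hy hy'
  have h1 : MDifferentiableAt 𝓘(ℝ, Coord n) 𝓘(ℝ, Coord n) (φ' ∘ φ.symm) y :=
    (h0.differentiableAt (by simp)).mdifferentiableAt
  have h2 : MDifferentiableAt 𝓘(ℝ, Coord n) (𝓡 n) φ'.symm ((φ' ∘ φ.symm) y) :=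
    mdifferentiableAt_atlas_symm hφ' (φ'.map_source hy')
  have h3 := mfderiv_comp y h2 h1
  have h4 : φ'.symm ∘ φ' ∘ φ.symm =ᶠ[𝓝 y] φ.symm := by
    have h5 := (φ.continuousAt_symm hy).eventually (φ'.open_source.mem_nhds hy')
    filter_upwards [h5] with z hz
    exact φ'.left_inv hz
  rw [h4.mfderiv_eq, mfderiv_eq_fderiv] at h3
  exact (congrArg (fun L => L v) h3).symm

theorem inChart_transition (hφ : φ ∈ atlas (Coord n) S) (hφ' : φ' ∈ atlas (Coord n) S)
    {y : Coord n} (hy : y ∈ φ.target) (hy' : φ.symm y ∈ φ'.source) (s : BilinField n S)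
    (v w : Coord n) :
    inChart φ s y v w = inChart φ' s (φ' (φ.symm y)) (fderiv ℝ (φ' ∘ φ.symm) y v)
      (fderiv ℝ (φ' ∘ φ.symm) y w) := by
  rw [inChart_apply, inChart_apply, chartInvDeriv_transition hφ hφ' hy hy',
    chartInvDeriv_transition hφ hφ' hy hy', φ'.left_inv hy']

theorem fderiv_transition_surjective (hφ : φ ∈ atlas (Coord n) S) (hφ' : φ' ∈ atlas (Coord n) S)
    {y : Coord n} (hy : y ∈ φ.target) (hy' : φ.symm y ∈ φ'.source) :
    Function.Surjective (fderiv ℝ (φ' ∘ φ.symm) y) := by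
  refine (LinearMap.injective_iff_surjective
    (f := (fderiv ℝ (φ' ∘ φ.symm) y : Coord n →ₗ[ℝ] Coord n))).mp fun v w h => ?_
  refine chartInvDeriv_injective hφ hy ?_
  rw [← chartInvDeriv_transition hφ hφ' hy hy', ← chartInvDeriv_transition hφ hφ' hy hy']
  exact congrArg _ h

theorem contDiff_lorentz : ContDiff ℝ ∞ (lorentz (n := n)) := by
  have h1 : ContDiff ℝ ∞ fun s : Coord n →L[ℝ] Coord n →L[ℝ] ℝ =>
      (s.comp (ContinuousLinearMap.snd ℝ ℝ (Coord n))).flip :=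
    (ContinuousLinearMap.flipₗᵢ ℝ (ℝ × Coord n) (Coord n) ℝ).contDiff.comp
      (contDiff_id.clm_comp contDiff_const)
  exact ((ContinuousLinearMap.flipₗᵢ ℝ (ℝ × Coord n) (ℝ × Coord n) ℝ).contDiff.comp
    (h1.clm_comp contDiff_const)).sub contDiff_const

end Charts

/-! ### The metric of a future end near the singularity -/

namespace FutureEnd

set_option maxSynthPendingDepth 3

variable {n : ℕ} {S : Type*} [TopologicalSpace S] [ChartedSpace (Coord n) S]
  {N : FutureEnd n S} {φ φ' : OpenPartialHomeomorph S (Coord n)}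

theorem rescaledMetric_eq (N : FutureEnd n S) (φ : OpenPartialHomeomorph S (Coord n))
    (q : ℝ × Coord n) : N.rescaledMetric φ q
      = Real.exp (2 * N.ψ q.1 (φ.symm q.2)) • lorentz (inChart φ (N.σ q.1) q.2) := by
  rw [rescaledMetric, metric, smul_smul, ← Real.exp_add, ψt]
  congr 2
  ring

theorem metric_eq (N : FutureEnd n S) (φ : OpenPartialHomeomorph S (Coord n))
    (q : ℝ × Coord n) :
    N.metric φ q = Real.exp (2 * N.f q.1) • N.rescaledMetric φ q := by
  rw [rescaledMetric, smul_smul, ← Real.exp_add]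
  simp

variable [IsManifold (𝓡 n) ∞ S]

namespace IsARW

theorem isMetricAt_rescaledMetric (hN : N.IsARW) (hφ : φ ∈ atlas (Coord n) S) {q : ℝ × Coord n}
    (h1 : q.1 ∈ Ioo N.a 0) (h2 : q.2 ∈ φ.target) : IsMetricAt (N.rescaledMetric φ) q := by
  have hnhds : Ioo N.a 0 ×ˢ φ.target ∈ 𝓝 q :=
    (isOpen_Ioo.prod φ.open_target).mem_nhds ⟨h1, h2⟩
  have hψ : ContDiffAt ℝ ∞ (fun q : ℝ × Coord n => N.ψ q.1 (φ.symm q.2)) q := by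
    have hsymm := contMDiffAt_symm_of_mem_maximalAtlas (I := 𝓡 n) (n := ∞)
      (IsManifold.subset_maximalAtlas hφ) h2
    have e1 : ContMDiffAt 𝓘(ℝ, ℝ × Coord n) (𝓡 n) ∞ (fun q : ℝ × Coord n => φ.symm q.2) q :=
      hsymm.comp q contDiff_snd.contMDiff.contMDiffAt
    have e2 : ContMDiffAt 𝓘(ℝ, ℝ × Coord n) 𝓘(ℝ, ℝ) ∞ (fun q : ℝ × Coord n => q.1) q :=
      contDiff_fst.contMDiff.contMDiffAt
    have e3 : ContMDiffAt (𝓘(ℝ, ℝ).prod (𝓡 n)) 𝓘(ℝ, ℝ) ∞ (fun p : ℝ × S => N.ψ p.1 p.2)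
        (q.1, φ.symm q.2) :=
      hN.ψ_smooth.contMDiffAt ((isOpen_Ioo.prod isOpen_univ).mem_nhds ⟨h1, mem_univ _⟩)
    exact contMDiffAt_iff_contDiffAt.mp (e3.comp q (e2.prodMk e1))
  have hσ : ContDiffAt ℝ ∞ (fun q : ℝ × Coord n => inChart φ (N.σ q.1) q.2) q :=
    (hN.σ_smooth φ hφ).contDiffAt hnhds
  refine ⟨?_, ?_, ?_⟩
  · have h3 : ContDiffAt ℝ ∞ (N.rescaledMetric φ) q := by
      rw [show N.rescaledMetric φ = fun q => Real.exp (2 * N.ψ q.1 (φ.symm q.2)) •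
        lorentz (inChart φ (N.σ q.1) q.2) from funext (N.rescaledMetric_eq φ)]
      exact (Real.contDiff_exp.contDiffAt.comp q (contDiffAt_const.mul hψ)).smul
        (contDiff_lorentz.contDiffAt.comp q hσ)
    exact h3.of_le (by norm_cast)
  · filter_upwards [hnhds] with r hr
    rw [rescaledMetric_eq]
    refine isInvertible_of_nondegenerate fun v hv => ?_
    have h3 := isInvertible_lorentz
      ((hN.σ_scalarProduct _ hr.1).inChart_pos hφ hr.2)
    refine h3.injective ?_
    rw [map_zero]
    exact (smul_eq_zero.mp hv).resolve_left (Real.exp_pos _).ne'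
  · filter_upwards [hnhds] with r hr v w
    rw [rescaledMetric_eq]
    simp only [smul_apply]
    rw [lorentz_symm ((hN.σ_scalarProduct _ hr.1).inChart_symm φ r.2)]

theorem isConformalAt (hN : N.IsARW) (hφ : φ ∈ atlas (Coord n) S) {q : ℝ × Coord n}
    (h1 : q.1 ∈ Ioo N.a 0) (h2 : q.2 ∈ φ.target) :
    IsConformalAt (N.metric φ) (N.rescaledMetric φ) N.f q where
  metric := hN.isMetricAt_rescaledMetric hφ h1 h2
  contDiffAt := ((hN.f_smooth).contDiffAt (isOpen_Ioo.mem_nhds h1)).of_le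
    (by norm_cast)
  eq := Eventually.of_forall fun q => N.metric_eq φ q

theorem isMetricAt (hN : N.IsARW) (hφ : φ ∈ atlas (Coord n) S) {q : ℝ × Coord n}
    (h1 : q.1 ∈ Ioo N.a 0) (h2 : q.2 ∈ φ.target) : IsMetricAt (N.metric φ) q :=
  (hN.isConformalAt hφ h1 h2).isMetricAt

/-- Passing from the chart `φ` to `φ'` is a change of coordinates of the future end. -/
theorem isPullbackAt (hN : N.IsARW) (hφ : φ ∈ atlas (Coord n) S) (hφ' : φ' ∈ atlas (Coord n) S)
    {q : ℝ × Coord n} (h1 : q.1 ∈ Ioo N.a 0) (h2 : q.2 ∈ φ.target)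
    (h3 : φ.symm q.2 ∈ φ'.source) :
    IsPullbackAt (N.metric φ) (N.metric φ') (fun q => (q.1, φ' (φ.symm q.2))) q ∧
      ∀ v, fderiv ℝ (fun q : ℝ × Coord n => (q.1, φ' (φ.symm q.2))) q v
        = (v.1, fderiv ℝ (φ' ∘ φ.symm) q.2 v.2) := by
  have hev : ∀ᶠ r : ℝ × Coord n in 𝓝 q,
      r.1 ∈ Ioo N.a 0 ∧ r.2 ∈ φ.target ∧ φ.symm r.2 ∈ φ'.source := by
    have e1 := (continuous_fst.tendsto q).eventually (isOpen_Ioo.mem_nhds h1)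
    have e2 := (continuous_snd.tendsto q).eventually (φ.open_target.mem_nhds h2)
    have e3 := (continuous_snd.tendsto q).eventually
      ((φ.continuousAt_symm h2).eventually (φ'.open_source.mem_nhds h3))
    filter_upwards [e1, e2, e3] with r a b c using ⟨a, b, c⟩
  have hcd : ∀ r : ℝ × Coord n, r.2 ∈ φ.target → φ.symm r.2 ∈ φ'.source →
      ContDiffAt ℝ ∞ (fun q : ℝ × Coord n => φ' (φ.symm q.2)) r := fun r a b =>
    (contDiffAt_transition hφ hφ' a b).comp r contDiffAt_snd
  have hfd : ∀ r : ℝ × Coord n, r.2 ∈ φ.target → φ.symm r.2 ∈ φ'.source →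
      ∀ v, fderiv ℝ (fun q : ℝ × Coord n => (q.1, φ' (φ.symm q.2))) r v
        = (v.1, fderiv ℝ (φ' ∘ φ.symm) r.2 v.2) := by
    intro r a b v
    have e1 := ((contDiffAt_transition hφ hφ' a b).differentiableAt (by simp)).hasFDerivAt
    have e2 : HasFDerivAt (fun q : ℝ × Coord n => φ' (φ.symm q.2)) _ r :=
      e1.comp r (hasFDerivAt_snd (𝕜 := ℝ) (E := ℝ) (F := Coord n) (p := r))
    have e3 := (hasFDerivAt_fst (𝕜 := ℝ) (E := ℝ) (F := Coord n) (p := r)).prodMk e2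
    rw [e3.fderiv]
    simp
  refine ⟨⟨hN.isMetricAt hφ h1 h2, hN.isMetricAt hφ' h1 (φ'.map_source h3), ?_, ?_, ?_⟩,
    hfd q h2 h3⟩
  · exact (contDiffAt_fst.prodMk (hcd q h2 h3)).of_le (by norm_cast)
  · filter_upwards [hev] with r hr w
    obtain ⟨z, hz⟩ := fderiv_transition_surjective hφ hφ' hr.2.1 hr.2.2 w.2
    exact ⟨(w.1, z), by rw [hfd r hr.2.1 hr.2.2, hz]⟩
  · filter_upwards [hev] with r hr v w
    rw [hfd r hr.2.1 hr.2.2, hfd r hr.2.1 hr.2.2]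
    simp only [metric, smul_apply, lorentz_apply, φ'.left_inv hr.2.2]
    rw [inChart_transition hφ hφ' hr.2.1 hr.2.2]

end IsARW

end FutureEnd

/-! ### The lower bound for the curvature form -/

namespace FutureEnd

section CurvatureBound

set_option maxSynthPendingDepth 3

variable {n : ℕ} {S : Type*} [TopologicalSpace S] [ChartedSpace (Coord n) S]
  {N : FutureEnd n S} {φ φ' : OpenPartialHomeomorph S (Coord n)}

namespace IsARW

theorem γ_pos (hN : N.IsARW) : 0 < N.γ := by
  have := hN.omega_pos
  rw [γ]
  linarith

theorem eventually_mem (hN : N.IsARW) : ∀ᶠ τ in 𝓝[<] (0 : ℝ), τ ∈ Ioo N.a 0 :=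
  Ioo_mem_nhdsLT hN.a_neg

theorem deriv_ne_zero (hN : N.IsARW) {τ : ℝ} (hτ : τ ∈ Ioo N.a 0) : deriv N.f τ ≠ 0 := by
  have := hN.f_deriv_neg τ hτ
  intro h
  rw [h] at this
  simp at this

/-- The mass is positive and `e^{(n + ω - 2) f} → 0`. -/
theorem tendsto_sq_deriv (hN : N.IsARW) :
    Tendsto (fun τ => |deriv N.f τ| ^ 2) (𝓝[<] 0) atTop := by
  obtain ⟨m, hm, h⟩ := hN.mass
  have h1 : Tendsto (fun τ => Real.exp (-((n + N.omega - 2) * N.f τ))) (𝓝[<] 0) atTop := by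
    refine Real.tendsto_exp_atTop.comp (tendsto_neg_atBot_atTop.comp ?_)
    exact hN.f_tendsto.const_mul_atBot hN.omega_pos
  refine (h.pos_mul_atTop hm h1).congr fun τ => ?_
  rw [mul_assoc, ← Real.exp_add, add_neg_cancel, Real.exp_zero, mul_one]

theorem tendsto_inv_deriv (hN : N.IsARW) :
    Tendsto (fun τ => (deriv N.f τ)⁻¹) (𝓝[<] 0) (𝓝 0) := by
  have h1 : Tendsto (fun τ => Real.sqrt (|deriv N.f τ| ^ 2)) (𝓝[<] 0) atTop :=
    Real.tendsto_sqrt_atTop.comp hN.tendsto_sq_deriv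
  rw [tendsto_zero_iff_abs_tendsto_zero]
  refine (tendsto_inv_atTop_zero.comp h1).congr fun τ => ?_
  simp [Real.sqrt_sq_eq_abs, abs_inv]

theorem tendsto_second_deriv (hN : N.IsARW) :
    Tendsto (fun τ => deriv (deriv N.f) τ / deriv N.f τ ^ 2) (𝓝[<] 0) (𝓝 (-N.γ)) := by
  obtain ⟨l, hl⟩ := hN.f_limit
  have h1 : Tendsto (fun τ => (|deriv N.f τ| ^ 2)⁻¹) (𝓝[<] 0) (𝓝 0) :=
    tendsto_inv_atTop_zero.comp hN.tendsto_sq_deriv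
  have h2 := (hl.mul h1).sub_const N.γ
  rw [mul_zero, zero_sub] at h2
  refine h2.congr' ?_
  filter_upwards [hN.eventually_mem] with τ hτ
  have h3 := hN.deriv_ne_zero hτ
  have h4 : iteratedDeriv 2 N.f τ = deriv (deriv N.f) τ := by
    rw [iteratedDeriv_eq_iterate]; rfl
  rw [h4, sq_abs]
  field_simp
  ring

variable [IsManifold (𝓡 n) ∞ S]

/-- The 2-jets of the rescaled metric converge, and the limit metric is `-(dx⁰)² + σbar`. -/
theorem tendsto_jetAt (hN : N.IsARW) (hφ : φ ∈ atlas (Coord n) S) {y : Coord n}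
    (hy : y ∈ φ.target) : ∃ j : Jet (Coord n), j.1 = lorentz (inChart φ N.σbar y) ∧
      j.2.1 = (lorentz (inChart φ N.σbar y)).inverse ∧
      Tendsto (fun q => jetAt (N.rescaledMetric φ) q) (𝓝[<] 0 ×ˢ 𝓝 y) (𝓝 j) := by
  obtain ⟨K, hKc, hyK, hKs⟩ := exists_compact_subset φ.open_target hy
  have hK : K ∈ 𝓝 y := mem_interior_iff_mem_nhds.mp hyK
  have hσ : ContDiffAt ℝ ∞ (inChart φ N.σbar) y :=
    (hN.σbar_smooth φ hφ).contDiffAt (φ.open_target.mem_nhds hy)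
  have hlim : ContDiffAt ℝ ∞ (N.limitMetric φ) (0, y) :=
    contDiff_lorentz.contDiffAt.comp (0, y) (hσ.comp (f := Prod.snd) ((0 : ℝ), y) contDiffAt_snd)
  have key : ∀ k : ℕ, Tendsto (fun q => iteratedFDeriv ℝ k (N.rescaledMetric φ) q)
      (𝓝[<] 0 ×ˢ 𝓝 y) (𝓝 (iteratedFDeriv ℝ k (N.limitMetric φ) (0, y))) := by
    intro k
    refine tendsto_of_tendstoUniformlyOn (hN.metric_tendsto φ hφ K hKs hKc k) hK ?_
    have h1 := hlim.continuousAt_iteratedFDeriv (k := k) (by exact mod_cast le_top)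
    exact ContinuousAt.comp (f := fun y : Coord n => ((0 : ℝ), y)) h1 (by fun_prop)
  have h0 : Tendsto (N.rescaledMetric φ) (𝓝[<] 0 ×ˢ 𝓝 y) (𝓝 (lorentz (inChart φ N.σbar y))) := by
    have h1 := ((continuousMultilinearCurryFin0 ℝ (ℝ × Coord n)
      (ℝ × Coord n →L[ℝ] ℝ × Coord n →L[ℝ] ℝ)).continuous.tendsto _).comp (key 0)
    simpa [Function.comp_def, limitMetric] using h1
  have h1 := ((continuousMultilinearCurryFin1 ℝ (ℝ × Coord n)
      (ℝ × Coord n →L[ℝ] ℝ × Coord n →L[ℝ] ℝ)).continuous.tendsto _).comp (key 1)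
  simp only [Function.comp_def, continuousMultilinearCurryFin1_iteratedFDeriv] at h1
  obtain ⟨L, hL, hLf⟩ := exists_continuous_iteratedFDeriv_two (E := ℝ × Coord n)
    (F := ℝ × Coord n →L[ℝ] ℝ × Coord n →L[ℝ] ℝ)
  have h2 := (hL.tendsto _).comp (key 2)
  simp only [Function.comp_def, hLf] at h2
  have hinv : Tendsto (fun q => (N.rescaledMetric φ q).inverse) (𝓝[<] 0 ×ˢ 𝓝 y)
      (𝓝 (lorentz (inChart φ N.σbar y)).inverse) := by
    obtain ⟨e, he⟩ := isInvertible_lorentz (hN.σbar_scalarProduct.inChart_pos hφ hy)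
    have h3 := (contDiffAt_map_inverse (𝕜 := ℝ) (n := 1) e).continuousAt
    rw [he] at h3
    exact h3.tendsto.comp h0
  exact ⟨(_, _, _, _), rfl, rfl, h0.prodMk_nhds (hinv.prodMk_nhds (h1.prodMk_nhds h2))⟩

end IsARW

/-- The curvature form at the point `q` of the chart `φ` is bounded from below by
`½ min (γ̃, 1) |f'|² e^{2 ψ̃}` times the squared area for the Riemannian metric `(dx⁰)² + σ`. -/
def CurvatureBound (N : FutureEnd n S) (φ : OpenPartialHomeomorph S (Coord n))
    (q : ℝ × Coord n) : Prop :=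
  ∀ X Y : ℝ × Coord n,
    min N.γ 1 / 2 * (|deriv N.f q.1| ^ 2 * Real.exp (2 * N.ψt q.1 (φ.symm q.2)))
      * areaSq (inChart φ (N.σ q.1) q.2) X Y ≤ riemann (N.metric φ) q X Y X Y

/-- The function of the jet of the rescaled metric, of `1 / f'`, `f'' / |f'|²` and of two vectors,
whose positivity expresses the curvature bound. The rescaled metric `k (-(dx⁰)² + σ)` determines
`k` as minus its value at `∂₀`, so that `σ` can be eliminated from the squared area; this keeps the
function a polynomial in the jet, hence continuous. -/
def boundFun (c : ℝ) (z : Jet (Coord n) × ℝ × ℝ × (ℝ × Coord n) × (ℝ × Coord n)) : ℝ :=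
  -(z.1.1 (1, 0) (1, 0)) * z.1.1 (z.1.curv z.2.2.2.1 z.2.2.2.2 z.2.2.2.2 z.2.1 z.2.2.1) z.2.2.2.1
    - c * ((-(z.1.1 (1, 0) (1, 0)) * (z.2.2.2.1.1 * z.2.2.2.1.1)
          + z.1.1 (0, z.2.2.2.1.2) (0, z.2.2.2.1.2))
        * (-(z.1.1 (1, 0) (1, 0)) * (z.2.2.2.2.1 * z.2.2.2.2.1)
          + z.1.1 (0, z.2.2.2.2.2) (0, z.2.2.2.2.2))
      - (-(z.1.1 (1, 0) (1, 0)) * (z.2.2.2.1.1 * z.2.2.2.2.1)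
          + z.1.1 (0, z.2.2.2.1.2) (0, z.2.2.2.2.2)) ^ 2)

theorem continuous_boundFun (c : ℝ) : Continuous (boundFun (n := n) c) := by
  have hA : Continuous fun z : Jet (Coord n) × ℝ × ℝ × (ℝ × Coord n) × (ℝ × Coord n) => z.1.1 :=
    continuous_fst.fst
  have hX : Continuous fun z : Jet (Coord n) × ℝ × ℝ × (ℝ × Coord n) × (ℝ × Coord n) =>
    z.2.2.2.1 := continuous_snd.snd.snd.fst
  have hY : Continuous fun z : Jet (Coord n) × ℝ × ℝ × (ℝ × Coord n) × (ℝ × Coord n) =>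
    z.2.2.2.2 := continuous_snd.snd.snd.snd
  have hk : Continuous fun z : Jet (Coord n) × ℝ × ℝ × (ℝ × Coord n) × (ℝ × Coord n) =>
      -(z.1.1 (1, 0) (1, 0)) :=
    ((hA.clm_apply continuous_const).clm_apply continuous_const).neg
  have hX0 := (continuous_const (y := (0 : ℝ))).prodMk hX.snd
  have hY0 := (continuous_const (y := (0 : ℝ))).prodMk hY.snd
  have hXX := (hk.mul (hX.fst.mul hX.fst)).add ((hA.clm_apply hX0).clm_apply hX0)
  have hYY := (hk.mul (hY.fst.mul hY.fst)).add ((hA.clm_apply hY0).clm_apply hY0)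
  have hXY := (hk.mul (hX.fst.mul hY.fst)).add ((hA.clm_apply hX0).clm_apply hY0)
  exact (hk.mul continuous_curv).sub (continuous_const.mul ((hXX.mul hYY).sub (hXY.pow 2)))

theorem boundFun_eq {s : Coord n →L[ℝ] Coord n →L[ℝ] ℝ} {k : ℝ} {j : Jet (Coord n)}
    (hj : j.1 = k • lorentz s)
    (c t r : ℝ) (X Y : ℝ × Coord n) : boundFun c (j, t, r, X, Y)
      = k * (j.1 (j.curv X Y Y t r) X - c * (k * areaSq s X Y)) := by
  simp only [boundFun, areaSq]
  rw [hj]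
  simp [lorentz_apply]
  ring

variable [IsManifold (𝓡 n) ∞ S]

/-- Near the singularity `boundFun` is positive on all pairs in `orthoPairs`. -/
theorem IsARW.boundFun_pos (hN : N.IsARW) (hφ : φ ∈ atlas (Coord n) S) {y : Coord n}
    (hy : y ∈ φ.target) : {z : (ℝ × Coord n) × (ℝ × Coord n) × (ℝ × Coord n) |
      0 < boundFun (min N.γ 1 / 2) (jetAt (N.rescaledMetric φ) z.1, (deriv N.f z.1.1)⁻¹,
        deriv (deriv N.f) z.1.1 / deriv N.f z.1.1 ^ 2, z.2.1, z.2.2)}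
      ∈ (𝓝[<] 0 ×ˢ 𝓝 y) ×ˢ 𝓝ˢ (orthoPairs n) := by
  obtain ⟨j, hj1, hj2, hj⟩ := hN.tendsto_jetAt hφ hy
  have hs := hN.σbar_scalarProduct.inChart_symm φ y
  have hp := hN.σbar_scalarProduct.inChart_pos hφ hy
  refine isCompact_orthoPairs.mem_prod_nhdsSet_of_forall fun P hP => ?_
  obtain ⟨hX, hY⟩ := orthoPairs_independent (X := P.1) (Y := P.2) hP
  have hl : Tendsto (fun z : (ℝ × Coord n) × (ℝ × Coord n) × (ℝ × Coord n) => z.1)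
      ((𝓝[<] 0 ×ˢ 𝓝 y) ×ˢ 𝓝 P) (𝓝[<] 0 ×ˢ 𝓝 y) := tendsto_fst
  have hl1 : Tendsto (fun z : (ℝ × Coord n) × (ℝ × Coord n) × (ℝ × Coord n) => z.1.1)
      ((𝓝[<] 0 ×ˢ 𝓝 y) ×ˢ 𝓝 P) (𝓝[<] 0) := tendsto_fst.comp hl
  have hlP : Tendsto (fun z : (ℝ × Coord n) × (ℝ × Coord n) × (ℝ × Coord n) => z.2)
      ((𝓝[<] 0 ×ˢ 𝓝 y) ×ˢ 𝓝 P) (𝓝 P) := tendsto_snd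
  have ht := (hj.comp hl).prodMk_nhds ((hN.tendsto_inv_deriv.comp hl1).prodMk_nhds
    ((hN.tendsto_second_deriv.comp hl1).prodMk_nhds (((continuous_fst.tendsto P).comp
      hlP).prodMk_nhds ((continuous_snd.tendsto P).comp hlP))))
  have h1 := ((continuous_boundFun (min N.γ 1 / 2)).tendsto _).comp ht
  have h2 : 0 < boundFun (min N.γ 1 / 2) (j, 0, -N.γ, P.1, P.2) := by
    rw [boundFun_eq (s := inChart φ N.σbar y) (k := 1) (by rw [hj1, one_smul]), one_mul, one_mul,
      sub_pos]
    exact areaSq_lt_curv_limit hs hp hj1 hj2 hN.γ_pos hX hY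
  exact h1.eventually (lt_mem_nhds h2)

/-- The curvature form of the future end in terms of the jet of the rescaled metric. -/
theorem IsARW.riemann_eq (hN : N.IsARW) (hφ : φ ∈ atlas (Coord n) S) {q : ℝ × Coord n}
    (h1 : q.1 ∈ Ioo N.a 0) (h2 : q.2 ∈ φ.target) (X Y : ℝ × Coord n) :
    riemann (N.metric φ) q X Y X Y = Real.exp (2 * N.f q.1) * (deriv N.f q.1 ^ 2 *
      (jetAt (N.rescaledMetric φ) q).1 ((jetAt (N.rescaledMetric φ) q).curv X Y Y
        (deriv N.f q.1)⁻¹ (deriv (deriv N.f) q.1 / deriv N.f q.1 ^ 2)) X) := by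
  rw [riemann, (hN.isConformalAt hφ h1 h2).curvature_eq (hN.deriv_ne_zero h1), N.metric_eq,
    smul_apply, smul_apply, map_smul, smul_apply, smul_eq_mul, smul_eq_mul]
  rfl

theorem IsARW.curvatureBound_of_boundFun (hN : N.IsARW) (hφ : φ ∈ atlas (Coord n) S)
    {q : ℝ × Coord n} (h1 : q.1 ∈ Ioo N.a 0) (h2 : q.2 ∈ φ.target)
    (h : ∀ P ∈ orthoPairs n, 0 < boundFun (min N.γ 1 / 2) (jetAt (N.rescaledMetric φ) q,
      (deriv N.f q.1)⁻¹, deriv (deriv N.f) q.1 / deriv N.f q.1 ^ 2, P.1, P.2)) :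
    N.CurvatureBound φ q := by
  refine (hN.isMetricAt hφ h1 h2).areaSq_le_riemann
    ((hN.σ_scalarProduct _ h1).inChart_symm φ q.2) fun P hP => ?_
  have h3 := h P hP
  rw [boundFun_eq (N.rescaledMetric_eq φ q)] at h3
  have h4 := pos_of_mul_pos_right h3 (Real.exp_pos _).le
  have h5 : Real.exp (2 * N.ψt q.1 (φ.symm q.2))
      = Real.exp (2 * N.f q.1) * Real.exp (2 * N.ψ q.1 (φ.symm q.2)) := by
    rw [← Real.exp_add, ψt, mul_add]
  rw [hN.riemann_eq hφ h1 h2, h5, sq_abs]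
  have h6 := mul_pos (mul_pos (Real.exp_pos (2 * N.f q.1))
    (pow_pos (abs_pos.mpr (hN.deriv_ne_zero h1)) 2)) h4
  rw [sq_abs] at h6
  generalize (jetAt (N.rescaledMetric φ) q).1 ((jetAt (N.rescaledMetric φ) q).curv P.1 P.2 P.2
        (deriv N.f q.1)⁻¹ (deriv (deriv N.f) q.1 / deriv N.f q.1 ^ 2)) P.1 = R at h6 ⊢
  generalize areaSq (inChart φ (N.σ q.1) q.2) P.1 P.2 = Q at h6 ⊢
  linarith

theorem IsARW.eventually_curvatureBound (hN : N.IsARW) (hφ : φ ∈ atlas (Coord n) S) {y : Coord n}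
    (hy : y ∈ φ.target) : ∀ᶠ q in 𝓝[<] 0 ×ˢ 𝓝 y, N.CurvatureBound φ q := by
  have h1 : ∀ᶠ q : ℝ × Coord n in 𝓝[<] 0 ×ˢ 𝓝 y, q.1 ∈ Ioo N.a 0 :=
    tendsto_fst.eventually hN.eventually_mem
  have h2 : ∀ᶠ q : ℝ × Coord n in 𝓝[<] 0 ×ˢ 𝓝 y, q.2 ∈ φ.target :=
    tendsto_snd.eventually (φ.open_target.mem_nhds hy)
  obtain ⟨U, hU, W, hW, hUW⟩ := Filter.mem_prod_iff.mp (hN.boundFun_pos hφ hy)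
  have h3 : ∀ᶠ q in 𝓝[<] 0 ×ˢ 𝓝 y, q ∈ U := hU
  refine (h1.and (h2.and h3)).mono fun q hq => ?_
  refine hN.curvatureBound_of_boundFun hφ hq.1 hq.2.1 fun P hP => ?_
  have h4 := hUW (mk_mem_prod hq.2.2 (subset_of_mem_nhdsSet hW hP))
  rw [mem_ofPred_eq] at h4
  exact h4

/-- The curvature bound does not depend on the chart. -/
theorem IsARW.curvatureBound_of_chart (hN : N.IsARW) (hφ : φ ∈ atlas (Coord n) S)
    (hφ' : φ' ∈ atlas (Coord n) S) {τ : ℝ} (hτ : τ ∈ Ioo N.a 0) {y : Coord n}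
    (hy : y ∈ φ.target) (hy' : φ.symm y ∈ φ'.source)
    (h : N.CurvatureBound φ' (τ, φ' (φ.symm y))) : N.CurvatureBound φ (τ, y) := by
  intro X Y
  obtain ⟨hpull, hfd⟩ := hN.isPullbackAt hφ hφ' (q := (τ, y)) hτ hy hy'
  rw [hpull.riemann_eq, hfd, hfd]
  have h1 := h (X.1, fderiv ℝ (φ' ∘ φ.symm) y X.2) (Y.1, fderiv ℝ (φ' ∘ φ.symm) y Y.2)
  simp only [φ'.left_inv hy', areaSq] at h1
  simp only [areaSq, inChart_transition hφ hφ' hy hy']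
  exact h1

/-- The curvature bound holds near the singularity, uniformly on `S`. -/
theorem IsARW.exists_curvatureBound [CompactSpace S] (hN : N.IsARW) :
    ∃ ε : ℝ, 0 < ε ∧ ∀ φ ∈ atlas (Coord n) S, ∀ y ∈ φ.target, ∀ τ ∈ Ioo N.a 0, -ε < τ →
      N.CurvatureBound φ (τ, y) := by
  -- On a neighbourhood of each point use the chart given there; the bound is independent of it.
  have hloc : {z : ℝ × S | z.1 ∈ Ioo N.a 0 → ∀ φ ∈ atlas (Coord n) S, z.2 ∈ φ.source →
      N.CurvatureBound φ (z.1, φ z.2)} ∈ 𝓝[<] (0 : ℝ) ×ˢ 𝓝ˢ (univ : Set S) := by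
    refine isCompact_univ.mem_prod_nhdsSet_of_forall fun x _ => ?_
    have hx := mem_chart_source (Coord n) x
    have h1 := hN.eventually_curvatureBound (chart_mem_atlas (Coord n) x)
      ((chartAt (Coord n) x).map_source hx)
    have h2 : Tendsto (fun z : ℝ × S => (z.1, chartAt (Coord n) x z.2)) (𝓝[<] (0 : ℝ) ×ˢ 𝓝 x)
        (𝓝[<] (0 : ℝ) ×ˢ 𝓝 (chartAt (Coord n) x x)) :=
      tendsto_fst.prodMk (((chartAt (Coord n) x).continuousAt hx).tendsto.comp tendsto_snd)
    have h3 : ∀ᶠ z : ℝ × S in 𝓝[<] (0 : ℝ) ×ˢ 𝓝 x, z.2 ∈ (chartAt (Coord n) x).source :=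
      tendsto_snd.eventually ((chartAt (Coord n) x).open_source.mem_nhds hx)
    filter_upwards [h2.eventually h1, h3] with z hz hzs hτ φ hφ hzφ
    refine hN.curvatureBound_of_chart hφ (chart_mem_atlas (Coord n) x) hτ (φ.map_source hzφ) ?_ ?_
    · rwa [φ.left_inv hzφ]
    · rwa [φ.left_inv hzφ]
  obtain ⟨U, hU, W, hW, hUW⟩ := Filter.mem_prod_iff.mp hloc
  obtain ⟨l, hl, hlU⟩ := mem_nhdsLT_iff_exists_Ioo_subset.mp hU
  refine ⟨-l, neg_pos.mpr hl, fun φ hφ y hy τ hτ hlτ => ?_⟩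
  rw [neg_neg] at hlτ
  have h1 := hUW (mk_mem_prod (hlU ⟨hlτ, hτ.2⟩) (subset_of_mem_nhdsSet hW (mem_univ (φ.symm y))))
    hτ φ hφ (φ.map_target hy)
  rwa [φ.right_inv hy] at h1

end CurvatureBound

end FutureEnd

/-! ### The curvature form and contractions -/

section Contraction

set_option maxSynthPendingDepth 3

theorem bilin_sum_smul {V ι : Type*} [AddCommGroup V] [Module ℝ V] [Fintype ι]
    (B : V →ₗ[ℝ] V →ₗ[ℝ] ℝ) (x : ι → V) (ξ : ι → ℝ) :
    B (∑ i, ξ i • x i) (∑ j, ξ j • x j) = ∑ i, ∑ j, B (x i) (x j) * ξ i * ξ j := by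
  simp only [map_sum, map_smul, LinearMap.sum_apply, LinearMap.smul_apply, smul_eq_mul,
    Finset.mul_sum]
  rw [Finset.sum_comm]
  exact Finset.sum_congr rfl fun i _ => Finset.sum_congr rfl fun j _ => by ring

variable {V ι : Type*} [NormedAddCommGroup V] [NormedSpace ℝ V] [CompleteSpace V] [Fintype ι]
  {G : V → V →L[ℝ] V →L[ℝ] ℝ} {p : V}

namespace IsMetricAt

theorem riemann_sum_right (h : IsMetricAt G p) (a : V) (x : ι → V) (ξ : ι → ℝ) :
    riemann G p a (∑ i, ξ i • x i) a (∑ j, ξ j • x j)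
      = ∑ i, ∑ j, riemann G p a (x i) a (x j) * ξ i * ξ j := by
  refine bilin_sum_smul (LinearMap.mk₂ ℝ (fun b d => riemann G p a b a d)
    ?_ ?_ ?_ ?_) x ξ <;> intros <;>
    simp only [riemann, h.curvature_eq, map_add, map_sub, map_smul, add_apply, sub_apply,
      smul_apply, smul_eq_mul] <;> ring

theorem riemann_sum_left (h : IsMetricAt G p) (b : V) (x : ι → V) (ξ : ι → ℝ) :
    riemann G p (∑ i, ξ i • x i) b (∑ j, ξ j • x j) b
      = ∑ i, ∑ j, riemann G p (x i) b (x j) b * ξ i * ξ j := by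
  refine bilin_sum_smul (LinearMap.mk₂ ℝ (fun a c => riemann G p a b c b)
    ?_ ?_ ?_ ?_) x ξ <;> intros <;>
    simp only [riemann, h.curvature_eq, map_add, map_sub, map_smul, add_apply, sub_apply,
      smul_apply, smul_eq_mul] <;> ring

/-- The Jacobi endomorphism `c ↦ R(c, b) b`, whose trace is the Ricci curvature of `b`. -/
theorem exists_jacobiMap (h : IsMetricAt G p) (b : V) :
    ∃ L : V →ₗ[ℝ] V, ∀ c, L c = curvature G p c b b :=
  ⟨{  toFun := fun c => curvature G p c b b
      map_add' := fun c c' => by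
        simp only [h.curvature_eq, map_add, add_apply]
        abel
      map_smul' := fun r c => by
        simp only [h.curvature_eq, map_smul, smul_apply, RingHom.id_apply]
        module }, fun _ => rfl⟩

end IsMetricAt

end Contraction

/-! ### The geometry of spacelike graphs -/

theorem sum_smul_coordVec {n : ℕ} (v : Coord n) : ∑ i, v i • coordVec i = v := by
  simpa [coordVec] using (EuclideanSpace.basisFun (Fin n) ℝ).sum_repr v

namespace FutureEnd

section Graph

set_option maxSynthPendingDepth 3

variable {n : ℕ} {S : Type*} [TopologicalSpace S] {φ : OpenPartialHomeomorph S (Coord n)}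
  {u : S → ℝ} {y : Coord n}

/-- The tangent vector `(du ξ, ξ)` of the graph above `ξ`. -/
def tangent (u : S → ℝ) (φ : OpenPartialHomeomorph S (Coord n)) (y : Coord n) :
    Coord n →L[ℝ] ℝ × Coord n :=
  (du u φ y).prod (ContinuousLinearMap.id ℝ (Coord n))

theorem tangent_apply (ξ : Coord n) : tangent u φ y ξ = (du u φ y ξ, ξ) := rfl

theorem tangent_coordVec (i : Fin n) : tangent u φ y (coordVec i) = tangentVec u φ y i := rfl

theorem sum_smul_tangentVec (ξ : Fin n → ℝ) :
    ∑ i, ξ i • tangentVec u φ y i = tangent u φ y (WithLp.toLp 2 ξ) := by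
  rw [← sum_smul_coordVec (WithLp.toLp 2 ξ), map_sum]
  simp only [map_smul, tangent_coordVec]

variable [ChartedSpace (Coord n) S] {N : FutureEnd n S}

theorem metric_graphPt (N : FutureEnd n S) (u : S → ℝ) (φ : OpenPartialHomeomorph S (Coord n))
    (y : Coord n) (X Y : ℝ × Coord n) : N.metric φ (graphPt u φ y) X Y
      = Real.exp (2 * N.ψt (u (φ.symm y)) (φ.symm y))
        * (inChart φ (N.σ (u (φ.symm y))) y X.2 Y.2 - X.1 * Y.1) := by
  rw [metric, graphPt, smul_apply, smul_apply, lorentz_apply, smul_eq_mul]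

theorem sum_inducedMetric (N : FutureEnd n S) (u : S → ℝ) (φ : OpenPartialHomeomorph S (Coord n))
    (y : Coord n) (ξ : Fin n → ℝ) :
    ∑ i, ∑ j, N.inducedMetric u φ y i j * ξ i * ξ j = N.metric φ (graphPt u φ y)
      (tangent u φ y (WithLp.toLp 2 ξ)) (tangent u φ y (WithLp.toLp 2 ξ)) := by
  rw [← sum_smul_tangentVec]
  simp only [inducedMetric, Matrix.of_apply, map_sum, map_smul, sum_apply, smul_apply, smul_eq_mul,
    Finset.mul_sum]
  rw [Finset.sum_comm]
  exact Finset.sum_congr rfl fun i _ => Finset.sum_congr rfl fun j _ => by ring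

theorem IsARW.mul_weight_nonneg (hN : N.IsARW) (u : S → ℝ) (φ : OpenPartialHomeomorph S (Coord n))
    (y : Coord n) : 0 ≤ min N.γ 1 / 2 * N.weight u φ y :=
  mul_nonneg (half_pos (lt_min hN.γ_pos one_pos)).le (mul_nonneg (sq_nonneg _) (Real.exp_pos _).le)

variable [IsManifold (𝓡 n) ∞ S]

theorem IsARW.inChart_gradU (hN : N.IsARW) (hφ : φ ∈ atlas (Coord n) S)
    (h1 : u (φ.symm y) ∈ Ioo N.a 0) (hy : y ∈ φ.target) :
    inChart φ (N.σ (u (φ.symm y))) y (N.gradU u φ y) = du u φ y :=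
  (isInvertible_of_pos ((hN.σ_scalarProduct _ h1).inChart_pos hφ hy)).self_apply_inverse _

/-- The gradient of a spacelike graph has length less than one. -/
theorem IsARW.du_gradU_lt_one (hN : N.IsARW) (hφ : φ ∈ atlas (Coord n) S)
    (h1 : u (φ.symm y) ∈ Ioo N.a 0) (hy : y ∈ φ.target) (hg : (N.inducedMetric u φ y).PosDef) :
    du u φ y (N.gradU u φ y) < 1 := by
  have hD := hN.inChart_gradU hφ h1 hy
  by_cases h : N.gradU u φ y = 0
  · rw [h, map_zero]
    exact one_pos
  have h2 := (hN.σ_scalarProduct _ h1).inChart_pos hφ hy _ h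
  rw [hD] at h2
  have h3 : (N.gradU u φ y).ofLp ≠ 0 := fun h3 => h (by simpa using congrArg (WithLp.toLp 2) h3)
  have h4 := hg.dotProduct_mulVec_pos h3
  have h5 := N.sum_inducedMetric u φ y (N.gradU u φ y).ofLp
  have h6 : star (N.gradU u φ y).ofLp ⬝ᵥ (N.inducedMetric u φ y).mulVec (N.gradU u φ y).ofLp
      = ∑ i, ∑ j, N.inducedMetric u φ y i j * (N.gradU u φ y).ofLp i * (N.gradU u φ y).ofLp j := by
    simp only [dotProduct, Matrix.mulVec, star_trivial, Finset.mul_sum]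
    exact Finset.sum_congr rfl fun i _ => Finset.sum_congr rfl fun j _ => by ring
  rw [h6, h5, WithLp.toLp_ofLp, metric_graphPt, tangent_apply, hD] at h4
  -- The tangent vector above the gradient has the length `e^{2 ψ̃} (|Du|² - |Du|⁴)`.
  have h7 := pos_of_mul_pos_right h4 (Real.exp_pos _).le
  nlinarith

/-- The squared area spanned by the normal and a tangent vector of the graph bounds the induced
metric. With `p = |Du|²`, `s = σ(ξ, ξ)` and `r = du ξ`, and up to powers of `e^{ψ̃}`, the squared
area is `((1 + p) (r² + s) - 4 r²) / (1 - p)`; that this is at least `s - r²` is the Cauchy-Schwarz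
inequality `r² ≤ p s`. -/
theorem IsARW.metric_tangent_le (hN : N.IsARW) (hφ : φ ∈ atlas (Coord n) S)
    (h1 : u (φ.symm y) ∈ Ioo N.a 0) (hy : y ∈ φ.target) (hg : (N.inducedMetric u φ y).PosDef)
    (ξ : Coord n) :
    Real.exp (-2 * N.ψt (u (φ.symm y)) (φ.symm y)) *
        N.metric φ (graphPt u φ y) (tangent u φ y ξ) (tangent u φ y ξ)
      ≤ Real.exp (2 * N.ψt (u (φ.symm y)) (φ.symm y)) *
        areaSq (inChart φ (N.σ (u (φ.symm y))) y) (N.normal u φ y) (tangent u φ y ξ) := by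
  have hD := hN.inChart_gradU hφ h1 hy
  have hp := hN.du_gradU_lt_one hφ h1 hy hg
  have hcs := cauchy_schwarz ((hN.σ_scalarProduct _ h1).inChart_symm φ y)
    ((hN.σ_scalarProduct _ h1).inChart_pos hφ hy) (N.gradU u φ y) ξ
  have hv : 0 < N.v u φ y := Real.sqrt_pos.mpr (sub_pos.mpr hp)
  have hv2 : N.v u φ y ^ 2 = 1 - du u φ y (N.gradU u φ y) :=
    Real.sq_sqrt (sub_pos.mpr hp).le
  have hE : Real.exp (2 * N.ψt (u (φ.symm y)) (φ.symm y))
      * Real.exp (-N.ψt (u (φ.symm y)) (φ.symm y)) ^ 2 = 1 := by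
    rw [← Real.exp_nat_mul, ← Real.exp_add]
    simp
  have hE' : Real.exp (-2 * N.ψt (u (φ.symm y)) (φ.symm y))
      * Real.exp (2 * N.ψt (u (φ.symm y)) (φ.symm y)) = 1 := by
    rw [← Real.exp_add]
    simp
  have hA : areaSq (inChart φ (N.σ (u (φ.symm y))) y) (N.normal u φ y) (tangent u φ y ξ)
      = ((N.v u φ y)⁻¹ * Real.exp (-N.ψt (u (φ.symm y)) (φ.symm y))) ^ 2 *
        areaSq (inChart φ (N.σ (u (φ.symm y))) y) (1, N.gradU u φ y) (tangent u φ y ξ) := by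
    have := areaSq_smul_smul (inChart φ (N.σ (u (φ.symm y))) y) (1, N.gradU u φ y)
      (tangent u φ y ξ) (-((N.v u φ y)⁻¹ * Real.exp (-N.ψt (u (φ.symm y)) (φ.symm y)))) 1
    rw [one_smul, neg_sq, one_pow, mul_one] at this
    exact this
  rw [hA, metric_graphPt, ← mul_assoc, hE', one_mul, mul_pow, ← mul_assoc, mul_left_comm, hE,
    mul_one, areaSq, inv_pow, hv2, inv_mul_eq_div, le_div_iff₀ (sub_pos.mpr hp)]
  simp only [tangent_apply, hD] at hcs ⊢
  nlinarith

/-- The curvature form in the direction of the normal is bounded from below by the induced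
metric. -/
theorem IsARW.le_sum_riemann (hN : N.IsARW) (hφ : φ ∈ atlas (Coord n) S)
    (h1 : u (φ.symm y) ∈ Ioo N.a 0) (hy : y ∈ φ.target) (hg : (N.inducedMetric u φ y).PosDef)
    (hC : N.CurvatureBound φ (graphPt u φ y)) (ξ : Fin n → ℝ) :
    min N.γ 1 / 2 * N.weight u φ y * ∑ i, ∑ j, N.inducedMetric u φ y i j * ξ i * ξ j
        ≤ ∑ i, ∑ j, riemann (N.metric φ) (graphPt u φ y) (N.normal u φ y) (tangentVec u φ y i)
          (N.normal u φ y) (tangentVec u φ y j) * ξ i * ξ j ∧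
      min N.γ 1 / 2 * N.weight u φ y * ∑ i, ∑ j, N.inducedMetric u φ y i j * ξ i * ξ j
        ≤ ∑ i, ∑ j, riemann (N.metric φ) (graphPt u φ y) (tangentVec u φ y i) (N.normal u φ y)
          (tangentVec u φ y j) (N.normal u φ y) * ξ i * ξ j := by
  have hG : IsMetricAt (N.metric φ) (graphPt u φ y) := hN.isMetricAt hφ h1 hy
  rw [← hG.riemann_sum_right, ← hG.riemann_sum_left, sum_inducedMetric, sum_smul_tangentVec]
  have h2 := hN.metric_tangent_le hφ h1 hy hg (WithLp.toLp 2 ξ)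
  have h3 : min N.γ 1 / 2 * N.weight u φ y * N.metric φ (graphPt u φ y)
        (tangent u φ y (WithLp.toLp 2 ξ)) (tangent u φ y (WithLp.toLp 2 ξ))
      ≤ min N.γ 1 / 2 * (|deriv N.f (u (φ.symm y))| ^ 2
        * Real.exp (2 * N.ψt (u (φ.symm y)) (φ.symm y)))
        * areaSq (inChart φ (N.σ (u (φ.symm y))) y) (N.normal u φ y)
          (tangent u φ y (WithLp.toLp 2 ξ)) := by
    have h4 : 0 ≤ min N.γ 1 / 2 * |deriv N.f (u (φ.symm y))| ^ 2 :=
      mul_nonneg (half_pos (lt_min hN.γ_pos one_pos)).le (sq_nonneg _)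
    have h5 := mul_le_mul_of_nonneg_left h2 h4
    rw [weight]
    linarith
  refine ⟨h3.trans (hC _ _), h3.trans ?_⟩
  have h6 := hC (tangent u φ y (WithLp.toLp 2 ξ)) (N.normal u φ y)
  rw [areaSq_comm ((hN.σ_scalarProduct (graphPt u φ y).1 h1).inChart_symm φ _)] at h6
  exact h6

theorem IsARW.le_curvatureTerm (hN : N.IsARW) (hn : 1 ≤ n) (hφ : φ ∈ atlas (Coord n) S)
    (h1 : u (φ.symm y) ∈ Ioo N.a 0) (hy : y ∈ φ.target) (hg : (N.inducedMetric u φ y).PosDef)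
    (hh : (N.secondFF u φ y).PosDef) (hC : N.CurvatureBound φ (graphPt u φ y))
    {F : (Fin n → ℝ) → ℝ} (hF : IsClassKStar F) :
    min N.γ 1 / 2 * N.weight u φ y ≤ N.curvatureTerm u φ y F := by
  have hc := hN.mul_weight_nonneg u φ y
  refine (le_mul_of_one_le_right hc (by exact_mod_cast hn)).trans
    (hF.le_sum_Fup_mul (M := Matrix.of fun i j => riemann (N.metric φ) (graphPt u φ y)
      (N.normal u φ y) (tangentVec u φ y i) (N.normal u φ y) (tangentVec u φ y j)) hg hh hc
      fun ξ => (hN.le_sum_riemann hφ h1 hy hg hC ξ).1)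

/-- A vector orthogonal to the normal is tangent to the graph. -/
theorem IsARW.eq_tangent (hN : N.IsARW) (hφ : φ ∈ atlas (Coord n) S)
    (h1 : u (φ.symm y) ∈ Ioo N.a 0) (hy : y ∈ φ.target) (hg : (N.inducedMetric u φ y).PosDef)
    {z : ℝ × Coord n} (hz : N.metric φ (graphPt u φ y) z (N.normal u φ y) = 0) :
    z = tangent u φ y z.2 := by
  have hv : 0 < N.v u φ y := Real.sqrt_pos.mpr (sub_pos.mpr (hN.du_gradU_lt_one hφ h1 hy hg))
  rw [normal, map_smul, smul_eq_mul, metric_graphPt,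
    (hN.σ_scalarProduct _ h1).inChart_symm φ y, hN.inChart_gradU hφ h1 hy, mul_one] at hz
  have h2 : -((N.v u φ y)⁻¹ * Real.exp (-N.ψt (u (φ.symm y)) (φ.symm y))) ≠ 0 :=
    neg_ne_zero.mpr (mul_pos (inv_pos.mpr hv) (Real.exp_pos _)).ne'
  have h3 := (mul_eq_zero.mp ((mul_eq_zero.mp hz).resolve_left h2)).resolve_left
    (Real.exp_pos _).ne'
  exact Prod.ext (sub_eq_zero.mp h3).symm rfl

/-- The Ricci curvature of the normal is the trace of the curvature form over the tangent space of
the graph. -/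
theorem IsARW.ricciTerm_eq (hN : N.IsARW) (hφ : φ ∈ atlas (Coord n) S)
    (h1 : u (φ.symm y) ∈ Ioo N.a 0) (hy : y ∈ φ.target) (hg : (N.inducedMetric u φ y).PosDef) :
    N.ricciTerm u φ y = ∑ i, ∑ j, (N.inducedMetric u φ y)⁻¹ i j *
      riemann (N.metric φ) (graphPt u φ y) (tangentVec u φ y i) (N.normal u φ y)
        (tangentVec u φ y j) (N.normal u φ y) := by
  have hG : IsMetricAt (N.metric φ) (graphPt u φ y) := hN.isMetricAt hφ h1 hy
  obtain ⟨L, hL⟩ := hG.exists_jacobiMap (N.normal u φ y)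
  -- The image of `L` is orthogonal to the normal, so that `L` has the same trace as its restriction
  -- to the tangent space of the graph.
  have hLt : ∀ c, L c = tangent u φ y (L c).2 := fun c =>
    hN.eq_tangent hφ h1 hy hg (by
      rw [hL]
      exact hG.riemann_self_left (N.normal u φ y) c (N.normal u φ y))
  have htan : ∀ c : Coord n, L (tangent u φ y c) = du u φ y c • L (1, 0) + L (0, c) := fun c => by
    rw [← map_smul, ← map_add]
    simp [tangent_apply]
  set A : Matrix (Fin n) (Fin n) ℝ := Matrix.of fun j l => (L (tangentVec u φ y j)).2 l with hA
  have htr : N.ricciTerm u φ y = A.trace := by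
    have h2 : (L (1, 0)).1 = ∑ i, (L (1, 0)).2 i * du u φ y (coordVec i) := by
      have h3 := congrArg Prod.fst (hLt (1, 0))
      rw [tangent_apply] at h3
      conv_rhs at h3 => rw [← sum_smul_coordVec (L (1, 0)).2]
      simpa only [map_sum, map_smul, smul_eq_mul] using h3
    rw [ricciTerm, ricci, ← hL, h2, ← Finset.sum_add_distrib]
    refine Finset.sum_congr rfl fun i _ => ?_
    rw [hA, Matrix.diag_apply, Matrix.of_apply, ← tangent_coordVec, htan, ← hL]
    simp [mul_comm]
  have hM : ∀ i j, riemann (N.metric φ) (graphPt u φ y) (tangentVec u φ y i) (N.normal u φ y)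
      (tangentVec u φ y j) (N.normal u φ y) = (A * N.inducedMetric u φ y) j i := by
    intro i j
    rw [riemann, ← hL, hLt, ← WithLp.toLp_ofLp 2 (L (tangentVec u φ y j)).2,
      ← sum_smul_tangentVec]
    simp [Matrix.mul_apply, hA, inducedMetric, sum_apply]
  simp only [hM]
  have h4 : ∑ i, ∑ j, (N.inducedMetric u φ y)⁻¹ i j * (A * N.inducedMetric u φ y) j i
      = ((N.inducedMetric u φ y)⁻¹ * (A * N.inducedMetric u φ y)).trace := by
    simp only [Matrix.trace, Matrix.diag_apply, Matrix.mul_apply (M := (N.inducedMetric u φ y)⁻¹)]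
  rw [h4, htr, Matrix.trace_mul_comm, mul_assoc,
    Matrix.mul_nonsing_inv _ ((Matrix.isUnit_iff_isUnit_det _).mp hg.isUnit), mul_one]

theorem IsARW.le_ricciTerm (hN : N.IsARW) (hn : 1 ≤ n) (hφ : φ ∈ atlas (Coord n) S)
    (h1 : u (φ.symm y) ∈ Ioo N.a 0) (hy : y ∈ φ.target) (hg : (N.inducedMetric u φ y).PosDef)
    (hC : N.CurvatureBound φ (graphPt u φ y)) :
    min N.γ 1 / 2 * N.weight u φ y ≤ N.ricciTerm u φ y := by
  rw [hN.ricciTerm_eq hφ h1 hy hg]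
  refine (le_mul_of_one_le_right (hN.mul_weight_nonneg u φ y) (by exact_mod_cast hn)).trans
    (le_sum_inv_mul (M := Matrix.of fun i j => riemann (N.metric φ) (graphPt u φ y)
      (tangentVec u φ y i) (N.normal u φ y) (tangentVec u φ y j) (N.normal u φ y)) hg
      fun ξ => (hN.le_sum_riemann hφ h1 hy hg hC ξ).2)

end Graph

end FutureEnd

/-! ### The inverse curvature flow -/

namespace FutureEnd

theorem zero_mem_timeInterval {T : EReal} (hT : 0 < T) : (0 : ℝ) ∈ timeInterval T :=
  ⟨le_rfl, by simpa using hT⟩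

theorem ordConnected_timeInterval (T : EReal) : (timeInterval T).OrdConnected :=
  ⟨fun _ hs _ ht _ hr => ⟨hs.1.trans hr.1, (EReal.coe_le_coe_iff.mpr hr.2).trans_lt ht.2⟩⟩

variable {n : ℕ} {S : Type*} [TopologicalSpace S] [ChartedSpace (Coord n) S]
  {N : FutureEnd n S} {F : (Fin n → ℝ) → ℝ} {T : EReal} {x : ℝ → S → ℝ × S} {u : ℝ → S → ℝ}

/-- Along the flow the time coordinate `x⁰` does not decrease: `F` is non-negative on convex
hypersurfaces and `-ν` is future directed. -/
theorem IsIFCF.fst_le_fst (h : N.IsIFCF F T x u) (hF : IsClassKStar F) (ξ : S) {t : ℝ}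
    (ht : t ∈ timeInterval T) : (x 0 ξ).1 ≤ (x t ξ).1 := by
  have hder : ∀ s ∈ timeInterval T, ∃ d : ℝ, 0 ≤ d ∧
      HasDerivWithinAt (fun r => (x r ξ).1) d (timeInterval T) s := by
    intro s hs
    set φ := chartAt (Coord n) (x s ξ).2
    have hφ : φ ∈ atlas (Coord n) S := chart_mem_atlas _ _
    have hsrc : (x s ξ).2 ∈ φ.source := mem_chart_source _ _
    have hg := (h.spacelike s hs).spacelike φ hφ _ (φ.map_source hsrc)
    have hh := h.convex s hs φ hφ _ (φ.map_source hsrc)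
    have h1 := (hasFDerivAt_fst (𝕜 := ℝ) (E := ℝ) (F := Coord n)).comp_hasDerivWithinAt s
      (h.evolution s hs ξ φ hφ hsrc)
    refine ⟨_, ?_, h1⟩
    have h2 : 0 ≤ N.graphCurvature (u s) φ (φ (x s ξ).2) F := hF.matrixFun_nonneg hg hh
    have h3 : 0 ≤ N.v (u s) φ (φ (x s ξ).2) := Real.sqrt_nonneg _
    simp only [normal, ContinuousLinearMap.coe_fst', Prod.smul_fst, smul_eq_mul, mul_one,
      neg_mul_neg]
    positivity
  choose! d hd hdx using hder
  have hmono : MonotoneOn (fun r => (x r ξ).1) (timeInterval T) :=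
    monotoneOn_of_hasDerivWithinAt_nonneg (ordConnected_timeInterval T).convex
      (fun s hs => (hdx s hs).continuousWithinAt)
      (fun s hs => (hdx s (interior_subset hs)).mono interior_subset)
      fun s hs => hd s (interior_subset hs)
  exact hmono (zero_mem_timeInterval h.T_pos) ht ht.1

/-- The lower bound for the time coordinate of the initial hypersurface holds on all leaves. -/
theorem IsIFCF.lt_leaf (h : N.IsIFCF F T x u) (hF : IsClassKStar F) {b : ℝ} (hb : ∀ p, b < u 0 p)
    {t : ℝ} (ht : t ∈ timeInterval T) (p : S) : b < u t p := by
  obtain ⟨Φ, hΦ⟩ := h.embedding t ht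
  obtain ⟨Φ₀, hΦ₀⟩ := h.embedding 0 (zero_mem_timeInterval h.T_pos)
  have h1 := h.fst_le_fst hF (Φ.symm p) ht
  rw [hΦ, hΦ₀, Φ.apply_symm_apply] at h1
  exact (hb _).trans_le h1

end FutureEnd

end ARW

end

theorem mainTheorem3 {n : ℕ} (hn : 1 ≤ n) {S : Type*} [TopologicalSpace S] [T2Space S]
    [CompactSpace S] [ChartedSpace (ARW.Coord n) S] [IsManifold (𝓡 n) ∞ S]
    (N : ARW.FutureEnd n S) (hN : N.IsARW) :
    ((N.γ < 1 → N.NonnegSectional) →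
      ∃ ε : ℝ, 0 < ε ∧ ∃ c : ℝ, 0 < c ∧
        ∀ F : (Fin n → ℝ) → ℝ, ARW.IsClassKStar F →
          (∀ u : S → ℝ, N.IsSpacelikeGraph u → N.IsStrictlyConvex u → (∀ x, -ε < u x) →
            ∀ φ ∈ atlas (ARW.Coord n) S, ∀ y ∈ φ.target,
              c * N.weight u φ y ≤ N.curvatureTerm u φ y F) ∧
          (∀ (T : EReal) (x : ℝ → S → ℝ × S) (u : ℝ → S → ℝ), N.IsIFCF F T x u →
            (∀ p, -ε < u 0 p) →
            ∀ t ∈ ARW.FutureEnd.timeInterval T, ∀ φ ∈ atlas (ARW.Coord n) S, ∀ y ∈ φ.target,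
              c * N.weight (u t) φ y ≤ N.curvatureTerm (u t) φ y F)) ∧
    (∃ ε : ℝ, 0 < ε ∧ ∃ c : ℝ, 0 < c ∧
      (∀ u : S → ℝ, N.IsSpacelikeGraph u → N.IsWeaklyConvex u → (∀ x, -ε < u x) →
        ∀ φ ∈ atlas (ARW.Coord n) S, ∀ y ∈ φ.target,
          c * N.weight u φ y ≤ N.ricciTerm u φ y) ∧
      (∀ F : (Fin n → ℝ) → ℝ, ARW.IsClassKStar F →
        ∀ (T : EReal) (x : ℝ → S → ℝ × S) (u : ℝ → S → ℝ), N.IsIFCF F T x u →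
          (∀ p, -ε < u 0 p) →
          ∀ t ∈ ARW.FutureEnd.timeInterval T, ∀ φ ∈ atlas (ARW.Coord n) S, ∀ y ∈ φ.target,
            c * N.weight (u t) φ y ≤ N.ricciTerm (u t) φ y)) := by
  obtain ⟨ε, hε, hC⟩ := hN.exists_curvatureBound
  have hc : 0 < min N.γ 1 / 2 := half_pos (lt_min hN.γ_pos one_pos)
  have hCu : ∀ u : S → ℝ, N.IsSpacelikeGraph u → (∀ x, -ε < u x) →
      ∀ φ ∈ atlas (ARW.Coord n) S, ∀ y ∈ φ.target,
        N.CurvatureBound φ (ARW.FutureEnd.graphPt u φ y) :=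
    fun u hu hεu φ hφ y hy => hC φ hφ y hy _ (hu.mem _) (hεu _)
  refine ⟨fun _ => ⟨ε, hε, _, hc, fun F hF => ⟨?_, ?_⟩⟩, ε, hε, _, hc, ?_, ?_⟩
  · intro u hu hcu hεu φ hφ y hy
    exact hN.le_curvatureTerm hn hφ (hu.mem _) hy (hu.spacelike φ hφ y hy) (hcu φ hφ y hy)
      (hCu u hu hεu φ hφ y hy) hF
  · intro T x u h hε0 t ht φ hφ y hy
    have hu := h.spacelike t ht
    exact hN.le_curvatureTerm hn hφ (hu.mem _) hy (hu.spacelike φ hφ y hy) (h.convex t ht φ hφ y hy)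
      (hCu _ hu (h.lt_leaf hF hε0 ht) φ hφ y hy) hF
  · intro u hu _ hεu φ hφ y hy
    exact hN.le_ricciTerm hn hφ (hu.mem _) hy (hu.spacelike φ hφ y hy) (hCu u hu hεu φ hφ y hy)
  · intro F hF T x u h hε0 t ht φ hφ y hy
    have hu := h.spacelike t ht
    exact hN.le_ricciTerm hn hφ (hu.mem _) hy (hu.spacelike φ hφ y hy)
      (hCu _ hu (h.lt_leaf hF hε0 ht) φ hφ y hy)
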